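/- Let $\Bbbk$ be a field of characteristic $0$ and let $Q$ be a finite connected quiver with vertex set $Q_0\neq\emptyset$ and arrow set $Q_1\neq\emptyset$. Paths are composed from left to right, $\Bbbk Q$ is the path algebra, and $A=\Bbbk Q/I$ is graded by path length. Consider the conditions: (a) every vertex is the source of at most two arrows and the target of at most two arrows; (b) whenever $\beta\neq\beta'$ are arrows ending where the arrow $\alpha$ starts, exactly one of $\beta\alpha,\beta'\alpha$ lies in $I$; whenever $\beta\ne\beta'$ are arrows starting where $\alpha$ ends, exactly one of $\alpha\beta,\alpha\beta'$ lies in $I$; (c) $I$ is generated by paths of length two. If (a)–(c) hold, $A$ is called *gentle* when $\dim_\Bbbk A<\infty$ and *locally gentle* when $\dim_\Bbbk A=\infty$. Let $S=A/A_{\ge1}$, and let $\underline{\mathrm{Ext}}$ denote graded Ext in the category of $\mathbb Z$-graded right $A$-modules. The depth of $A$ is the least $i$ with $\underline{\mathrm{Ext}}^i_A(S,A)\neq0$. The algebra $A$ is *Cohen–Macaulay* if (CM1) its Gelfand–Kirillov dimension equals its depth, or (CM2) there are commuting, homogeneous, algebraically independent elements $x_1,\dots,x_d\in A$, where $d=\mathrm{GKdim}(A)$,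 such that $A$ is a finitely generated free $\Bbbk[x_1,\dots,x_d]$-module. (For gentle and locally gentle algebras, the two conditions are equivalent.) The algebra $A$ is *AS Gorenstein* if its graded injective dimensions as a right and as a left module over itself are equal to the same integer $d<\infty$, $\underline{\mathrm{Ext}}^i_A(S,A)=0$ for $i\ne d$, and $\underline{\mathrm{Ext}}^d_A(S,A)\cong V[\ell]$ for some $\ell\in\mathbb Z$ and some $\Bbbk$-central invertible $(S,S)$-bimodule $V$ concentrated in degree $0$. Let $h_A(t)=\sum_{n\ge0}\dim_\Bbbk(A_n)\,t^n$, regarded as a rational function. For $n\ge0$, let $\widetilde A_n$ be the quiver with vertices $\mathbb Z/(n+1)$ and exactly one arrow $i\to i+1$ for each $i$ (and no others). **Theorem.** Suppose that $A=\Bbbk Q/I$ is locally gentle and Cohen–Macaulay. Then the following are equivalent: (i) $A$ is AS Gorenstein; (ii) $h_A(t^{-1})=\pm t^k h_A(t)$ for some $k\in\mathbb Z$ and some choice of sign; (iii) $Q$ is $\widetilde A_n$ for some $n\ge0$, or $|Q_1|=2|Q_0|$. The equivalence of (i) and (ii) fails for gentle algebras: over every field $\Bbbk$ of characteristic $0$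 there is a gentle algebra that satisfies (CM1), (CM2) and (ii), but is not AS Gorenstein. -/

import Mathlib

universe a u v w

namespace LocGentle

noncomputable section

open CategoryTheory CategoryTheory.Limits
open scoped TensorProduct

/-! ### Graded algebras and graded right modules -/

/-- `𝒜` is a multiplicative grading of the `k`-algebra `A` that is concentrated in degrees `≥ 0`.
Indexing the grading by `ℤ` (with `𝒜 n = 0` for `n < 0`) makes `ℤ`-graded modules and their shifts
convenient to write down. -/
class NonnegGraded {k : Type u} {A : Type a} [Field k] [Ring A] [Algebra k A]
    (𝒜 : ℤ → Submodule k A) : Prop extends SetLike.GradedMonoid 𝒜 where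
  eq_bot_of_neg : ∀ n : ℤ, n < 0 → 𝒜 n = ⊥

section GradedModules

variable {k : Type u} {A : Type a} [Field k] [Ring A] [Algebra k A]

/-- A `ℤ`-graded right module over the graded algebra `(A, 𝒜)`: a family of abelian groups `M i`
with biadditive, unital and associative actions `M i × 𝒜 n → M (i + n)`. (The target degree is a
free index `j` together with a proof of `i + n = j`.) -/
structure GrMod (𝒜 : ℤ → Submodule k A) where
  carrier : ℤ → Type a
  [grp : ∀ i, AddCommGroup (carrier i)]
  act : ∀ {i n j : ℤ}, i + n = j → (carrier i →+ 𝒜 n →+ carrier j)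
  act_one : ∀ {i : ℤ} (h : i + 0 = i) (x : carrier i) (e : 𝒜 0), (e : A) = 1 → act h x e = x
  act_act : ∀ {i n j m l p : ℤ} (h₁ : i + n = j) (h₂ : j + m = l) (h₃ : i + p = l)
    (x : carrier i) (b : 𝒜 n) (c : 𝒜 m) (d : 𝒜 p), (d : A) = b * c →
    act h₂ (act h₁ x b) c = act h₃ x d

attribute [instance] GrMod.grp

variable {𝒜 : ℤ → Submodule k A}

namespace GrMod

/-- Morphisms of graded modules: degree-preserving additive maps commuting with the action. -/
@[ext]
structure Hom (M N : GrMod 𝒜) where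
  app : ∀ i, M.carrier i →+ N.carrier i
  app_act : ∀ {i n j : ℤ} (h : i + n = j) (x : M.carrier i) (b : 𝒜 n),
    app j (M.act h x b) = N.act h (app i x) b

instance : Category (GrMod 𝒜) where
  Hom := Hom
  id M := ⟨fun i => AddMonoidHom.id _, fun _ _ _ => rfl⟩
  comp f g := ⟨fun i => (g.app i).comp (f.app i), fun h x b => by
    simp [f.app_act, g.app_act]⟩

@[ext]
lemma hom_ext {M N : GrMod 𝒜} {f g : M ⟶ N} (h : ∀ i x, f.app i x = g.app i x) : f = g :=
  Hom.ext (funext fun i => AddMonoidHom.ext (h i))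

@[simp] lemma id_app (M : GrMod 𝒜) (i : ℤ) (x : M.carrier i) : Hom.app (𝟙 M) i x = x := rfl

@[simp] lemma comp_app {M N P : GrMod 𝒜} (f : M ⟶ N) (g : N ⟶ P) (i : ℤ) (x : M.carrier i) :
    Hom.app (f ≫ g) i x = g.app i (f.app i x) := rfl

instance (M N : GrMod 𝒜) : Zero (M ⟶ N) := ⟨⟨fun _ => 0, fun _ _ _ => by simp⟩⟩
instance (M N : GrMod 𝒜) : Add (M ⟶ N) :=
  ⟨fun f g => ⟨fun i => f.app i + g.app i, fun h x b => by simp [f.app_act, g.app_act]⟩⟩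
instance (M N : GrMod 𝒜) : Neg (M ⟶ N) :=
  ⟨fun f => ⟨fun i => - f.app i, fun h x b => by simp [f.app_act]⟩⟩

@[simp] lemma zero_app {M N : GrMod 𝒜} (i : ℤ) (x : M.carrier i) :
    Hom.app (0 : M ⟶ N) i x = 0 := rfl
@[simp] lemma add_app {M N : GrMod 𝒜} (f g : M ⟶ N) (i : ℤ) (x : M.carrier i) :
    Hom.app (f + g) i x = f.app i x + g.app i x := rfl
@[simp] lemma neg_app {M N : GrMod 𝒜} (f : M ⟶ N) (i : ℤ) (x : M.carrier i) :
    Hom.app (-f) i x = - f.app i x := rfl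

instance (M N : GrMod 𝒜) : AddCommGroup (M ⟶ N) where
  add_assoc f g h := by ext; simp [add_assoc]
  zero_add f := by ext; simp
  add_zero f := by ext; simp
  add_comm f g := by ext; simp [add_comm]
  neg_add_cancel f := by ext; simp
  nsmul := nsmulRec
  zsmul := zsmulRec

instance : Preadditive (GrMod 𝒜) where
  add_comp _ _ _ f g h := by ext; simp
  comp_add _ _ _ f g h := by ext; simp

/-- The product of a family of graded modules, formed degreewise. -/
def prod {J : Type} (F : J → GrMod 𝒜) : GrMod 𝒜 where
  carrier i := ∀ j, (F j).carrier i
  act {i n j} h :=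
    { toFun := fun x =>
        { toFun := fun b t => (F t).act h (x t) b
          map_zero' := by funext; simp
          map_add' := fun _ _ => by funext; simp }
      map_zero' := by ext; simp
      map_add' := fun _ _ => by ext; simp }
  act_one h x e he := by funext t; exact (F t).act_one h _ e he
  act_act h₁ h₂ h₃ x b c d hd := by funext t; exact (F t).act_act h₁ h₂ h₃ _ b c d hd

lemma hasFiniteProducts : HasFiniteProducts (GrMod 𝒜) := by
  have : HasProducts.{0} (GrMod 𝒜) := hasProducts_of_limit_fans
    (fun {J} F => Fan.mk (prod F) fun j =>
      (⟨fun i => Pi.evalAddMonoidHom _ j, fun _ _ _ => rfl⟩ : Hom (prod F) (F j)))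
    (fun {J} F => Fan.IsLimit.mk _
      (fun s => (⟨fun i => AddMonoidHom.pi fun j => (s.proj j).app i, fun h x b => by
        funext j; exact (s.proj j).app_act h x b⟩ : Hom s.pt (prod F)))
      (fun s j => rfl)
      (fun s m hm => by
        ext i x
        funext j
        exact congrArg (fun f : s.pt ⟶ F j => Hom.app f i x) (hm j)))
  exact hasFiniteProducts_of_hasProducts _

/-- The kernel of a morphism, formed degreewise. -/
def ker {M N : GrMod 𝒜} (f : M ⟶ N) : GrMod 𝒜 where
  carrier i := (f.app i).ker
  act {i n j} h :=
    { toFun := fun x =>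
        { toFun := fun b => ⟨M.act h x.1 b, by
            have hx : f.app i x.1 = 0 := x.2
            simp [AddMonoidHom.mem_ker, f.app_act, hx]⟩
          map_zero' := Subtype.ext (map_zero _)
          map_add' := fun _ _ => Subtype.ext (map_add _ _ _) }
      map_zero' := AddMonoidHom.ext fun b => Subtype.ext (by simp)
      map_add' := fun _ _ => AddMonoidHom.ext fun b => Subtype.ext (by simp) }
  act_one h x e he := Subtype.ext (M.act_one h _ e he)
  act_act h₁ h₂ h₃ x b c d hd := Subtype.ext (M.act_act h₁ h₂ h₃ _ b c d hd)

/-- The inclusion of the kernel. -/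
def kerι {M N : GrMod 𝒜} (f : M ⟶ N) : ker f ⟶ M :=
  (⟨fun i => (f.app i).ker.subtype, fun _ _ _ => rfl⟩ : Hom (ker f) M)

lemma kerι_comp {M N : GrMod 𝒜} (f : M ⟶ N) : kerι f ≫ f = 0 := by
  ext i x; exact x.2

/-- The degreewise kernel is a categorical kernel. -/
def kerIsLimit {M N : GrMod 𝒜} (f : M ⟶ N) : IsLimit (KernelFork.ofι (kerι f) (kerι_comp f)) :=
  KernelFork.IsLimit.ofι _ _
    (fun {W} g hg => (⟨fun i => (g.app i).codRestrict _ fun x =>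
        congrArg (fun t : W ⟶ N => Hom.app t i x) hg, fun h x b => by
          exact Subtype.ext (g.app_act h x b)⟩ : Hom W (ker f)))
    (fun _ _ => rfl)
    (fun {W} g hg m hm => by
      ext i x
      apply Subtype.ext
      exact congrArg (fun t : W ⟶ M => Hom.app t i x) hm)

/-- The quotient of a graded module by a family of subgroups that is stable under the action. -/
def quot (M : GrMod 𝒜) (K : ∀ i, AddSubgroup (M.carrier i))
    (hK : ∀ {i n j : ℤ} (h : i + n = j) (x : M.carrier i) (b : 𝒜 n), x ∈ K i → M.act h x b ∈ K j) :
    GrMod 𝒜 where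
  carrier i := M.carrier i ⧸ K i
  act {i n j} h := QuotientAddGroup.lift (K i)
    ((AddMonoidHom.compHom (QuotientAddGroup.mk' (K j))).comp (M.act h))
    (fun x hx => by
      ext b
      exact (QuotientAddGroup.eq_zero_iff _).2 (hK h x b hx))
  act_one h x e he := by
    induction x using QuotientAddGroup.induction_on with
    | H x => exact congrArg _ (M.act_one h x e he)
  act_act h₁ h₂ h₃ x b c d hd := by
    induction x using QuotientAddGroup.induction_on with
    | H x => exact congrArg _ (M.act_act h₁ h₂ h₃ x b c d hd)

/-- The projection to a quotient. -/
def quotπ (M : GrMod 𝒜) (K : ∀ i, AddSubgroup (M.carrier i))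
    (hK : ∀ {i n j : ℤ} (h : i + n = j) (x : M.carrier i) (b : 𝒜 n),
      x ∈ K i → M.act h x b ∈ K j) : M ⟶ quot M K hK :=
  (⟨fun i => QuotientAddGroup.mk' (K i), fun _ _ _ => rfl⟩ : Hom M (quot M K hK))

/-- The map out of a quotient induced by a morphism that kills the family of subgroups. -/
def quotDesc {M N : GrMod 𝒜} (K : ∀ i, AddSubgroup (M.carrier i))
    (hK : ∀ {i n j : ℤ} (h : i + n = j) (x : M.carrier i) (b : 𝒜 n), x ∈ K i → M.act h x b ∈ K j)
    (g : M ⟶ N) (hg : ∀ i, ∀ x ∈ K i, g.app i x = 0) : quot M K hK ⟶ N :=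
  (⟨fun i => QuotientAddGroup.lift (K i) (g.app i) (hg i), fun h x b => by
      induction x using QuotientAddGroup.induction_on with
      | H x => exact g.app_act h x b⟩ : Hom (quot M K hK) N)

lemma range_stable {M N : GrMod 𝒜} (f : M ⟶ N) {i n j : ℤ} (h : i + n = j) (x : N.carrier i)
    (b : 𝒜 n) (hx : x ∈ (f.app i).range) : N.act h x b ∈ (f.app j).range := by
  obtain ⟨y, rfl⟩ := hx
  exact ⟨M.act h y b, f.app_act h y b⟩

/-- The cokernel of a morphism, formed degreewise. -/
def coker {M N : GrMod 𝒜} (f : M ⟶ N) : GrMod 𝒜 :=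
  quot N (fun i => (f.app i).range) (range_stable f)

/-- The projection to the cokernel. -/
def cokerπ {M N : GrMod 𝒜} (f : M ⟶ N) : N ⟶ coker f := quotπ N _ (range_stable f)

lemma comp_cokerπ {M N : GrMod 𝒜} (f : M ⟶ N) : f ≫ cokerπ f = 0 := by
  ext i x
  exact (QuotientAddGroup.eq_zero_iff _).2 ⟨x, rfl⟩

/-- The degreewise cokernel is a categorical cokernel. -/
def cokerIsColimit {M N : GrMod 𝒜} (f : M ⟶ N) :
    IsColimit (CokernelCofork.ofπ (cokerπ f) (comp_cokerπ f)) :=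
  CokernelCofork.IsColimit.ofπ _ _
    (fun {W} g hg => quotDesc _ (range_stable f) g (by
      rintro i _ ⟨y, rfl⟩
      exact congrArg (fun t : M ⟶ W => Hom.app t i y) hg))
    (fun _ _ => rfl)
    (fun {W} g hg m hm => by
      ext i x
      obtain ⟨x, rfl⟩ := QuotientAddGroup.mk_surjective x
      exact congrArg (fun t : N ⟶ W => Hom.app t i x) hm)

lemma injective_of_mono {M N : GrMod 𝒜} (f : M ⟶ N) [Mono f] (i : ℤ) :
    Function.Injective (f.app i) := by
  rw [injective_iff_map_eq_zero]
  intro x hx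
  have h : kerι f = 0 := by rw [← cancel_mono f, kerι_comp, zero_comp]
  exact congrArg (fun t : ker f ⟶ M => Hom.app t i ⟨x, hx⟩) h

lemma surjective_of_epi {M N : GrMod 𝒜} (f : M ⟶ N) [Epi f] (i : ℤ) :
    Function.Surjective (f.app i) := by
  intro y
  have h : cokerπ f = 0 := by rw [← cancel_epi f, comp_cokerπ, comp_zero]
  exact (QuotientAddGroup.eq_zero_iff y).1
    (congrArg (fun t : N ⟶ coker f => Hom.app t i y) h)

/-- A monomorphism is the kernel of its cokernel. -/
lemma normalMono {M N : GrMod 𝒜} (f : M ⟶ N) [Mono f] : Nonempty (NormalMono f) := ⟨{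
  Z := coker f
  g := cokerπ f
  w := comp_cokerπ f
  isLimit := KernelFork.IsLimit.ofι' _ _ fun {W} g hg => by
    have hr : ∀ i x, ∃ y, f.app i y = g.app i x := fun i x =>
      (QuotientAddGroup.eq_zero_iff (g.app i x)).1
        (congrArg (fun t : W ⟶ coker f => Hom.app t i x) hg)
    choose l hl using hr
    refine ⟨(⟨fun i => AddMonoidHom.mk' (l i) fun x y => injective_of_mono f i ?_,
      fun h x b => injective_of_mono f _ ?_⟩ : Hom W M), ?_⟩
    · simp [hl]
    · simp [hl, f.app_act, g.app_act]
    · ext i x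
      exact hl i x }⟩

/-- An epimorphism is the cokernel of its kernel. -/
lemma normalEpi {M N : GrMod 𝒜} (f : M ⟶ N) [Epi f] : Nonempty (NormalEpi f) := ⟨{
  W := ker f
  g := kerι f
  w := kerι_comp f
  isColimit := CokernelCofork.IsColimit.ofπ' _ _ fun {W} g hg => by
    have hs : ∀ i y, ∃ x, f.app i x = y := fun i => surjective_of_epi f i
    choose s hs using hs
    have key : ∀ i x x', f.app i x = f.app i x' → g.app i x = g.app i x' := fun i x x' h => by
      have h0 : f.app i (x - x') = 0 := by rw [map_sub, h, sub_self]
      have h1 : g.app i (x - x') = 0 :=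
        congrArg (fun t : ker f ⟶ W => Hom.app t i ⟨x - x', h0⟩) hg
      rwa [map_sub, sub_eq_zero] at h1
    refine ⟨(⟨fun i => AddMonoidHom.mk' (fun y => g.app i (s i y)) fun x y => ?_,
      fun h x b => ?_⟩ : Hom N W), ?_⟩
    · rw [← map_add]
      apply key
      simp [hs]
    · change g.app _ _ = W.act h (g.app _ _) b
      rw [← g.app_act]
      apply key
      simp [hs, f.app_act]
    · ext i x
      exact key i _ _ (hs i _) }⟩

/-- The category of `ℤ`-graded right modules is abelian. -/
instance : Abelian (GrMod 𝒜) where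
  normalMonoOfMono f _ := normalMono f
  normalEpiOfEpi f _ := normalEpi f
  has_finite_products := hasFiniteProducts
  has_kernels := ⟨fun f => ⟨⟨⟨_, kerIsLimit f⟩⟩⟩⟩
  has_cokernels := ⟨fun f => ⟨⟨⟨_, cokerIsColimit f⟩⟩⟩⟩

instance : HasExt.{a + 1} (GrMod 𝒜) := HasExt.standard _

/-- The shift `M[j]`, with `M[j]_i = M_{i + j}`. -/
def shift (M : GrMod 𝒜) (j : ℤ) : GrMod 𝒜 where
  carrier i := M.carrier (i + j)
  act {i n l} h := M.act (show i + j + n = l + j by lia)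
  act_one {i} _ x e he := M.act_one (add_zero (i + j)) x e he
  act_act {i n l m q p} h₁ h₂ h₃ x b c d hd :=
    M.act_act (show i + j + n = l + j by lia) (show l + j + m = q + j by lia)
      (show i + j + p = q + j by lia) x b c d hd

/-- The shift of a morphism. -/
def shiftMap {M N : GrMod 𝒜} (f : M ⟶ N) (j : ℤ) : M.shift j ⟶ N.shift j :=
  (⟨fun i => f.app (i + j), fun {i n l} h x b => f.app_act (show i + j + n = l + j by lia) x b⟩ :
    Hom (M.shift j) (N.shift j))

end GrMod

open GrMod

section Regular

variable (𝒜) [NonnegGraded 𝒜]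

/-- The algebra `A` as a graded right module over itself. -/
def regular : GrMod 𝒜 where
  carrier i := 𝒜 i
  act {i n j} h :=
    { toFun := fun x =>
        { toFun := fun b => ⟨(x : A) * b, h ▸ SetLike.mul_mem_graded x.2 b.2⟩
          map_zero' := by ext; simp
          map_add' := fun _ _ => by ext; simp [mul_add] }
      map_zero' := by ext; simp
      map_add' := fun _ _ => by ext; simp [add_mul] }
  act_one h x e he := by ext; simp [he]
  act_act h₁ h₂ h₃ x b c d hd := by ext; simp [hd, mul_assoc]

variable {𝒜} in
/-- Left multiplication by a degree zero element, as an endomorphism of the right module `A`. -/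
def leftMul (s : 𝒜 0) : regular 𝒜 ⟶ regular 𝒜 :=
  (⟨fun i =>
      { toFun := fun x : 𝒜 i => (⟨(s : A) * x,
          by simpa using SetLike.GradedMul.mul_mem (A := 𝒜) s.2 x.2⟩ : 𝒜 i)
        map_zero' := Subtype.ext (mul_zero (s : A))
        map_add' := fun (x y : 𝒜 i) => Subtype.ext (mul_add (s : A) x y) },
    fun {i n j} _ (x : 𝒜 i) b => Subtype.ext (mul_assoc (s : A) x b).symm⟩ :
    GrMod.Hom (regular 𝒜) (regular 𝒜))

/-- The graded ideal `A₊ = ⨁_{i > 0} A_i`. -/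
def augmentation (i : ℤ) : AddSubgroup ((regular 𝒜).carrier i) := if 0 < i then ⊤ else ⊥

lemma augmentation_stable {i n j : ℤ} (h : i + n = j) (x : (regular 𝒜).carrier i) (b : 𝒜 n)
    (hx : x ∈ augmentation 𝒜 i) : (regular 𝒜).act h x b ∈ augmentation 𝒜 j := by
  by_cases hi : 0 < i
  · rcases lt_or_ge n 0 with hn | hn
    · have hb : b = 0 := by
        have h0 : (b : A) ∈ (⊥ : Submodule k A) :=
          (NonnegGraded.eq_bot_of_neg (𝒜 := 𝒜) n hn).le b.2
        exact Subtype.ext h0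
      rw [hb, map_zero]
      exact zero_mem _
    · rw [augmentation, if_pos (by lia)]
      trivial
  · rw [augmentation, if_neg hi] at hx
    have hx0 : x = 0 := hx
    rw [hx0, map_zero]
    exact zero_mem _

/-- The graded right module `S = A / A₊`. -/
def simples : GrMod 𝒜 := quot (regular 𝒜) (augmentation 𝒜) (augmentation_stable 𝒜)

variable {𝒜} in
/-- Left multiplication by a degree zero element, as an endomorphism of the right module `S`. -/
def simplesLeftMul (s : 𝒜 0) : simples 𝒜 ⟶ simples 𝒜 :=
  quotDesc _ (augmentation_stable 𝒜) (leftMul s ≫ quotπ _ _ (augmentation_stable 𝒜)) (by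
    intro i x hx
    refine (QuotientAddGroup.eq_zero_iff _).2 ?_
    by_cases hi : 0 < i
    · simp [augmentation, hi]
    · simp only [augmentation, if_neg hi, AddSubgroup.mem_bot] at hx ⊢
      rw [hx, map_zero])

/-- The degree `j` part of the graded Ext group `Ext^i_A(S, A)`. Homogeneous maps `M → N` of
degree `j` are the morphisms `M ⟶ N[j]`, so this is `Ext^i(S, A[j])` in the category of graded
right modules. -/
abbrev ExtSA (i : ℕ) (j : ℤ) : Type (a + 1) :=
  Abelian.Ext.{a + 1} (simples 𝒜) ((regular 𝒜).shift j) i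

end Regular

/-- The opposite grading, on the opposite algebra. -/
def opGrading (𝒜 : ℤ → Submodule k A) (i : ℤ) : Submodule k Aᵐᵒᵖ :=
  (𝒜 i).map (MulOpposite.opLinearEquiv k).toLinearMap

instance [NonnegGraded 𝒜] : NonnegGraded (opGrading 𝒜) where
  one_mem := ⟨1, SetLike.GradedOne.one_mem, rfl⟩
  mul_mem := by
    rintro i j _ _ ⟨x, hx, rfl⟩ ⟨y, hy, rfl⟩
    exact ⟨y * x, add_comm j i ▸ SetLike.mul_mem_graded hy hx, rfl⟩
  eq_bot_of_neg n hn := by simp [opGrading, NonnegGraded.eq_bot_of_neg n hn]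

end GradedModules

/-! ### Bimodules -/

section Bimodules

/-- The tensor product `V ⊗_S W` of a right `S`-module `V` and a left `S`-module `W`: the quotient
of `V ⊗_ℤ W` by the relations `v s ⊗ w = v ⊗ s w`. -/
def BalancedTensor (S : Type a) [Ring S] (V W : Type a) [AddCommGroup V] [AddCommGroup W]
    [Module Sᵐᵒᵖ V] [Module S W] : Type a :=
  TensorProduct ℤ V W ⧸ AddSubgroup.closure
    {z : TensorProduct ℤ V W | ∃ (v : V) (s : S) (x : W),
      z = (MulOpposite.op s • v) ⊗ₜ[ℤ] x - v ⊗ₜ[ℤ] (s • x)}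

instance (S : Type a) [Ring S] (V W : Type a) [AddCommGroup V] [AddCommGroup W]
    [Module Sᵐᵒᵖ V] [Module S W] : AddCommGroup (BalancedTensor S V W) :=
  inferInstanceAs (AddCommGroup (_ ⧸ _))

/-- The class of `v ⊗ w` in `V ⊗_S W`. -/
def BalancedTensor.tmul (S : Type a) [Ring S] {V W : Type a} [AddCommGroup V] [AddCommGroup W]
    [Module Sᵐᵒᵖ V] [Module S W] (v : V) (x : W) : BalancedTensor S V W :=
  QuotientAddGroup.mk (v ⊗ₜ[ℤ] x)

/-- `V ⊗_S W ≅ S` as `(S, S)`-bimodules: there is an additive bijection which is left linear in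
`V` and right linear in `W`. -/
def TensorIsoSelf (S : Type a) [Ring S] (V W : Type a) [AddCommGroup V] [AddCommGroup W]
    [Module S V] [Module Sᵐᵒᵖ V] [Module S W] [Module Sᵐᵒᵖ W] : Prop :=
  ∃ e : BalancedTensor S V W ≃+ S,
    (∀ (s : S) (v : V) (x : W),
      e (BalancedTensor.tmul S (s • v) x) = s * e (BalancedTensor.tmul S v x)) ∧
    (∀ (s : S) (v : V) (x : W),
      e (BalancedTensor.tmul S v (MulOpposite.op s • x)) = e (BalancedTensor.tmul S v x) * s)

/-- The `(S, S)`-bimodule `V` is invertible: `V ⊗_S W ≅ S ≅ W ⊗_S V` as bimodules for some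
`(S, S)`-bimodule `W`. -/
def IsInvertibleBimodule (S : Type a) [Ring S] (V : Type a) [AddCommGroup V]
    [Module S V] [Module Sᵐᵒᵖ V] : Prop :=
  ∃ (W : Type a) (_ : AddCommGroup W) (_ : Module S W) (_ : Module Sᵐᵒᵖ W)
    (_ : SMulCommClass S Sᵐᵒᵖ W), TensorIsoSelf S V W ∧ TensorIsoSelf S W V

end Bimodules

/-! ### Homological and growth conditions on a graded algebra

These are for graded algebras whose degree zero part `A₀` is semisimple (such as quotients of
path algebras by ideals generated by paths of length two, where `A₀ = k^n`), so that the graded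
Jacobson radical is `A₊` and `S = A / A₊ = A₀` as a ring. -/

section Conditions

variable {k : Type u} {A : Type a} [Field k] [Ring A] [Algebra k A]

/-- `(A, 𝒜)` is Artin-Schelter Gorenstein: the graded injective dimensions of `A` as a right and
as a left module (a left module being a right module over the opposite algebra) are equal to the
same natural number `d`, and the graded Ext group `Ext^i_A(S, A)` is zero for `i ≠ d` and
isomorphic to `V[ℓ]` for `i = d`, where `V` is a `k`-central invertible `(S, S)`-bimodule in
degree `0` (so `V[ℓ]` lives in degree `-ℓ`). The left action on `Ext^d_A(S, A)` comes from
left multiplication on `A`, the right action from left multiplication on `S`. On a bimodule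
concentrated in one degree `A₊` acts by zero, so that it is enough to consider the action
of degree zero elements. -/
def IsASGorenstein (𝒜 : ℤ → Submodule k A) [NonnegGraded 𝒜] : Prop :=
  ∃ d : ℕ,
    injectiveDimension (regular 𝒜) = d ∧
    injectiveDimension (regular (opGrading 𝒜)) = d ∧
    (∀ i : ℕ, i ≠ d → ∀ j : ℤ, Subsingleton (ExtSA 𝒜 i j)) ∧
    ∃ ℓ : ℤ,
      (∀ j : ℤ, j ≠ -ℓ → Subsingleton (ExtSA 𝒜 d j)) ∧
      ∃ (V : Type a) (_ : AddCommGroup V) (_ : Module (𝒜 0) V) (_ : Module (𝒜 0)ᵐᵒᵖ V)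
        (_ : SMulCommClass (𝒜 0) (𝒜 0)ᵐᵒᵖ V),
        (∀ (c : k) (v : V),
          algebraMap k (𝒜 0) c • v = MulOpposite.op (algebraMap k (𝒜 0) c) • v) ∧
        IsInvertibleBimodule (𝒜 0) V ∧
        ∃ φ : V ≃+ ExtSA 𝒜 d (-ℓ),
          (∀ (s : 𝒜 0) (v : V), φ (s • v) =
            (φ v).comp (Abelian.Ext.mk₀ (GrMod.shiftMap (leftMul s) (-ℓ))) (add_zero d)) ∧
          (∀ (s : 𝒜 0) (v : V), φ (MulOpposite.op s • v) =
            (Abelian.Ext.mk₀ (simplesLeftMul s)).comp (φ v) (zero_add d))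

/-- The depth of `A` is `d`: the least `i` with `Ext^i_A(S, A) ≠ 0` is `d`. -/
def HasDepth (𝒜 : ℤ → Submodule k A) [NonnegGraded 𝒜] (d : ℕ) : Prop :=
  IsLeast {i : ℕ | ∃ j : ℤ, Nontrivial (ExtSA 𝒜 i j)} d

variable (k A) in
/-- The Gelfand-Kirillov dimension: the supremum over all finite dimensional subspaces `W` of
`limsup log (dim Wⁿ) / log n`, with `Wⁿ` spanned by the products of at most `n` elements
of `W`. -/
def gkDim : EReal :=
  ⨆ (W : Submodule k A) (_ : FiniteDimensional k W),
    Filter.limsup (fun n : ℕ =>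
      ((Real.log (Module.finrank k ((1 ⊔ W) ^ n : Submodule k A)) / Real.log n : ℝ) : EReal))
      Filter.atTop

/-- First Cohen-Macaulay condition: the Gelfand-Kirillov dimension equals the depth. -/
def CM1 (𝒜 : ℤ → Submodule k A) [NonnegGraded 𝒜] : Prop :=
  ∃ d : ℕ, HasDepth 𝒜 d ∧ gkDim k A = d

/-- Second Cohen-Macaulay condition: with `d` the Gelfand-Kirillov dimension, there are `d`
commuting, homogeneous, algebraically independent elements of `A` over which `A` is a finitely
generated free (right) module. An injective algebra homomorphism `ψ` from the polynomial ring
is the same thing as the commuting algebraically independent elements `ψ (X i)`. -/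
def CM2 (𝒜 : ℤ → Submodule k A) : Prop :=
  ∃ d : ℕ, gkDim k A = d ∧
    ∃ ψ : MvPolynomial (Fin d) k →ₐ[k] A, Function.Injective ψ ∧
      (∀ i, SetLike.IsHomogeneousElem 𝒜 (ψ (MvPolynomial.X i))) ∧
      ∃ (m : ℕ) (y : Fin m → A), ∀ x : A,
        ∃! c : Fin m → MvPolynomial (Fin d) k, x = ∑ i, y i * ψ (c i)

/-- The Hilbert series `∑ dim(A_n) tⁿ`. -/
def hilbertSeries (𝒜 : ℤ → Submodule k A) : PowerSeries ℚ :=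
  PowerSeries.mk fun n => (Module.finrank k (𝒜 n) : ℚ)

/-- The Hilbert series is (the expansion of) a rational function `h` with
`h(t⁻¹) = ± tᵐ h(t)` for some integer `m`. -/
def HilbertSymmetric (𝒜 : ℤ → Submodule k A) : Prop :=
  ∃ h : RatFunc ℚ, (h : LaurentSeries ℚ) = (hilbertSeries 𝒜 : LaurentSeries ℚ) ∧
    ∃ m : ℤ,
      h.eval (algebraMap ℚ (RatFunc ℚ)) (RatFunc.X)⁻¹ = RatFunc.X ^ m * h ∨
      h.eval (algebraMap ℚ (RatFunc ℚ)) (RatFunc.X)⁻¹ = -(RatFunc.X ^ m * h)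

end Conditions

/-! ### Path algebras -/

section PathAlgebras

/-- The path algebra `kQ` of a quiver `Q` with finite vertex set `V`: finitely supported families
of coefficients on the paths `a ⟶ ⋯ ⟶ b`, for all pairs of vertices `a`, `b`. -/
def PathAlgebra (k : Type u) (V : Type v) [Field k] [Quiver.{w} V] : Type (max u v w) :=
  ∀ a b : V, Quiver.Path a b →₀ k

namespace PathAlgebra

variable {k : Type u} {V : Type v} [Field k] [Quiver.{w} V]

instance : AddCommGroup (PathAlgebra k V) := inferInstanceAs (AddCommGroup (∀ a b, Quiver.Path a b →₀ k))
instance : Module k (PathAlgebra k V) := inferInstanceAs (Module k (∀ a b, Quiver.Path a b →₀ k))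

/-- The coefficients of an element of the path algebra on the paths from `a` to `b`. -/
def coeff (f : PathAlgebra k V) (a b : V) : Quiver.Path a b →₀ k := f a b

@[ext]
lemma ext {f g : PathAlgebra k V} (h : ∀ a b, f.coeff a b = g.coeff a b) : f = g := funext₂ h

@[simp] lemma add_coeff (f g : PathAlgebra k V) (a b : V) :
    (f + g).coeff a b = f.coeff a b + g.coeff a b := rfl
@[simp] lemma zero_coeff (a b : V) : (0 : PathAlgebra k V).coeff a b = 0 := rfl
@[simp] lemma smul_coeff (c : k) (f : PathAlgebra k V) (a b : V) :
    (c • f).coeff a b = c • f.coeff a b := rfl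

lemma sum_coeff {ι : Type*} (s : Finset ι) (f : ι → PathAlgebra k V) (a b : V) :
    (∑ i ∈ s, f i).coeff a b = ∑ i ∈ s, (f i).coeff a b :=
  map_sum (⟨⟨fun f : PathAlgebra k V => f.coeff a b, rfl⟩, fun _ _ => rfl⟩ :
    PathAlgebra k V →+ (Quiver.Path a b →₀ k)) f s

variable (k) in
/-- The bilinear extension of the concatenation of paths `a ⟶ ⋯ ⟶ b` and `b ⟶ ⋯ ⟶ c`. -/
def concat (a b c : V) : (Quiver.Path a b →₀ k) →ₗ[k] (Quiver.Path b c →₀ k) →ₗ[k] (Quiver.Path a c →₀ k) :=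
  Finsupp.linearCombination k fun p => Finsupp.lmapDomain k k fun q => p.comp q

@[simp]
lemma concat_single {a b c : V} (p : Quiver.Path a b) (q : Quiver.Path b c) (x y : k) :
    concat k a b c (Finsupp.single p x) (Finsupp.single q y) =
      Finsupp.single (p.comp q) (x * y) := by
  simp [concat]

lemma concat_assoc {a b c d : V} (f : Quiver.Path a b →₀ k) (g : Quiver.Path b c →₀ k) (h : Quiver.Path c d →₀ k) :
    concat k a c d (concat k a b c f g) h = concat k a b d f (concat k b c d g h) := by
  induction f using Finsupp.induction_linear with
  | zero => simp
  | add f₁ f₂ h₁ h₂ => simp [h₁, h₂]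
  | single p x =>
    induction g using Finsupp.induction_linear with
    | zero => simp
    | add f₁ f₂ h₁ h₂ => simp [h₁, h₂]
    | single q y =>
      induction h using Finsupp.induction_linear with
      | zero => simp
      | add f₁ f₂ h₁ h₂ => simp only [map_add, h₁, h₂]
      | single r z => simp only [concat_single, Quiver.Path.comp_assoc, mul_assoc]

lemma nil_concat {a b : V} (f : Quiver.Path a b →₀ k) :
    concat k a a b (Finsupp.single Quiver.Path.nil 1) f = f := by
  induction f using Finsupp.induction_linear with
  | zero => simp
  | add f₁ f₂ h₁ h₂ => rw [map_add, h₁, h₂]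
  | single p x => simp

lemma concat_nil {a b : V} (f : Quiver.Path a b →₀ k) :
    concat k a b b f (Finsupp.single Quiver.Path.nil 1) = f := by
  induction f using Finsupp.induction_linear with
  | zero => simp
  | add f₁ f₂ h₁ h₂ => rw [map_add, LinearMap.add_apply, h₁, h₂]
  | single p x => simp

section Mul

variable [Fintype V]

/-- Multiplication is the bilinear extension of the concatenation of paths, with product zero for
paths that cannot be concatenated. -/
instance : Mul (PathAlgebra k V) :=
  ⟨fun f g => fun a c => ∑ b, concat k a b c (f.coeff a b) (g.coeff b c)⟩

lemma mul_coeff (f g : PathAlgebra k V) (a c : V) :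
    (f * g).coeff a c = ∑ b, concat k a b c (f.coeff a b) (g.coeff b c) := rfl

end Mul

variable [DecidableEq V]

variable (k) in
/-- A path, as an element of the path algebra. -/
def ofPath {a b : V} (p : Quiver.Path a b) : PathAlgebra k V :=
  (Pi.single a (Pi.single b (Finsupp.single p 1)) : ∀ c d : V, Quiver.Path c d →₀ k)

lemma ofPath_coeff_self {a b : V} (p : Quiver.Path a b) :
    (ofPath k p).coeff a b = Finsupp.single p 1 := by
  simp [ofPath, coeff]

lemma ofPath_coeff_of_ne_left {a b c d : V} (p : Quiver.Path a b) (h : c ≠ a) :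
    (ofPath k p).coeff c d = 0 := by
  simp [ofPath, coeff, h]

lemma ofPath_coeff_of_ne_right {a b c d : V} (p : Quiver.Path a b) (h : d ≠ b) :
    (ofPath k p).coeff c d = 0 := by
  by_cases hc : c = a
  · subst hc; simp [ofPath, coeff, h]
  · simp [ofPath, coeff, hc]

variable [Fintype V]

/-- The unit is the sum of the stationary paths. -/
instance : One (PathAlgebra k V) := ⟨∑ v, ofPath k (Quiver.Path.nil : Quiver.Path v v)⟩

lemma one_coeff_self (a : V) :
    (1 : PathAlgebra k V).coeff a a = Finsupp.single Quiver.Path.nil 1 := by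
  change (∑ v, ofPath k (Quiver.Path.nil : Quiver.Path v v)).coeff a a = _
  rw [sum_coeff, Finset.sum_eq_single a, ofPath_coeff_self]
  · exact fun b _ hb => ofPath_coeff_of_ne_left _ hb.symm
  · simp

lemma one_coeff_of_ne {a b : V} (h : a ≠ b) : (1 : PathAlgebra k V).coeff a b = 0 := by
  change (∑ v, ofPath k (Quiver.Path.nil : Quiver.Path v v)).coeff a b = _
  rw [sum_coeff]
  refine Finset.sum_eq_zero fun v _ => ?_
  by_cases hv : a = v
  · exact ofPath_coeff_of_ne_right _ (hv ▸ h.symm)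
  · exact ofPath_coeff_of_ne_left _ hv

instance : Ring (PathAlgebra k V) where
  __ := (inferInstance : AddCommGroup (PathAlgebra k V))
  left_distrib f g h := by ext1 a c; simp [mul_coeff, Finset.sum_add_distrib]
  right_distrib f g h := by ext1 a c; simp [mul_coeff, Finset.sum_add_distrib]
  zero_mul f := by ext1 a c; simp [mul_coeff]
  mul_zero f := by ext1 a c; simp [mul_coeff]
  mul_assoc f g h := by
    ext1 a d
    simp only [mul_coeff, map_sum, LinearMap.sum_apply, concat_assoc]
    exact Finset.sum_comm
  one_mul f := by
    ext1 a c
    rw [mul_coeff, Finset.sum_eq_single a, one_coeff_self, nil_concat]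
    · intro b _ hb
      simp [one_coeff_of_ne hb.symm]
    · simp
  mul_one f := by
    ext1 a c
    rw [mul_coeff, Finset.sum_eq_single c, one_coeff_self, concat_nil]
    · intro b _ hb
      simp [one_coeff_of_ne hb]
    · simp

instance : Algebra k (PathAlgebra k V) :=
  Algebra.ofModule
    (fun c f g => by ext1 a b; simp [mul_coeff, Finset.smul_sum])
    (fun c f g => by ext1 a b; simp [mul_coeff, Finset.smul_sum])

/-- The product of composable paths is their concatenation. -/
lemma ofPath_mul_ofPath {a b c : V} (p : Quiver.Path a b) (q : Quiver.Path b c) :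
    ofPath k p * ofPath k q = ofPath k (p.comp q) := by
  ext1 x z
  rw [mul_coeff, Finset.sum_eq_single b]
  · by_cases hx : x = a
    · subst hx
      by_cases hz : z = c
      · subst hz; simp [ofPath_coeff_self]
      · simp [ofPath_coeff_of_ne_right _ hz]
    · simp [ofPath_coeff_of_ne_left _ hx]
  · intro y _ hy
    simp [ofPath_coeff_of_ne_right _ hy]
  · simp

/-- The product of paths that are not composable is zero. -/
lemma ofPath_mul_ofPath_of_ne {a b c d : V} (p : Quiver.Path a b) (q : Quiver.Path c d) (h : b ≠ c) :
    ofPath k p * ofPath k q = 0 := by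
  ext1 x z
  rw [mul_coeff]
  refine Finset.sum_eq_zero fun y _ => ?_
  by_cases hy : y = b
  · subst hy; simp [ofPath_coeff_of_ne_left _ h]
  · simp [ofPath_coeff_of_ne_right _ hy]

end PathAlgebra

open PathAlgebra

variable {k : Type u} {V : Type v} [Field k] [Fintype V] [DecidableEq V] [Quiver.{w} V]

/-- The algebra `A = kQ / I`. -/
abbrev QuotAlgebra (I : TwoSidedIdeal (PathAlgebra k V)) : Type (max u v w) := I.ringCon.Quotient

/-- The class in `kQ / I` of an element of `kQ`. -/
def quotMk (I : TwoSidedIdeal (PathAlgebra k V)) : PathAlgebra k V →ₗ[k] QuotAlgebra I where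
  toFun := fun x => (x : I.ringCon.Quotient)
  map_add' _ _ := rfl
  map_smul' _ _ := rfl

/-- The grading of `kQ / I` by path length: `A_n` is spanned by the classes of the paths
of length `n`. -/
def pathGrading (I : TwoSidedIdeal (PathAlgebra k V)) (n : ℤ) : Submodule k (QuotAlgebra I) :=
  Submodule.span k {x | ∃ (a b : V) (p : Quiver.Path a b), (p.length : ℤ) = n ∧ x = quotMk I (ofPath k p)}

instance (I : TwoSidedIdeal (PathAlgebra k V)) : NonnegGraded (pathGrading I) where
  one_mem := by
    have h : (1 : QuotAlgebra I) = ∑ v, quotMk I (ofPath k (Quiver.Path.nil : Quiver.Path v v)) :=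
      (map_sum (quotMk I) _ _).symm ▸ rfl
    rw [h]
    exact Submodule.sum_mem _ fun v _ => Submodule.subset_span ⟨v, v, Quiver.Path.nil, rfl, rfl⟩
  mul_mem := by
    intro i j x y hx hy
    induction hx using Submodule.span_induction with
    | zero => simp
    | add x₁ x₂ _ _ h₁ h₂ => rw [add_mul]; exact add_mem h₁ h₂
    | smul c x _ h => rw [smul_mul_assoc]; exact Submodule.smul_mem _ _ h
    | mem x hx =>
      obtain ⟨a, b, p, hp, rfl⟩ := hx
      induction hy using Submodule.span_induction with
      | zero => simp
      | add x₁ x₂ _ _ h₁ h₂ => rw [mul_add]; exact add_mem h₁ h₂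
      | smul c x _ h => rw [mul_smul_comm]; exact Submodule.smul_mem _ _ h
      | mem y hy =>
        obtain ⟨c, d, q, hq, rfl⟩ := hy
        have h : quotMk I (ofPath k p) * quotMk I (ofPath k q) =
            quotMk I (ofPath k p * ofPath k q) := rfl
        rw [h]
        by_cases hbc : b = c
        · subst hbc
          rw [ofPath_mul_ofPath]
          refine Submodule.subset_span ⟨a, d, p.comp q, ?_, rfl⟩
          rw [Quiver.Path.length_comp, ← hp, ← hq]
          push_cast
          rfl
        · rw [ofPath_mul_ofPath_of_ne p q hbc, map_zero]
          exact zero_mem _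
  eq_bot_of_neg n hn := by
    rw [pathGrading, Submodule.span_eq_bot]
    rintro _ ⟨a, b, p, hp, rfl⟩
    lia

/-! ### Gentle and locally gentle algebras -/

variable (V) in
/-- The number of arrows of a quiver. -/
def numArrows [∀ a b : V, Fintype (a ⟶ b)] : ℕ := Fintype.card (Σ a b : V, (a ⟶ b))

variable (V) in
/-- The quiver is `Ã_n` for some `n ≥ 0`: its vertices can be identified with `ℤ/(n+1)` in such
a way that there is exactly one arrow `i ⟶ i + 1` for each `i`, and no other arrow. -/
def IsTildeA [∀ a b : V, Fintype (a ⟶ b)] : Prop :=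
  ∃ (n : ℕ) (e : V ≃ ZMod (n + 1)),
    ∀ a b : V, Fintype.card (a ⟶ b) = if e b = e a + 1 then 1 else 0

/-- The conditions on `(Q, I)` shared by gentle and locally gentle algebras `kQ / I`. -/
structure GentleConditions [∀ a b : V, Fintype (a ⟶ b)]
    (I : TwoSidedIdeal (PathAlgebra k V)) : Prop where
  /-- There is a vertex. -/
  nonempty : Nonempty V
  /-- There is an arrow. -/
  one_le_numArrows : 1 ≤ numArrows V
  /-- The underlying graph is connected. -/
  connected : Subsingleton (Quiver.WeaklyConnectedComponent V)
  /-- At most two arrows end at each vertex. -/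
  indeg_le : ∀ x : V, Fintype.card (Σ y : V, (y ⟶ x)) ≤ 2
  /-- At most two arrows start at each vertex. -/
  outdeg_le : ∀ x : V, Fintype.card (Σ y : V, (x ⟶ y)) ≤ 2
  /-- If distinct arrows `β`, `β'` end where `α` starts, exactly one of `βα`, `β'α` is in `I`. -/
  left_unique : ∀ {x y : V} (α : x ⟶ y) (β β' : Σ z : V, (z ⟶ x)), β ≠ β' →
    Xor (ofPath k (β.2.toPath.comp α.toPath) ∈ I) (ofPath k (β'.2.toPath.comp α.toPath) ∈ I)
  /-- If distinct arrows `β`, `β'` start where `α` ends, exactly one of `αβ`, `αβ'` is in `I`. -/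
  right_unique : ∀ {x y : V} (α : x ⟶ y) (β β' : Σ z : V, (y ⟶ z)), β ≠ β' →
    Xor (ofPath k (α.toPath.comp β.2.toPath) ∈ I) (ofPath k (α.toPath.comp β'.2.toPath) ∈ I)
  /-- `I` is generated by paths of length two. -/
  generated : ∃ R : Set (PathAlgebra k V),
    (∀ r ∈ R, ∃ (a b : V) (p : Quiver.Path a b), p.length = 2 ∧ r = ofPath k p) ∧
    I = TwoSidedIdeal.span R

/-- `kQ / I` is gentle. -/
def IsGentle [∀ a b : V, Fintype (a ⟶ b)] (I : TwoSidedIdeal (PathAlgebra k V)) : Prop :=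
  GentleConditions I ∧ FiniteDimensional k (QuotAlgebra I)

/-- `kQ / I` is locally gentle. -/
def IsLocallyGentle [∀ a b : V, Fintype (a ⟶ b)] (I : TwoSidedIdeal (PathAlgebra k V)) : Prop :=
  GentleConditions I ∧ ¬ FiniteDimensional k (QuotAlgebra I)

end PathAlgebras

end

end LocGentle

open LocGentle

namespace LocGentle

open CategoryTheory CategoryTheory.Limits

set_option linter.unusedSectionVars false

/-! ### Extension groups and short exact sequences -/

section Homological

variable {C : Type u} [Category.{v} C] [Abelian C] [HasExt.{w} C]
  {S : ShortComplex C} (hS : S.ShortExact)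

/-! The Cohen–Macaulay hypothesis is needed for one thing only: every arrow `α` has an arrow `β`
with `αβ ≠ 0` in `A` (`IsLocallyGentle.exists_mul_ne_zero`). Otherwise `α` is killed on the right by
all of `A₊`. Such a socle element makes the depth zero, whereas an infinite dimensional `A` has
Gelfand–Kirillov dimension at least one. Under the second condition it would be killed by a
polynomial variable of positive degree, although `A` is free over the polynomial ring.

The gentle conditions make the continuation of an arrow unique in both directions, so it is a
permutation `σ` of the finite set of arrows (`GentleConditions.exists_perm`). Hence `A` has as basis
the vertices and, for each arrow `γ` and each `n`, the single path `γ, σ γ, …, σⁿ γ`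
(`stringBasis`). The Hilbert series is `|Q₀| + |Q₁| t / (1 - t)`, which is symmetric exactly if
`|Q₁| = |Q₀|` or `|Q₁| = 2|Q₀|` (`eval_inv_symm_iff`). By connectedness every vertex is the source
of an arrow, so these equations say that there is one arrow, respectively there are two arrows, from
each vertex; the first case is an oriented cycle.

For the Gorenstein property, let `F` be the graded module whose component in every degree is the
space of functions on the arrows. It is injective (`injective_functions`), and a shift of `A` embeds
into it by recording which arrows can continue a path. The image is everything in positive degrees
of `A`, the functions of the source in degree zero, and nothing below. In the two good cases the
cokernel is a shift of the graded dual of `A`, which is injective, so the injective dimension is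
one. A homomorphism from `A₊` to a shift of `A` amounts to one scalar per arrow
(`toFun_arrowImage`), so that `Ext¹(S, A)` can be read off: it lives in a single degree and is `A₀`
with a twisted right action (`isASGorenstein_of_augmentation`).

In the remaining case some arrow `b` leads from a vertex with another outgoing arrow `b'` to a
vertex with only one (`sources_trichotomy`). Then `Ext¹(S, A) ≠ 0`, so the dimension would have to
be one. Let `a` be the predecessor of `b'`, so that `ab = 0`. Removing the first arrow `b` is a
homomorphism from the kernel of left multiplication by `a` to `A` which does not extend to `A[1]`.
So `Ext¹(aA, A) ≠ 0`, which is impossible in injective dimension one (`not_isASGorenstein`).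

The finite dimensional counterexample is the Kronecker quiver: its Hilbert series `2 + 2t` is
symmetric, but its right socle meets the two degrees zero and one. -/

include hS in
lemma extClass_comp_mk₀_eq_zero_iff {Y : C} (f : S.X₁ ⟶ Y) :
    hS.extClass.comp (Abelian.Ext.mk₀ f) (add_zero 1) = 0 ↔ ∃ g : S.X₂ ⟶ Y, S.f ≫ g = f := by
  constructor
  · intro h
    obtain ⟨x, hx⟩ := Abelian.Ext.contravariant_sequence_exact₁ hS Y (Abelian.Ext.mk₀ f) _ h
    obtain ⟨g, rfl⟩ := (Abelian.Ext.mk₀_bijective _ _).2 x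
    rw [Abelian.Ext.mk₀_comp_mk₀] at hx
    exact ⟨g, (Abelian.Ext.mk₀_bijective _ _).1 hx⟩
  · rintro ⟨g, rfl⟩
    rw [← Abelian.Ext.mk₀_comp_mk₀, hS.extClass_comp_assoc]

/-- The long exact sequence with `Ext¹(X₂, Y) = 0`. Together with the preceding lemma it presents
`Ext¹(X₃, Y)` as the morphisms on `X₁` modulo those that extend to `X₂`, the form in which all
extension groups below are computed. -/
lemma exists_extClass_comp_mk₀_eq [Projective S.X₂] {Y : C} (x : Abelian.Ext.{w} S.X₃ Y 1) :
    ∃ f : S.X₁ ⟶ Y, hS.extClass.comp (Abelian.Ext.mk₀ f) (add_zero 1) = x := by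
  obtain ⟨y, hy⟩ := Abelian.Ext.contravariant_sequence_exact₃ hS Y x
    (Abelian.Ext.eq_zero_of_projective _) (n₀ := 0) (add_zero 1)
  obtain ⟨f, rfl⟩ := (Abelian.Ext.mk₀_bijective _ _).2 y
  exact ⟨f, hy⟩

lemma subsingleton_ext_one_of_forall_exists_extend (hS : S.ShortExact) [Projective S.X₂] {Y : C}
    (h : ∀ f : S.X₁ ⟶ Y, ∃ g : S.X₂ ⟶ Y, S.f ≫ g = f) :
    Subsingleton (Abelian.Ext.{w} S.X₃ Y 1) := by
  refine subsingleton_of_forall_eq 0 fun x => ?_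
  obtain ⟨f, rfl⟩ := exists_extClass_comp_mk₀_eq hS x
  exact (extClass_comp_mk₀_eq_zero_iff hS f).2 (h f)

lemma exists_extend_of_subsingleton_ext_one (hS : S.ShortExact) {Y : C}
    [Subsingleton (Abelian.Ext.{w} S.X₃ Y 1)] (f : S.X₁ ⟶ Y) : ∃ g : S.X₂ ⟶ Y, S.f ≫ g = f :=
  (extClass_comp_mk₀_eq_zero_iff hS f).1 (Subsingleton.elim _ _)

/-- Over a subobject of a projective object, the first extension group with values in an object of
injective dimension at most one vanishes. -/
lemma subsingleton_ext_one_of_hasInjectiveDimensionLT_two (hS : S.ShortExact) [Projective S.X₂]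
    {Y : C} [HasInjectiveDimensionLT Y 2] : Subsingleton (Abelian.Ext.{w} S.X₁ Y 1) := by
  refine subsingleton_of_forall_eq 0 fun x => ?_
  -- The connecting map takes values in `Ext²(X₃, Y) = 0`, so the class comes from `Ext¹(X₂, Y)`,
  -- which is zero too.
  obtain ⟨y, hy⟩ := Abelian.Ext.contravariant_sequence_exact₁ hS Y x (n₁ := 2) rfl
    (Abelian.Ext.eq_zero_of_hasInjectiveDimensionLT _ 2 le_rfl)
  rw [← hy, Abelian.Ext.eq_zero_of_projective y, Abelian.Ext.comp_zero]

omit [HasExt.{w} C] in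
lemma hasInjectiveDimensionLT_two_of_injective (hS : S.ShortExact) [Injective S.X₂]
    [Injective S.X₃] : HasInjectiveDimensionLT S.X₁ 2 :=
  hS.hasInjectiveDimensionLT_X₁ 1 inferInstance inferInstance

end Homological

/-! ### Graded modules -/

section GradedModules

variable {k : Type u} {A : Type a} [Field k] [Ring A] [Algebra k A] {𝒜 : ℤ → Submodule k A}

namespace GrMod

lemma mono_of_injective {M N : GrMod 𝒜} (f : M ⟶ N)
    (h : ∀ i x, f.app i x = 0 → x = 0) : Mono f := by
  rw [Preadditive.mono_iff_cancel_zero]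
  intro P g hg
  ext i x
  exact h _ _ (congrArg (fun t : P ⟶ N => Hom.app t i x) hg)

lemma epi_of_surjective {M N : GrMod 𝒜} (f : M ⟶ N)
    (h : ∀ i, Function.Surjective (f.app i)) : Epi f := by
  rw [Preadditive.epi_iff_cancel_zero]
  intro P g hg
  ext i y
  obtain ⟨x, rfl⟩ := h i y
  exact congrArg (fun t : M ⟶ P => Hom.app t i x) hg

lemma shortExact_of_degreewise {S : ShortComplex (GrMod 𝒜)}
    (hf : ∀ i x, S.f.app i x = 0 → x = 0) (hg : ∀ i, Function.Surjective (S.g.app i))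
    (hfg : ∀ i x, S.g.app i x = 0 → ∃ y, S.f.app i y = x) : S.ShortExact := by
  have := mono_of_injective S.f hf
  have := epi_of_surjective S.g hg
  refine ⟨S.exact_of_f_is_kernel (KernelFork.IsLimit.ofι' _ _ fun {W} g hgz => ?_)⟩
  have hr : ∀ i x, ∃ y, S.f.app i y = g.app i x := fun i x =>
    hfg i _ (congrArg (fun t : W ⟶ S.X₃ => Hom.app t i x) hgz)
  choose l hl using hr
  refine ⟨(⟨fun i => AddMonoidHom.mk' (l i) fun x y => injective_of_mono S.f i ?_,
    fun h x b => injective_of_mono S.f _ ?_⟩ : Hom W S.X₁), ?_⟩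
  · simp [hl]
  · simp [hl, S.f.app_act, g.app_act]
  · ext i x
    exact hl i x

/-- The short complex formed by the kernel of a morphism and the morphism. -/
def kerComplex {M N : GrMod 𝒜} (f : M ⟶ N) : ShortComplex (GrMod 𝒜) :=
  ShortComplex.mk (kerι f) f (kerι_comp f)

lemma kerComplex_shortExact {M N : GrMod 𝒜} (f : M ⟶ N)
    (hf : ∀ i, Function.Surjective (f.app i)) : (kerComplex f).ShortExact :=
  shortExact_of_degreewise (fun _ _ hx => Subtype.ext hx) hf fun _ x hx => ⟨⟨x, hx⟩, rfl⟩

/-- The short complex formed by a morphism and its cokernel. -/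
def cokerComplex {M N : GrMod 𝒜} (f : M ⟶ N) : ShortComplex (GrMod 𝒜) :=
  ShortComplex.mk f (cokerπ f) (comp_cokerπ f)

lemma cokerComplex_shortExact {M N : GrMod 𝒜} (f : M ⟶ N)
    (hf : ∀ i x, f.app i x = 0 → x = 0) : (cokerComplex f).ShortExact :=
  shortExact_of_degreewise hf (fun _ => QuotientAddGroup.mk_surjective)
    fun i x hx => (QuotientAddGroup.eq_zero_iff (N := (f.app i).range) x).1 hx

section Scalars

variable [NonnegGraded 𝒜]

/-- A scalar, as an element of degree zero. -/
def scalar (𝒜 : ℤ → Submodule k A) [NonnegGraded 𝒜] (c : k) : 𝒜 0 :=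
  ⟨algebraMap k A c, SetLike.algebraMap_mem_graded 𝒜 c⟩

omit [NonnegGraded 𝒜] in
lemma act_eq_act (M : GrMod 𝒜) {i n m j : ℤ} (h : i + n = j) (h' : i + m = j) (x : M.carrier i)
    (b : 𝒜 n) (c : 𝒜 m) (hbc : (b : A) = c) : M.act h x b = M.act h' x c := by
  obtain rfl : n = m := by lia
  rw [Subtype.ext hbc]

/-- The scalars act on the components of a graded module through the degree zero part. -/
instance (M : GrMod 𝒜) (i : ℤ) : Module k (M.carrier i) where
  smul c x := M.act (add_zero i) x (scalar 𝒜 c)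
  one_smul x := M.act_one _ x _ (map_one (algebraMap k A))
  mul_smul c d x := (M.act_act (add_zero i) (add_zero i) (add_zero i) x _ _ _ (by
    simp [scalar, Algebra.commutes c])).symm
  smul_zero c := by
    change M.act (add_zero i) 0 (scalar 𝒜 c) = 0
    simp
  smul_add c x y := by
    change M.act (add_zero i) (x + y) (scalar 𝒜 c) = _ + _
    rw [map_add]; rfl
  add_smul c d x := by
    change M.act (add_zero i) x (scalar 𝒜 (c + d)) =
      M.act (add_zero i) x (scalar 𝒜 c) + M.act (add_zero i) x (scalar 𝒜 d)
    rw [← map_add]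
    exact act_eq_act _ _ _ _ _ _ (by simp [scalar])
  zero_smul x := by
    change M.act (add_zero i) x (scalar 𝒜 0) = 0
    rw [← map_zero (M.act (add_zero i) x)]
    exact act_eq_act _ _ _ _ _ _ (by simp [scalar])

lemma smul_def (M : GrMod 𝒜) {i : ℤ} (c : k) (x : M.carrier i) :
    c • x = M.act (add_zero i) x (scalar 𝒜 c) := rfl

lemma act_smul (M : GrMod 𝒜) {i n j : ℤ} (h : i + n = j) (c : k) (x : M.carrier i) (b : 𝒜 n) :
    M.act h x (c • b) = c • M.act h x b := by
  rw [smul_def, M.act_act h (add_zero j) h x b (scalar 𝒜 c) (c • b)]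
  simp [scalar, Algebra.smul_def, Algebra.commutes c]

lemma smul_act (M : GrMod 𝒜) {i n j : ℤ} (h : i + n = j) (c : k) (x : M.carrier i) (b : 𝒜 n) :
    M.act h (c • x) b = c • M.act h x b := by
  rw [← act_smul, smul_def, M.act_act (add_zero i) h h x (scalar 𝒜 c) b (c • b)]
  simp [scalar, Algebra.smul_def]

lemma app_smul {M N : GrMod 𝒜} (f : M ⟶ N) {i : ℤ} (c : k) (x : M.carrier i) :
    f.app i (c • x) = c • f.app i x := f.app_act _ x _

/-- A component of a morphism, as a linear map. -/
def appₗ {M N : GrMod 𝒜} (f : M ⟶ N) (i : ℤ) : M.carrier i →ₗ[k] N.carrier i where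
  __ := f.app i
  map_smul' c x := app_smul f c x

@[simp] lemma appₗ_apply {M N : GrMod 𝒜} (f : M ⟶ N) (i : ℤ) (x : M.carrier i) :
    appₗ f i x = f.app i x := rfl

/-- The action of a homogeneous element, as a linear map. -/
def actₗ (M : GrMod 𝒜) {i n j : ℤ} (h : i + n = j) (b : 𝒜 n) : M.carrier i →ₗ[k] M.carrier j where
  toFun x := M.act h x b
  map_add' x y := by simp
  map_smul' c x := smul_act M h c x b

@[simp] lemma actₗ_apply (M : GrMod 𝒜) {i n j : ℤ} (h : i + n = j) (b : 𝒜 n) (x : M.carrier i) :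
    actₗ M h b x = M.act h x b := rfl

lemma act_of_neg (M : GrMod 𝒜) {i n j : ℤ} (h : i + n = j) (hn : n < 0) (x : M.carrier i)
    (b : 𝒜 n) : M.act h x b = 0 := by
  have hb : b = 0 := by
    have h0 : (b : A) ∈ (⊥ : Submodule k A) := (NonnegGraded.eq_bot_of_neg (𝒜 := 𝒜) n hn).le b.2
    exact Subtype.ext h0
  rw [hb, map_zero]

/-- The unit, as an element of degree `n = 0`. -/
def unit (𝒜 : ℤ → Submodule k A) [NonnegGraded 𝒜] (n : ℤ) (hn : n = 0) : 𝒜 n :=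
  ⟨1, hn ▸ SetLike.GradedOne.one_mem⟩

/-- The morphism `A[l] ⟶ M` that sends the unit to a given element. -/
def ofElement {M : GrMod 𝒜} {l n : ℤ} (h : n + l = 0) (x : M.carrier n) :
    (regular 𝒜).shift l ⟶ M :=
  (⟨fun i => M.act (show n + (i + l) = i by lia) x, fun {i m j} hj y b =>
      (M.act_act (show n + (i + l) = i by lia) hj (show n + (j + l) = j by lia) x y b _ rfl).symm⟩ :
    Hom ((regular 𝒜).shift l) M)

/-- A morphism `A[l] ⟶ M` is determined by the image of the unit. -/
lemma app_eq_act_unit {M : GrMod 𝒜} {l n : ℤ} (f : (regular 𝒜).shift l ⟶ M) (h : n + l = 0)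
    (i : ℤ) (b : 𝒜 (i + l)) :
    f.app i b = M.act (show n + (i + l) = i by lia) (f.app n (unit 𝒜 (n + l) h)) b := by
  refine Eq.trans ?_ (f.app_act (show n + (i + l) = i by lia) (unit 𝒜 (n + l) h) b)
  exact congrArg (f.app i) (Subtype.ext (one_mul (b : A)).symm)

/-- `A[l]` represents the functor `M ↦ M₋ₗ`, and epimorphisms are surjective in each degree. -/
instance projective_regular_shift (l : ℤ) : Projective ((regular 𝒜).shift l) where
  factors {E X} f e he := by
    obtain ⟨y, hy⟩ := surjective_of_epi e (-l) (f.app (-l) (unit 𝒜 (-l + l) (by lia)))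
    refine ⟨ofElement (by lia) y, ?_⟩
    ext i b
    rw [comp_app, app_eq_act_unit f (n := -l) (by lia) i b, ← hy]
    exact e.app_act _ _ _

/-- The regular module is its own shift by zero. -/
def regularIsoShiftZero : regular 𝒜 ≅ (regular 𝒜).shift 0 where
  hom := (⟨fun i =>
    { toFun := fun x : 𝒜 i => (⟨x, by simp⟩ : 𝒜 (i + 0))
      map_zero' := rfl
      map_add' := fun _ _ => rfl }, fun _ _ _ => rfl⟩ : Hom (regular 𝒜) ((regular 𝒜).shift 0))
  inv := (⟨fun i =>
    { toFun := fun x : 𝒜 (i + 0) => (⟨x, by simpa using x.2⟩ : 𝒜 i)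
      map_zero' := rfl
      map_add' := fun _ _ => rfl }, fun _ _ _ => rfl⟩ : Hom ((regular 𝒜).shift 0) (regular 𝒜))

instance projective_regular : Projective (regular 𝒜) :=
  Projective.of_iso regularIsoShiftZero.symm inferInstance

lemma simples_proj_surjective (i : ℤ) : Function.Surjective
    (Hom.app (quotπ (regular 𝒜) (augmentation 𝒜) (augmentation_stable 𝒜)) i) :=
  QuotientAddGroup.mk_surjective

end Scalars

end GrMod

end GradedModules

/-! ### The graded dual of the regular left module -/

section GradedDual

variable {k : Type u} {A : Type (max u a)} [Field k] [Ring A] [Algebra k A]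

namespace GrMod

/-- Left multiplication by a homogeneous element, as a linear map between homogeneous components. -/
def mulₗ (𝒜 : ℤ → Submodule k A) [NonnegGraded 𝒜] {n m l : ℤ} (h : n + m = l) (b : 𝒜 n) :
    𝒜 m →ₗ[k] 𝒜 l where
  toFun x := ⟨b * x, h ▸ SetLike.mul_mem_graded b.2 x.2⟩
  map_add' _ _ := Subtype.ext (mul_add _ _ _)
  map_smul' _ _ := Subtype.ext (mul_smul_comm _ _ _)

@[simp] lemma coe_mulₗ (𝒜 : ℤ → Submodule k A) [NonnegGraded 𝒜] {n m l : ℤ} (h : n + m = l)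
    (b : 𝒜 n) (x : 𝒜 m) : (mulₗ 𝒜 h b x : A) = b * x := rfl

/-- The shift by `m` of the graded dual of `A`, considered as a left module over itself. -/
def dual (𝒜 : ℤ → Submodule k A) [NonnegGraded 𝒜] (m : ℤ) : GrMod.{max u a, u} 𝒜 where
  carrier i := Module.Dual k (𝒜 (-(i + m)))
  act {i n j} h :=
    { toFun := fun φ =>
        { toFun := fun b => φ ∘ₗ mulₗ 𝒜 (show n + -(j + m) = -(i + m) by lia) b
          map_zero' := by
            ext x
            change φ _ = 0
            rw [← map_zero φ]
            exact congrArg φ (Subtype.ext (zero_mul _))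
          map_add' := fun b c => by
            ext x
            change φ _ = φ _ + φ _
            rw [← map_add φ]
            exact congrArg φ (Subtype.ext (add_mul _ _ _)) }
      map_zero' := rfl
      map_add' := fun _ _ => rfl }
  act_one h φ e he := by
    ext x
    exact congrArg φ (Subtype.ext (by simp [he]))
  act_act h₁ h₂ h₃ φ b c d hd := by
    ext x
    exact congrArg φ (Subtype.ext (by simp [hd, mul_assoc]))

variable {𝒜 : ℤ → Submodule k A} [NonnegGraded 𝒜]

/-- The morphism to the graded dual that corresponds to a linear functional. -/
def toDual {M : GrMod.{max u a, u} 𝒜} {m l : ℤ} (h : l + m = 0) (θ : M.carrier l →ₗ[k] k) :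
    M ⟶ dual 𝒜 m :=
  (⟨fun i =>
    { toFun := fun x =>
        ({ toFun := fun b => θ (M.act (show i + -(i + m) = l by lia) x b)
           map_add' := fun b c => by simp
           map_smul' := fun c b => by simp [act_smul] } : Module.Dual k (𝒜 (-(i + m))))
      map_zero' := LinearMap.ext fun b => by
        change θ (M.act _ 0 b) = 0
        simp
      map_add' := fun x y => LinearMap.ext fun b => by
        change θ (M.act _ (x + y) b) = θ _ + θ _
        simp },
    fun {i n j} hj x b => LinearMap.ext fun c =>
      congrArg θ (M.act_act hj _ _ x b c _ rfl)⟩ : Hom M (dual 𝒜 m))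

lemma toDual_app_apply {M : GrMod.{max u a, u} 𝒜} {m l : ℤ} (h : l + m = 0)
    (θ : M.carrier l →ₗ[k] k) (i : ℤ) (x : M.carrier i) (b : 𝒜 (-(i + m))) :
    (show Module.Dual k (𝒜 (-(i + m))) from Hom.app (toDual h θ) i x) b =
      θ (M.act (show i + -(i + m) = l by lia) x b) := rfl

/-- The functional that corresponds to a morphism to the graded dual. -/
def functional {M : GrMod.{max u a, u} 𝒜} {m l : ℤ} (h : l + m = 0) (f : M ⟶ dual 𝒜 m) :
    M.carrier l →ₗ[k] k where
  toFun x := (show Module.Dual k (𝒜 (-(l + m))) from f.app l x) (unit 𝒜 _ (by lia))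
  map_add' x y := by rw [map_add]; rfl
  map_smul' c x := by
    rw [app_smul]
    change (show Module.Dual k (𝒜 (-(l + m))) from f.app l x) _ = _
    exact (congrArg _ (Subtype.ext (by simp [scalar, unit, Algebra.smul_def]))).trans
      (map_smul (show Module.Dual k (𝒜 (-(l + m))) from f.app l x) c _)

lemma toDual_functional {M : GrMod.{max u a, u} 𝒜} {m l : ℤ} (h : l + m = 0)
    (f : M ⟶ dual 𝒜 m) : toDual h (functional h f) = f := by
  ext i x
  refine LinearMap.ext fun b => ?_
  rw [toDual_app_apply]
  change (show Module.Dual k (𝒜 (-(l + m))) from f.app l (M.act _ x b)) _ = _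
  rw [f.app_act]
  exact congrArg (show Module.Dual k (𝒜 (-(i + m))) from f.app i x)
    (Subtype.ext (mul_one (b : A)))

/-- Morphisms from `M` to this module correspond to functionals on the one component `M₋ₘ`, and
functionals on a subspace extend because `k` is a field. -/
instance injective_dual (m : ℤ) : Injective (dual 𝒜 m) where
  factors {X Y} f g hg := by
    have hm : -m + m = 0 := by lia
    obtain ⟨r, hr⟩ := LinearMap.exists_leftInverse_of_injective (appₗ g (-m))
      (LinearMap.ker_eq_bot.2 (injective_of_mono g (-m)))
    refine ⟨toDual hm (functional hm f ∘ₗ r), ?_⟩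
    rw [← toDual_functional hm f]
    ext i x
    refine LinearMap.ext fun b => ?_
    rw [comp_app, toDual_app_apply, toDual_app_apply, ← g.app_act, LinearMap.comp_apply,
      toDual_functional]
    exact congrArg _ (LinearMap.congr_fun hr _)

end GrMod

end GradedDual

/-! ### Functionals on directed systems -/

/-- A compatible family of functionals extends along a degreewise injective map of directed systems
of vector spaces. -/
lemma exists_extend_functionals {k ι : Type*} [Field k] [Preorder ι] [Nonempty ι]
    [IsDirectedOrder ι] {X Y : ι → Type*} [∀ i, AddCommGroup (X i)] [∀ i, AddCommGroup (Y i)]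
    [∀ i, Module k (X i)] [∀ i, Module k (Y i)] (f : ∀ i j, i ≤ j → X i →ₗ[k] X j)
    (f' : ∀ i j, i ≤ j → Y i →ₗ[k] Y j) [DirectedSystem X fun i j h => f i j h]
    [DirectedSystem Y fun i j h => f' i j h] (g : ∀ i, X i →ₗ[k] Y i)
    (hg : ∀ i x, g i x = 0 → x = 0) (hfg : ∀ i j h x, g j (f i j h x) = f' i j h (g i x))
    (φ : ∀ i, X i →ₗ[k] k) (hφ : ∀ i j h x, φ j (f i j h x) = φ i x) :
    ∃ ψ : ∀ i, Y i →ₗ[k] k, (∀ i j h y, ψ j (f' i j h y) = ψ i y) ∧ ∀ i x, ψ i (g i x) = φ i x := by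
  classical
  let G := Module.DirectLimit.map (f := f) (f' := f') g (fun i j h => LinearMap.ext (hfg i j h))
  -- Injectivity passes to the direct limits, because an element that dies in the limit already dies
  -- at some stage. A retraction of the limits then extends the functional on the first limit.
  obtain ⟨r, hr⟩ := LinearMap.exists_leftInverse_of_injective G (by
    rw [LinearMap.ker_eq_bot']
    intro z hz
    obtain ⟨i, x, rfl⟩ := Module.DirectLimit.exists_of z
    rw [Module.DirectLimit.map_apply_of] at hz
    obtain ⟨j, hij, hj⟩ := Module.DirectLimit.of.zero_exact hz
    rw [← hfg] at hj
    rw [← Module.DirectLimit.of_f (hij := hij), hg _ _ hj, map_zero])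
  refine ⟨fun i => Module.DirectLimit.lift k ι X f φ hφ ∘ₗ r ∘ₗ Module.DirectLimit.of k ι Y f' i,
    fun i j h y => ?_, fun i x => ?_⟩
  · simp only [LinearMap.comp_apply, Module.DirectLimit.of_f]
  · have := LinearMap.congr_fun hr (Module.DirectLimit.of k ι X f i x)
    simp only [LinearMap.comp_apply, G, Module.DirectLimit.map_apply_of, LinearMap.id_apply] at this
    simp [this]

/-! ### Algebras with a basis of paths on which the arrows act by a permutation -/

/-- A basis of the graded algebra `A` that consists of orthogonal idempotents `e v` (the vertices)
and of elements `p γ n` of degree `n + 1` (the path of length `n + 1` with arrows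
`γ, σ γ, …, σⁿ γ`), where `σ` is a permutation of the arrows. The source of the arrow `γ` is
`s γ`, and its target is `s (σ γ)`. -/
structure StringBasis {k : Type u} {A : Type a} [Field k] [Ring A] [Algebra k A]
    (𝒜 : ℤ → Submodule k A) (V : Type v) (E : Type w) [Fintype V] [DecidableEq V]
    [DecidableEq E] where
  s : E → V
  σ : Equiv.Perm E
  s_surjective : Function.Surjective s
  e : V → A
  p : E → ℕ → A
  linearIndependent : LinearIndependent k (Sum.elim e fun x : E × ℕ => p x.1 x.2)
  span_eq_top : Submodule.span k (Set.range (Sum.elim e fun x : E × ℕ => p x.1 x.2)) = ⊤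
  span_zero : 𝒜 0 = Submodule.span k (Set.range e)
  span_succ : ∀ n : ℕ, 𝒜 (n + 1) = Submodule.span k (Set.range fun γ => p γ n)
  one_eq : 1 = ∑ v, e v
  e_mul_e : ∀ v w, e v * e w = if w = v then e v else 0
  e_mul_p : ∀ v γ n, e v * p γ n = if s γ = v then p γ n else 0
  p_mul_e : ∀ γ n v, p γ n * e v = if s ((σ ^ (n + 1)) γ) = v then p γ n else 0
  p_mul_p : ∀ γ n δ m, p γ n * p δ m = if δ = (σ ^ (n + 1)) γ then p γ (n + m + 1) else 0

namespace StringBasis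

/-! ### The right action of the algebra on functions on the arrows -/

section Representation

variable {k : Type u} {A : Type a} [Field k] [Ring A] [Algebra k A]
  {𝒜 : ℤ → Submodule k A} {V : Type v} {E : Type w} [Fintype V] [DecidableEq V]
  [DecidableEq E] (B : StringBasis 𝒜 V E)

lemma e_mem (v : V) : B.e v ∈ 𝒜 0 := by
  rw [B.span_zero]
  exact Submodule.subset_span ⟨v, rfl⟩

lemma p_mem {m : ℤ} (γ : E) (n : ℕ) (h : m = n + 1) : B.p γ n ∈ 𝒜 m := by
  rw [h, B.span_succ]
  exact Submodule.subset_span ⟨γ, rfl⟩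

/-- The basis, as a bundled basis. -/
noncomputable def basis : Module.Basis (V ⊕ E × ℕ) k A :=
  Module.Basis.mk B.linearIndependent B.span_eq_top.ge

@[simp] lemma basis_inl (v : V) : B.basis (Sum.inl v) = B.e v := by simp [basis]

@[simp] lemma basis_inr (γ : E) (n : ℕ) : B.basis (Sum.inr (γ, n)) = B.p γ n := by simp [basis]

lemma induction {P : A → Prop} (he : ∀ v, P (B.e v)) (hp : ∀ γ n, P (B.p γ n)) (h0 : P 0)
    (hadd : ∀ x y, P x → P y → P (x + y)) (hsmul : ∀ (c : k) x, P x → P (c • x)) (x : A) :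
    P x := by
  have hx : x ∈ Submodule.span k (Set.range (Sum.elim B.e fun x : E × ℕ => B.p x.1 x.2)) :=
    B.span_eq_top ▸ Submodule.mem_top
  induction hx using Submodule.span_induction with
  | mem x hx =>
    obtain ⟨v | ⟨γ, n⟩, rfl⟩ := hx
    · exact he v
    · exact hp γ n
  | zero => exact h0
  | add x y _ _ hx hy => exact hadd x y hx hy
  | smul c x _ hx => exact hsmul c x hx

/-- The right action of `A` on the functions on the arrows. -/
noncomputable def rep : A →ₗ[k] (E → k) →ₗ[k] (E → k) :=
  B.basis.constr k (Sum.elim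
    (fun v => LinearMap.pi fun β => if B.s β = v then LinearMap.proj β else 0)
    (fun x => LinearMap.single k (fun _ => k) ((B.σ ^ (x.2 + 1)) x.1) ∘ₗ LinearMap.proj x.1))

lemma rep_e (v : V) (y : E → k) (β : E) : B.rep (B.e v) y β = if B.s β = v then y β else 0 := by
  rw [rep, ← basis_inl, Module.Basis.constr_basis]
  by_cases h : B.s β = v <;> simp [h]

lemma rep_p (γ : E) (n : ℕ) (y : E → k) :
    B.rep (B.p γ n) y = Pi.single ((B.σ ^ (n + 1)) γ) (y γ) := by
  rw [rep, ← basis_inr, Module.Basis.constr_basis]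
  simp

lemma rep_mul (a b : A) (y : E → k) : B.rep (a * b) y = B.rep b (B.rep a y) := by
  induction a using B.induction with
  | h0 => simp
  | hadd a a' h h' => simp [add_mul, h, h']
  | hsmul c a h => simp [h]
  | he v =>
    induction b using B.induction with
    | h0 => simp
    | hadd a a' h h' => simp [mul_add, h, h']
    | hsmul c a h => simp [h]
    | he w =>
      ext β
      rw [B.e_mul_e]
      split_ifs with h
      · subst h
        simp only [rep_e]
        split_ifs <;> simp
      · simp only [rep_e, map_zero, LinearMap.zero_apply, Pi.zero_apply]
        split_ifs <;> simp_all
    | hp γ n =>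
      rw [B.e_mul_p, rep_p, rep_e]
      split_ifs with h <;> simp [rep_p]
  | hp γ n =>
    induction b using B.induction with
    | h0 => simp
    | hadd a a' h h' => simp [mul_add, h, h']
    | hsmul c a h => simp [h]
    | he w =>
      ext β
      rw [B.p_mul_e, rep_e, rep_p]
      by_cases hβ : β = (B.σ ^ (n + 1)) γ
      · subst hβ
        split_ifs <;> simp [rep_p]
      · split_ifs <;> simp [rep_p, hβ]
    | hp δ m =>
      rw [B.p_mul_p, rep_p, rep_p]
      split_ifs with h
      · subst h
        rw [rep_p, Pi.single_eq_same, ← Equiv.Perm.mul_apply, ← pow_add]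
        congr 2
        · ring_nf
      · simp [h]

lemma rep_one (y : E → k) : B.rep 1 y = y := by
  ext β
  simp [B.one_eq, rep_e]

/-- The value of an element of `A` on the constant function `1`. -/
noncomputable def toFun : A →ₗ[k] (E → k) := B.rep.flip 1

lemma toFun_apply (x : A) : B.toFun x = B.rep x 1 := rfl

lemma toFun_e (v : V) (β : E) : B.toFun (B.e v) β = if B.s β = v then 1 else 0 := by
  simp [toFun_apply, rep_e]

/-- A path is recorded by the one arrow that continues it, just as a vertex is recorded by all the
arrows that start there. -/
lemma toFun_p (γ : E) (n : ℕ) : B.toFun (B.p γ n) = Pi.single ((B.σ ^ (n + 1)) γ) 1 := by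
  simp [toFun_apply, rep_p]

lemma toFun_mul (x y : A) : B.toFun (x * y) = B.rep y (B.toFun x) := B.rep_mul _ _ _

end Representation

end StringBasis

namespace StringBasis

/-! ### Injectivity of the graded module of functions on the arrows -/

section Resolution

variable {k : Type u} {A : Type (max u a)} [Field k] [Ring A] [Algebra k A]
  {𝒜 : ℤ → Submodule k A} {V : Type v} {E : Type a} [Fintype V] [DecidableEq V]
  [DecidableEq E] (B : StringBasis 𝒜 V E)

/-- The graded module that is the space of functions on the arrows in every degree. -/
noncomputable def functions : GrMod.{max u a, u} 𝒜 where
  carrier _ := E → k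
  act _ := AddMonoidHom.mk' (fun y => AddMonoidHom.mk' (fun b => B.rep b y)
    fun b c => by simp) fun y z => by ext; simp
  act_one _ y e he := by
    change B.rep e y = y
    rw [he, rep_one]
  act_act _ _ _ y b c d hd := by
    change B.rep c (B.rep b y) = B.rep d y
    rw [hd, rep_mul]

/-- The product of the arrows from place `i` to place `j` in the orbit of an arrow. -/
def segment (α : E) (i j : ℤ) : A :=
  if j ≤ i then 1 else B.p ((B.σ ^ i) α) (j - i - 1).toNat

lemma segment_self (α : E) (i : ℤ) : B.segment α i i = 1 := if_pos le_rfl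

lemma segment_of_eq (α : E) (i : ℤ) (n : ℕ) (j : ℤ) (h : j = i + (n + 1)) :
    B.segment α i j = B.p ((B.σ ^ i) α) n := by
  rw [segment, if_neg (by lia)]
  congr 1
  lia

lemma segment_mul (α : E) {i j l : ℤ} (hij : i ≤ j) (hjl : j ≤ l) :
    B.segment α i j * B.segment α j l = B.segment α i l := by
  obtain rfl | hij := hij.eq_or_lt
  · rw [segment_self, one_mul]
  obtain rfl | hjl := hjl.eq_or_lt
  · rw [segment_self, mul_one]
  obtain ⟨n, rfl⟩ : ∃ n : ℕ, j = i + (n + 1) := ⟨(j - i - 1).toNat, by lia⟩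
  obtain ⟨m, rfl⟩ : ∃ m : ℕ, l = i + (n + 1) + (m + 1) :=
    ⟨(l - (i + (n + 1)) - 1).toNat, by lia⟩
  rw [B.segment_of_eq α i n _ rfl, B.segment_of_eq α _ m _ rfl,
    B.segment_of_eq α i (n + m + 1) _ (by push_cast; ring), p_mul_p, if_pos]
  rw [add_comm, zpow_add, Equiv.Perm.mul_apply]
  rfl

lemma rep_segment (α : E) {i j : ℤ} (h : i ≤ j) (y : E → k) :
    B.rep (B.segment α i j) y ((B.σ ^ j) α) = y ((B.σ ^ i) α) := by
  obtain rfl | hij := h.eq_or_lt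
  · rw [segment_self, rep_one]
  obtain ⟨n, rfl⟩ : ∃ n : ℕ, j = i + (n + 1) := ⟨(j - i - 1).toNat, by lia⟩
  rw [B.segment_of_eq α i n _ rfl, rep_p, add_comm i, zpow_add, Equiv.Perm.mul_apply]
  exact Pi.single_eq_same _ _

variable [NonnegGraded 𝒜]

lemma functions_smul (i : ℤ) (c : k) (y : E → k) :
    (show B.functions.carrier i from (c • (show B.functions.carrier i from y))) =
      (c • y : E → k) := by
  change B.rep (algebraMap k A c) y = c • y
  rw [Algebra.algebraMap_eq_smul_one, map_smul, LinearMap.smul_apply, rep_one]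

lemma segment_mem (α : E) {i j : ℤ} (h : i ≤ j) : B.segment α i j ∈ 𝒜 (j - i) := by
  rw [segment]
  split_ifs with h'
  · obtain rfl : j = i := by lia
    rw [sub_self]
    exact SetLike.GradedOne.one_mem
  · exact B.p_mem _ _ (by lia)

/-- Right multiplication by segments, on the components of a graded module. -/
noncomputable def transport (α : E) (M : GrMod.{max u a, u} 𝒜) (i j : ℤ) (h : i ≤ j) :
    M.carrier i →ₗ[k] M.carrier j :=
  GrMod.actₗ M (show i + (j - i) = j by lia) ⟨B.segment α i j, B.segment_mem α h⟩

instance directedSystem_transport (α : E) (M : GrMod.{max u a, u} 𝒜) :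
    DirectedSystem M.carrier fun i j h => B.transport α M i j h where
  map_self i x := by
    refine (GrMod.act_eq_act M _ (add_zero i) x _ (GrMod.unit 𝒜 0 rfl) ?_).trans
      (M.act_one _ _ _ rfl)
    exact B.segment_self α i
  map_map {l j i} hij hjl x :=
    M.act_act _ _ _ _ _ _ _ (B.segment_mul α hij hjl).symm

/-- The values of a morphism at the arrows `σⁱ α`, for varying degree `i`, form a family of
functionals that is compatible with multiplication by the segments of the orbit of `α`. So such a
family extends by linear algebra in the direct limit. -/
lemma exists_extend_coordinate (α : E) {X Y : GrMod.{max u a, u} 𝒜} (g : X ⟶ Y) [Mono g]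
    (f : X ⟶ B.functions) : ∃ ψ : ∀ i, Y.carrier i →ₗ[k] k,
      (∀ i j h y, ψ j (B.transport α Y i j h y) = ψ i y) ∧
      ∀ i x, ψ i (g.app i x) = (show E → k from f.app i x) ((B.σ ^ i) α) := by
  refine exists_extend_functionals (B.transport α X) (B.transport α Y) (GrMod.appₗ g)
    (fun i x hx => GrMod.injective_of_mono g i (hx.trans (map_zero (g.app i)).symm))
    (fun i j h x => g.app_act _ _ _)
    (fun i =>
      { toFun := fun x => (show E → k from f.app i x) ((B.σ ^ i) α)
        map_add' := fun x y => by rw [map_add]; rfl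
        map_smul' := fun c x => by
          rw [GrMod.app_smul]
          exact congrFun (B.functions_smul i c (f.app i x)) _ })
    (fun i j h x => ?_)
  change (show E → k from f.app j (X.act _ x _)) ((B.σ ^ j) α) = _
  rw [f.app_act]
  exact B.rep_segment α h (f.app i x)

/-- The families of functionals for the various `α` are extended independently of each other. The
resulting map is `A`-linear because a coordinate `β` may be computed after multiplication by the
arrow `β`, where the multiplication table of the paths decides what survives. -/
instance injective_functions : Injective B.functions where
  factors {X Y} f g hg := by
    choose ψ hψ hψg using fun α => B.exists_extend_coordinate α g f
    have hstep : ∀ (α β : E) (i j : ℤ) (n : ℕ) (y : Y.carrier i) (b : 𝒜 (n + 1))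
        (hj : i + (n + 1) = j), (B.σ ^ i) α = β → (b : A) = B.p β n →
        ψ α j (Y.act hj y b) = ψ α i y := fun α β i j n y b hj hβ hb => by
      rw [← hψ α i j (by lia) y]
      congr 1
      refine GrMod.act_eq_act _ _ _ _ _ _ ?_
      exact hb.trans (by rw [← hβ]; exact (B.segment_of_eq α i n j (by lia)).symm)
    -- In degree `i`, the arrow `β` is at place `i` of the orbit that has `σ⁻ⁱ β` at place zero.
    let h (i : ℤ) : Y.carrier i →ₗ[k] (E → k) := LinearMap.pi fun β => ψ ((B.σ ^ (-i)) β) i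
    have hσ : ∀ (i : ℤ) (β : E), (B.σ ^ i) ((B.σ ^ (-i)) β) = β := fun i β => by
      rw [← Equiv.Perm.mul_apply, ← zpow_add]; simp
    have harrow : ∀ (i j : ℤ) (hj : i + ((0 : ℕ) + 1) = j) (y : Y.carrier i) (β : E),
        h i y β = ψ ((B.σ ^ (-i)) β) j (Y.act hj y ⟨B.p β 0, B.p_mem β 0 rfl⟩) :=
      fun i j hj y β => (hstep _ β i j 0 y _ hj (hσ i β) rfl).symm
    have hact : ∀ (b : A) (i n j : ℤ) (hj : i + n = j) (hb : b ∈ 𝒜 n) (y : Y.carrier i),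
        h j (Y.act hj y ⟨b, hb⟩) = B.rep b (h i y) := by
      intro b i n j hj hb y
      rcases lt_or_ge n 0 with hn | hn
      · have hb0 : b = 0 := by
          have : b ∈ (⊥ : Submodule k A) := NonnegGraded.eq_bot_of_neg (𝒜 := 𝒜) n hn ▸ hb
          exact this
        rw [GrMod.act_of_neg _ _ hn, hb0]
        simp
      obtain rfl | hn := hn.eq_or_lt
      · have hb' := hb
        rw [B.span_zero] at hb'
        obtain rfl : i = j := by lia
        induction hb' using Submodule.span_induction with
        | zero =>
          have : (⟨0, hb⟩ : 𝒜 0) = 0 := rfl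
          rw [this]; simp
        | add b c hb' hc' h₁ h₂ =>
          rw [← B.span_zero] at hb' hc'
          have : (⟨b + c, hb⟩ : 𝒜 0) = ⟨b, hb'⟩ + ⟨c, hc'⟩ := rfl
          rw [this, map_add, map_add, h₁ hb', h₂ hc', map_add, LinearMap.add_apply]
        | smul c b hb' h₁ =>
          rw [← B.span_zero] at hb'
          have : (⟨c • b, hb⟩ : 𝒜 0) = c • ⟨b, hb'⟩ := rfl
          rw [this, GrMod.act_smul, map_smul, h₁ hb', map_smul, LinearMap.smul_apply]
        | mem b hb' =>
          obtain ⟨v, rfl⟩ := hb'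
          ext β
          -- Both coordinates are read off one degree higher, where the vertex `v` acts through the
          -- product of `v` and the arrow `β`: this is `β` or zero.
          rw [harrow i (i + 1) (by simp), rep_e, harrow i (i + 1) (by simp),
            Y.act_act _ _ (show i + ((0 : ℕ) + 1 : ℤ) = i + 1 by simp) y _ _
              (if B.s β = v then ⟨B.p β 0, B.p_mem β 0 rfl⟩ else 0)
              (by split_ifs <;> simp [e_mul_p, *])]
          split_ifs <;> simp
      · obtain ⟨n, rfl⟩ : ∃ m : ℕ, n = m + 1 := ⟨(n - 1).toNat, by lia⟩
        have hb' := hb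
        rw [B.span_succ] at hb'
        induction hb' using Submodule.span_induction with
        | zero =>
          have : (⟨0, hb⟩ : 𝒜 (n + 1)) = 0 := rfl
          rw [this]; simp
        | add b c hb' hc' h₁ h₂ =>
          rw [← B.span_succ] at hb' hc'
          have : (⟨b + c, hb⟩ : 𝒜 (n + 1)) = ⟨b, hb'⟩ + ⟨c, hc'⟩ := rfl
          rw [this, map_add, map_add, h₁ hb', h₂ hc', map_add, LinearMap.add_apply]
        | smul c b hb' h₁ =>
          rw [← B.span_succ] at hb'
          have : (⟨c • b, hb⟩ : 𝒜 (n + 1)) = c • ⟨b, hb'⟩ := rfl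
          rw [this, GrMod.act_smul, map_smul, h₁ hb', map_smul, LinearMap.smul_apply]
        | mem b hb' =>
          obtain ⟨γ, rfl⟩ := hb'
          ext β
          rw [rep_p]
          by_cases hβ : β = (B.σ ^ (n + 1)) γ
          · rw [hβ, Pi.single_eq_same]
            have hα : (B.σ ^ (-j)) ((B.σ ^ (n + 1)) γ) = (B.σ ^ (-i)) γ := by
              rw [← zpow_natCast, ← Equiv.Perm.mul_apply, ← zpow_add]
              congr 2
              push_cast
              lia
            change ψ ((B.σ ^ (-j)) ((B.σ ^ (n + 1)) γ)) j _ = ψ ((B.σ ^ (-i)) γ) i y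
            rw [hα]
            exact hstep _ γ i j n y _ hj (hσ i γ) rfl
          -- For any other `β` the path followed by `β` is zero in `A`, so the coordinate vanishes.
          · rw [Pi.single_eq_of_ne hβ, harrow j (j + 1) (by simp),
              Y.act_act _ _ (show i + ((n : ℤ) + 2) = j + 1 by lia) y _ _ 0
                (by simp [p_mul_p, hβ])]
            simp
    refine ⟨(⟨fun i => (h i).toAddMonoidHom, fun {i n j} hj y b => hact b i n j hj b.2 y⟩ : GrMod.Hom Y B.functions), ?_⟩
    ext i x
    refine funext fun β => ?_
    change ψ ((B.σ ^ (-i)) β) i (g.app i x) = _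
    rw [hψg, hσ]

end Resolution

end StringBasis

namespace StringBasis

/-! ### Homogeneous elements as functions on the arrows -/

section Coefficients

variable {k : Type u} {A : Type a} [Field k] [Ring A] [Algebra k A]
  {𝒜 : ℤ → Submodule k A} {V : Type v} {E : Type w} [Fintype V] [DecidableEq V]
  [Fintype E] [DecidableEq E] (B : StringBasis 𝒜 V E)

lemma exists_coeff_zero {x : A} (hx : x ∈ 𝒜 0) : ∃ c : V → k, x = ∑ v, c v • B.e v := by
  rw [B.span_zero, Submodule.mem_span_range_iff_exists_fun] at hx
  exact hx.imp fun _ h => h.symm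

lemma exists_coeff_succ {x : A} {n : ℕ} (hx : x ∈ 𝒜 (n + 1)) :
    ∃ c : E → k, x = ∑ γ, c γ • B.p γ n := by
  rw [B.span_succ, Submodule.mem_span_range_iff_exists_fun] at hx
  exact hx.imp fun _ h => h.symm

lemma toFun_sum_e (c : V → k) (β : E) : B.toFun (∑ v, c v • B.e v) β = c (B.s β) := by
  simp [toFun_e]

lemma toFun_sum_p (c : E → k) (n : ℕ) (γ : E) :
    B.toFun (∑ γ, c γ • B.p γ n) ((B.σ ^ (n + 1)) γ) = c γ := by
  simp [toFun_p, Pi.single_apply, Finset.sum_apply]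

/-- Paths of a fixed positive length are separated by the arrows that continue them, and vertices by
the arrows that start there. Homogeneity matters: paths of different lengths may have the same
continuation. -/
lemma eq_zero_of_toFun_eq_zero [NonnegGraded 𝒜] {x : A} {n : ℤ} (hx : x ∈ 𝒜 n)
    (h : B.toFun x = 0) : x = 0 := by
  rcases lt_or_ge n 0 with hn | hn
  · rw [NonnegGraded.eq_bot_of_neg (𝒜 := 𝒜) n hn] at hx
    exact hx
  obtain rfl | hn := hn.eq_or_lt
  · obtain ⟨c, rfl⟩ := B.exists_coeff_zero hx
    refine Finset.sum_eq_zero fun v _ => ?_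
    obtain ⟨β, rfl⟩ := B.s_surjective v
    rw [← toFun_sum_e B c β, h]
    simp
  · obtain ⟨n, rfl⟩ : ∃ m : ℕ, n = m + 1 := ⟨(n - 1).toNat, by lia⟩
    obtain ⟨c, rfl⟩ := B.exists_coeff_succ hx
    refine Finset.sum_eq_zero fun γ _ => ?_
    rw [← toFun_sum_p B c n γ, h]
    simp

/-- In positive degree every arrow continues exactly one path, since powers of `σ` are bijective. -/
lemma exists_toFun_eq {n : ℤ} (hn : 0 < n) (y : E → k) : ∃ x ∈ 𝒜 n, B.toFun x = y := by
  obtain ⟨n, rfl⟩ : ∃ m : ℕ, n = m + 1 := ⟨(n - 1).toNat, by lia⟩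
  refine ⟨∑ γ, y ((B.σ ^ (n + 1)) γ) • B.p γ n,
    Submodule.sum_mem _ fun γ _ => Submodule.smul_mem _ _ (B.p_mem γ n rfl), ?_⟩
  ext β
  obtain ⟨γ, rfl⟩ := (B.σ ^ (n + 1)).surjective β
  exact B.toFun_sum_p _ n γ

lemma exists_toFun_eq_comp (c : V → k) : ∃ x ∈ 𝒜 0, B.toFun x = c ∘ B.s :=
  ⟨∑ v, c v • B.e v, Submodule.sum_mem _ fun v _ => Submodule.smul_mem _ _ (B.e_mem v),
    funext fun β => B.toFun_sum_e c β⟩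

lemma linearMap_ext_zero {M : Type*} [AddCommGroup M] [Module k M] {n : ℤ} (hn : n = 0)
    {f g : 𝒜 n →ₗ[k] M} (h : ∀ v, f ⟨B.e v, hn ▸ B.e_mem v⟩ = g ⟨B.e v, hn ▸ B.e_mem v⟩) :
    f = g := by
  subst hn
  ext ⟨x, hx⟩
  obtain ⟨c, rfl⟩ := B.exists_coeff_zero hx
  have hx' : (⟨∑ v, c v • B.e v, hx⟩ : 𝒜 0) = ∑ v, c v • ⟨B.e v, B.e_mem v⟩ :=
    Subtype.ext (by simp)
  simp only [hx', map_sum, map_smul, h]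

lemma linearMap_ext_succ {M : Type*} [AddCommGroup M] [Module k M] {m : ℤ} {n : ℕ}
    (hm : m = n + 1) {f g : 𝒜 m →ₗ[k] M}
    (h : ∀ γ, f ⟨B.p γ n, B.p_mem γ n hm⟩ = g ⟨B.p γ n, B.p_mem γ n hm⟩) : f = g := by
  subst hm
  ext ⟨x, hx⟩
  obtain ⟨c, rfl⟩ := B.exists_coeff_succ hx
  have hx' : (⟨∑ γ, c γ • B.p γ n, hx⟩ : 𝒜 (n + 1)) = ∑ γ, c γ • ⟨B.p γ n, B.p_mem γ n rfl⟩ :=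
    Subtype.ext (by simp)
  simp only [hx', map_sum, map_smul, h]

end Coefficients

/-! ### Injective coresolutions of length one of the regular module -/

section Resolution

variable {k : Type u} {A : Type (max u a)} [Field k] [Ring A] [Algebra k A]
  {𝒜 : ℤ → Submodule k A} [NonnegGraded 𝒜] {V : Type v} {E : Type a} [Fintype V] [DecidableEq V]
  [Fintype E] [DecidableEq E] (B : StringBasis 𝒜 V E)

/-- The embedding of a shift of the regular module into the functions on the arrows. -/
noncomputable def embedding (j : ℤ) : (regular 𝒜).shift j ⟶ B.functions :=
  (⟨fun i => AddMonoidHom.mk' (fun x : 𝒜 (i + j) => B.toFun x) fun _ _ => map_add B.toFun _ _,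
    fun _ _ _ => B.toFun_mul _ _⟩ : GrMod.Hom ((regular 𝒜).shift j) B.functions)

lemma embedding_app {i j : ℤ} (x : 𝒜 (i + j)) :
    (B.embedding j).app i x = (B.toFun (x : A) : E → k) := rfl

lemma embedding_injective (i j : ℤ) (x : ((regular 𝒜).shift j).carrier i)
    (hx : (B.embedding j).app i x = 0) : x = 0 :=
  Subtype.ext (B.eq_zero_of_toFun_eq_zero (show 𝒜 (i + j) from x).2 hx)

/-- The weighted sum of the values of a function on the arrows. -/
noncomputable def weightedSum (ε : E → k) (l : ℤ) : B.functions.carrier l →ₗ[k] k where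
  toFun (y : E → k) := ∑ β, ε β * y β
  map_add' (y z : E → k) := by
    rw [← Finset.sum_add_distrib]
    exact Finset.sum_congr rfl fun β _ => mul_add _ _ _
  map_smul' c (y : E → k) := by
    rw [RingHom.id_apply, smul_eq_mul, Finset.mul_sum]
    refine Finset.sum_congr rfl fun β _ => ?_
    exact (congrArg (ε β * ·) (congrFun (B.functions_smul l c y) β)).trans (mul_left_comm _ _ _)

/-- The morphism from the functions on the arrows to the graded dual given by a weighted sum. -/
noncomputable def toDual (ε : E → k) (m : ℤ) : B.functions ⟶ GrMod.dual 𝒜 m :=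
  GrMod.toDual (neg_add_cancel m) (B.weightedSum ε (-m))

lemma toDual_app_apply (ε : E → k) {m i : ℤ} (y : E → k) (b : 𝒜 (-(i + m))) :
    (show Module.Dual k (𝒜 (-(i + m))) from (B.toDual ε m).app i y) b =
      ∑ β, ε β * B.rep b y β := rfl

lemma sum_mul_rep_e (ε y : E → k) (v : V) :
    ∑ β, ε β * B.rep (B.e v) y β = ∑ β with B.s β = v, ε β * y β := by
  simp [rep_e, Finset.sum_filter]

lemma sum_mul_rep_p (ε y : E → k) (γ : E) (n : ℕ) :
    ∑ β, ε β * B.rep (B.p γ n) y β = ε ((B.σ ^ (n + 1)) γ) * y γ := by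
  simp [rep_p, Pi.single_apply]

/-- On paths of positive length a functional can be prescribed arbitrarily, because the weights are
invertible and each path picks out its own coordinate. Only the dual of `A₀`, where the values at
all arrows from a vertex are summed, needs the hypothesis `h`. -/
lemma toDual_surjective {ε : E → k} (hε : ∀ β, ε β ≠ 0)
    (h : ∀ φ : V → k, ∃ y : E → k, ∀ v, ∑ β with B.s β = v, ε β * y β = φ v) (m i : ℤ) :
    Function.Surjective ((B.toDual ε m).app i) := by
  intro φ
  let φ' : Module.Dual k (𝒜 (-(i + m))) := φ
  rcases lt_or_ge (-(i + m)) 0 with hn | hn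
  · refine ⟨0, (map_zero _).trans (LinearMap.ext fun x => ?_)⟩
    obtain rfl : x = 0 := Subtype.ext <| by
      have : (x : A) ∈ (⊥ : Submodule k A) := NonnegGraded.eq_bot_of_neg (𝒜 := 𝒜) _ hn ▸ x.2
      exact this
    exact (map_zero φ').symm
  obtain hn | hn := hn.eq_or_lt
  · obtain ⟨y, hy⟩ := h fun v => φ' ⟨B.e v, hn ▸ B.e_mem v⟩
    refine ⟨y, B.linearMap_ext_zero (f := (show Module.Dual k _ from (B.toDual ε m).app i y))
      (g := φ') hn.symm fun v => ?_⟩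
    rw [toDual_app_apply, sum_mul_rep_e, hy]
  · obtain ⟨n, hn⟩ : ∃ n : ℕ, -(i + m) = n + 1 := ⟨(-(i + m) - 1).toNat, by lia⟩
    refine ⟨fun γ => (ε ((B.σ ^ (n + 1)) γ))⁻¹ * φ' ⟨B.p γ n, B.p_mem γ n hn⟩, ?_⟩
    refine B.linearMap_ext_succ (f := (show Module.Dual k _ from (B.toDual ε m).app i _))
      (g := φ') hn fun γ => ?_
    rw [toDual_app_apply, sum_mul_rep_p, mul_inv_cancel_left₀ (hε _)]

lemma eq_zero_of_toDual_app_eq_zero {ε : E → k} (hε : ∀ β, ε β ≠ 0) {m i : ℤ} (him : i + m < 0)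
    (y : E → k) (hy : (B.toDual ε m).app i y = 0) : y = 0 := by
  ext γ
  obtain ⟨n, hn⟩ : ∃ n : ℕ, -(i + m) = n + 1 := ⟨(-(i + m) - 1).toNat, by lia⟩
  have h := B.toDual_app_apply ε y ⟨B.p γ n, B.p_mem γ n hn⟩
  rw [sum_mul_rep_p, hy] at h
  exact (mul_eq_zero.1 h.symm).resolve_left (hε _)

lemma sum_eq_zero_of_toDual_app_eq_zero {ε : E → k} {m i : ℤ} (him : i + m = 0) (y : E → k)
    (hy : (B.toDual ε m).app i y = 0) (v : V) : ∑ β with B.s β = v, ε β * y β = 0 := by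
  have h := B.toDual_app_apply ε y ⟨B.e v, show B.e v ∈ 𝒜 (-(i + m)) by rw [him]; exact B.e_mem v⟩
  rw [sum_mul_rep_e, hy] at h
  exact h.symm

lemma exists_embedding_app_eq {i j : ℤ} {x : A} (hx : x ∈ 𝒜 (i + j)) {y : E → k}
    (hy : B.toFun x = y) : ∃ x, (B.embedding j).app i x = (show B.functions.carrier i from y) :=
  ⟨(⟨x, hx⟩ : 𝒜 (i + j)), hy⟩

/-- With one arrow from each vertex, `A` fills up the functions in every degree `≥ 0`. So the
cokernel of `A[j]` consists of all functions in degrees below `-j`, and this is the graded dual of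
`A` shifted by `j + 1`. -/
lemma hasInjectiveDimensionLT_two_of_injective (hs : Function.Injective B.s) (j : ℤ) :
    HasInjectiveDimensionLT ((regular 𝒜).shift j) 2 := by
  have hsum : ∀ (y : E → k) β, ∑ γ with B.s γ = B.s β, (1 : E → k) γ * y γ = y β := by
    intro y β
    simp [hs.eq_iff, Finset.sum_filter]
  let S : ShortComplex (GrMod 𝒜) :=
    ShortComplex.mk (B.embedding j) (B.toDual 1 (j + 1)) (by
      ext i x
      let x' : 𝒜 (i + j) := x
      refine LinearMap.ext fun b => (B.toDual_app_apply 1 (B.toFun x'.1) b).trans ?_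
      rw [← toFun_mul]
      -- The composition is zero for reasons of degree.
      have hb : x'.1 * b.1 ∈ 𝒜 (-1) := by
        have := SetLike.mul_mem_graded x'.2 b.2
        rwa [show i + j + -(i + (j + 1)) = -1 by lia] at this
      rw [NonnegGraded.eq_bot_of_neg (𝒜 := 𝒜) (-1) (by lia), Submodule.mem_bot] at hb
      rw [hb, map_zero]
      exact Finset.sum_eq_zero fun _ _ => mul_zero _)
  have hS : S.ShortExact := by
    refine GrMod.shortExact_of_degreewise (B.embedding_injective · j)
      (B.toDual_surjective (by simp) (fun φ => ⟨fun β => φ (B.s β), fun v => ?_⟩) (j + 1))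
      fun i y hy => ?_
    · obtain ⟨β, rfl⟩ := B.s_surjective v
      exact hsum _ β
    · rcases lt_trichotomy (i + j) 0 with hij | hij | hij
      · obtain rfl : y = 0 := by
          rcases (show i + (j + 1) ≤ 0 by lia).lt_or_eq with h | h
          · exact B.eq_zero_of_toDual_app_eq_zero (by simp) h y hy
          · exact funext fun β => (hsum y β).symm.trans
              (B.sum_eq_zero_of_toDual_app_eq_zero h y hy _)
        exact ⟨0, map_zero _⟩
      · obtain ⟨x, hx, hxy⟩ :=
          B.exists_toFun_eq_comp (𝒜 := 𝒜) (fun v => (show E → k from y) (Function.surjInv B.s_surjective v))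
        refine B.exists_embedding_app_eq (hij ▸ hx) (hxy.trans (funext fun β => ?_))
        exact congrArg (show E → k from y) (hs (Function.surjInv_eq B.s_surjective (B.s β)))
      · obtain ⟨x, hx, hxy⟩ := B.exists_toFun_eq hij y
        exact B.exists_embedding_app_eq hx hxy
  have : Injective S.X₂ := B.injective_functions
  have : Injective S.X₃ := GrMod.injective_dual _
  exact LocGentle.hasInjectiveDimensionLT_two_of_injective hS

/-- With two arrows from each vertex, `A₀` is only half of the functions. The other half is the dual
of `A₀`, so the cokernel of `A[j]` is the graded dual shifted by `j`, one less than for a single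
arrow. -/
lemma hasInjectiveDimensionLT_two_of_two_arrows (hs : ∀ v, ∃ β β', β ≠ β' ∧
    ∀ γ, B.s γ = v ↔ γ = β ∨ γ = β') (j : ℤ) :
    HasInjectiveDimensionLT ((regular 𝒜).shift j) 2 := by
  choose β₁ β₂ hne hs using hs
  -- With opposite weights, the sum over the arrows from `v` is the difference of two values. It
  -- vanishes at all `v` exactly for the functions of the source, which are those that come from
  -- `A₀`.
  let ε : E → k := fun γ => if γ = β₁ (B.s γ) then 1 else -1
  have hε : ∀ γ, ε γ ≠ 0 := fun γ => by simp only [ε]; split_ifs <;> simp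
  have hs₁ : ∀ v, B.s (β₁ v) = v := fun v => (hs v _).2 (Or.inl rfl)
  have hs₂ : ∀ v, B.s (β₂ v) = v := fun v => (hs v _).2 (Or.inr rfl)
  have hsum : ∀ (y : E → k) v, ∑ γ with B.s γ = v, ε γ * y γ = y (β₁ v) - y (β₂ v) := by
    intro y v
    have : Finset.univ.filter (fun γ => B.s γ = v) = {β₁ v, β₂ v} := by
      ext γ
      simp [hs]
    rw [this, Finset.sum_pair (hne v)]
    simp [ε, hs₁, hs₂, (hne v).symm, sub_eq_add_neg]
  let S : ShortComplex (GrMod 𝒜) :=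
    ShortComplex.mk (B.embedding j) (B.toDual ε j) (by
      ext i x
      let x' : 𝒜 (i + j) := x
      refine LinearMap.ext fun b => (B.toDual_app_apply ε (B.toFun x'.1) b).trans ?_
      rw [← toFun_mul]
      have hb : x'.1 * b.1 ∈ 𝒜 0 := by
        have := SetLike.mul_mem_graded x'.2 b.2
        rwa [show i + j + -(i + j) = 0 by lia] at this
      obtain ⟨c, hc⟩ := B.exists_coeff_zero hb
      rw [hc]
      simp only [toFun_sum_e]
      rw [← Finset.sum_fiberwise (g := B.s)]
      refine Finset.sum_eq_zero fun v _ => ?_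
      rw [hsum, hs₁, hs₂, sub_self])
  have hS : S.ShortExact := by
    refine GrMod.shortExact_of_degreewise (B.embedding_injective · j)
      (B.toDual_surjective hε (fun φ => ⟨fun β => if β = β₁ (B.s β) then φ (B.s β) else 0,
        fun v => ?_⟩) j) fun i y hy => ?_
    · rw [hsum]
      simp [hs₁, hs₂, (hne v).symm]
    · rcases lt_trichotomy (i + j) 0 with hij | hij | hij
      · obtain rfl : y = 0 := B.eq_zero_of_toDual_app_eq_zero hε hij y hy
        exact ⟨0, map_zero _⟩
      · obtain ⟨x, hx, hxy⟩ :=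
          B.exists_toFun_eq_comp (𝒜 := 𝒜) (fun v => (show E → k from y) (β₁ v))
        refine B.exists_embedding_app_eq (hij ▸ hx) (hxy.trans (funext fun γ => ?_))
        have h := B.sum_eq_zero_of_toDual_app_eq_zero hij y hy (B.s γ)
        replace h := sub_eq_zero.1 ((hsum y (B.s γ)).symm.trans h)
        obtain h' | h' := (hs (B.s γ) γ).1 rfl
        · exact congrArg (show E → k from y) h'.symm
        · exact h.trans (congrArg (show E → k from y) h'.symm)
      · obtain ⟨x, hx, hxy⟩ := B.exists_toFun_eq hij y
        exact B.exists_embedding_app_eq hx hxy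
  have : Injective S.X₂ := B.injective_functions
  have : Injective S.X₃ := GrMod.injective_dual _
  exact LocGentle.hasInjectiveDimensionLT_two_of_injective hS

include B in
/-- The regular module is not injective. -/
lemma not_injective_regular [Nonempty E] : ¬ Injective (regular 𝒜) := by
  intro h
  obtain ⟨γ⟩ := ‹Nonempty E›
  have : Injective ((regular 𝒜).shift 0) := Injective.of_iso GrMod.regularIsoShiftZero h
  have : Mono (B.embedding 0) :=
    GrMod.mono_of_injective _ (B.embedding_injective · 0)
  let r := Injective.factorThru (𝟙 _) (B.embedding 0)
  have hr : B.embedding 0 ≫ r = 𝟙 _ := Injective.comp_factorThru _ _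
  -- A retraction `r` onto `A` kills the indicator functions in degree `-1`, as `A₋₁ = 0`.
  -- Multiplication by arrows carries this over to degrees zero and one, but there the indicator
  -- function is the image of an arrow, which `r` has to preserve.
  let y (β : E) (i : ℤ) : B.functions.carrier i := (Pi.single β 1 : E → k)
  have hact : ∀ (β : E) (i j : ℤ) (h : i + 1 = j),
      B.functions.act h (y β i) ⟨B.p β 0, B.p_mem β 0 rfl⟩ = y (B.σ β) j := fun β i j h => by
    refine (B.rep_p β 0 _).trans ?_
    simp [y]
  have h0 : r.app 0 (y (B.σ γ) 0) = 0 := by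
    rw [← hact γ (-1) 0 rfl, r.app_act]
    have : r.app (-1) (y γ (-1)) = 0 := by
      have h1 : ((show 𝒜 (-1 + 0) from r.app (-1) (y γ (-1))) : A) ∈ (⊥ : Submodule k A) :=
        (NonnegGraded.eq_bot_of_neg (𝒜 := 𝒜) (-1 + 0) (by lia)).le (Subtype.mem _)
      exact Subtype.ext h1
    rw [this]
    simp
  have h1 : r.app 1 (y (B.σ (B.σ γ)) 1) = 0 := by
    rw [← hact (B.σ γ) 0 1 rfl, r.app_act, h0]
    simp
  have h2 : (B.embedding 0).app 1 (⟨B.p (B.σ γ) 0, B.p_mem _ 0 rfl⟩ : 𝒜 (1 + 0)) =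
      y (B.σ (B.σ γ)) 1 := by
    exact (B.embedding_app _).trans (B.toFun_p _ 0)
  rw [← h2] at h1
  have h3 := (congrArg (fun t : (regular 𝒜).shift 0 ⟶ (regular 𝒜).shift 0 =>
    t.app 1 (⟨B.p (B.σ γ) 0, B.p_mem _ 0 rfl⟩ : 𝒜 (1 + 0))) hr).symm.trans h1
  exact B.linearIndependent.ne_zero (Sum.inr (B.σ γ, 0)) (congrArg Subtype.val h3)

include B in
lemma injectiveDimension_regular_eq_one [Nonempty E]
    (h : ∀ j : ℤ, HasInjectiveDimensionLT ((regular 𝒜).shift j) 2) :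
    injectiveDimension (regular 𝒜) = (1 : ℕ) := by
  have : HasInjectiveDimensionLT (regular 𝒜) 2 :=
    have := h 0
    hasInjectiveDimensionLT_of_iso GrMod.regularIsoShiftZero.symm 2
  refine le_antisymm ((injectiveDimension_le_iff _ 1).2 this) ((injectiveDimension_ge_iff _ 1).2 ?_)
  rw [← injective_iff_hasInjectiveDimensionLT_one]
  exact B.not_injective_regular

end Resolution

end StringBasis

section

open scoped TensorProduct



/-! ### Bimodules twisted by an automorphism -/

section Twisted

/-- The ring `S` as a bimodule over itself, with the right action twisted by an automorphism. -/
def Twisted {S : Type a} [Ring S] (_ν : S ≃+* S) : Type a := S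

variable {S : Type a} [Ring S] (ν μ : S ≃+* S)

instance : AddCommGroup (Twisted ν) := inferInstanceAs (AddCommGroup S)
instance : Module S (Twisted ν) := inferInstanceAs (Module S S)
instance : Module Sᵐᵒᵖ (Twisted ν) :=
  Module.compHom S (RingHom.op (ν : S →+* S))

instance : SMulCommClass S Sᵐᵒᵖ (Twisted ν) :=
  ⟨fun s t v => (mul_assoc s (show S from v) (ν t.unop)).symm⟩

/-- The biadditive map `(v, x) ↦ v * ν x`. -/
def twistedMul : S →+ S →+ S :=
  AddMonoidHom.mk' (fun v => (AddMonoidHom.mulLeft v).comp (ν : S →+* S).toAddMonoidHom)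
    fun v w => AddMonoidHom.ext fun x => add_mul v w (ν x)

/-- The biadditive map `(v, x) ↦ v * ν x` on twisted bimodules. -/
def Twisted.mulHom : Twisted ν →+ Twisted μ →+ S := twistedMul (S := S) ν

/-- Multiplication, as a map on the tensor product of twisted bimodules. -/
def Twisted.tensorHom : BalancedTensor S (Twisted ν) (Twisted μ) →+ S :=
  QuotientAddGroup.lift _
    (TensorProduct.liftAddHom (Twisted.mulHom ν μ)
      fun n v x => by
        rw [map_zsmul, map_zsmul]; rfl) (by
      rw [AddSubgroup.closure_le]
      rintro _ ⟨v, s, x, rfl⟩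
      refine (map_sub _ _ _).trans (sub_eq_zero.2 ?_)
      change (show S from v) * ν s * ν (show S from x) =
        (show S from v) * ν (s * (show S from x))
      rw [map_mul, mul_assoc])

lemma Twisted.tensorHom_tmul (v : Twisted ν) (x : Twisted μ) :
    Twisted.tensorHom ν μ (BalancedTensor.tmul S v x) =
      (show S from v) * ν (show S from x) := rfl

/-- The inverse of `Twisted.tensorHom`. -/
def Twisted.tensorInv : S →+ BalancedTensor S (Twisted ν) (Twisted μ) :=
  AddMonoidHom.mk' (fun s => BalancedTensor.tmul S (show Twisted ν from s) (show Twisted μ from (1 : S)))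
    fun _ _ => congrArg QuotientAddGroup.mk (TensorProduct.add_tmul (R := ℤ) _ _ _)

/-- The map `v ⊗ x ↦ v ν(x)` has the inverse `s ↦ s ⊗ 1`: the relation `v ⊗ x = v·x ⊗ 1` holds in
the balanced tensor product, with `v·x = v ν(x)` by the twist. The second twist `μ` has to undo `ν`
for right linearity. -/
lemma Twisted.tensorIsoSelf (h : ∀ x, ν (μ x) = x) : TensorIsoSelf S (Twisted ν) (Twisted μ) := by
  refine ⟨{ Twisted.tensorHom ν μ with
    invFun := Twisted.tensorInv ν μ
    left_inv := fun z => ?_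
    right_inv := fun s => (Twisted.tensorHom_tmul ν μ _ _).trans (by simp) },
    fun s v x => mul_assoc s (show S from v) (ν (show S from x)), fun s v x => ?_⟩
  · suffices h : (Twisted.tensorInv ν μ).comp (Twisted.tensorHom ν μ) = AddMonoidHom.id _ from
      DFunLike.congr_fun h z
    refine QuotientAddGroup.addMonoidHom_ext _ (AddMonoidHom.ext fun z => ?_)
    induction z using TensorProduct.induction_on with
    | zero => rw [map_zero, map_zero]
    | add x y hx hy => rw [map_add, map_add, hx, hy]
    | tmul v x =>
    change BalancedTensor.tmul S (show Twisted ν from ((show S from v) * ν x : S))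
      (show Twisted μ from (1 : S)) = BalancedTensor.tmul S v x
    refine (QuotientAddGroup.eq.2 ?_).trans (congrArg (BalancedTensor.tmul S v)
      (mul_one (show S from x)))
    rw [neg_add_eq_sub, ← neg_sub]
    exact AddSubgroup.neg_mem _ (AddSubgroup.subset_closure ⟨v, x, (show Twisted μ from (1 : S)), rfl⟩)
  · change (show S from v) * ν ((show S from x) * μ s) = (show S from v) * ν (show S from x) * s
    rw [map_mul, h, mul_assoc]

lemma Twisted.isInvertibleBimodule : IsInvertibleBimodule S (Twisted ν) :=
  ⟨Twisted ν.symm, inferInstance, inferInstance, inferInstance, inferInstance,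
    Twisted.tensorIsoSelf _ _ ν.apply_symm_apply, Twisted.tensorIsoSelf _ _ ν.symm_apply_apply⟩

end Twisted

/-! ### The augmentation ideal and a criterion for the Artin-Schelter Gorenstein property -/

section Augmentation

variable {k : Type u} {A : Type a} [Field k] [Ring A] [Algebra k A]
  (𝒜 : ℤ → Submodule k A) [NonnegGraded 𝒜]

/-- The projection from the regular module to its semisimple quotient. -/
def simplesπ : regular 𝒜 ⟶ simples 𝒜 :=
  GrMod.quotπ (regular 𝒜) (augmentation 𝒜) (augmentation_stable 𝒜)

/-- The short exact sequence `A₊ ⟶ A ⟶ S`. -/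
def augComplex : ShortComplex (GrMod 𝒜) := GrMod.kerComplex (simplesπ 𝒜)

lemma augComplex_shortExact : (augComplex 𝒜).ShortExact :=
  GrMod.kerComplex_shortExact _ fun i => GrMod.simples_proj_surjective i

instance : Projective (augComplex 𝒜).X₂ := GrMod.projective_regular

variable {𝒜}

lemma mem_aug_of_pos {i : ℤ} (hi : 0 < i) (x : 𝒜 i) : (simplesπ 𝒜).app i x = 0 := by
  refine (QuotientAddGroup.eq_zero_iff (N := augmentation 𝒜 i) _).2 ?_
  rw [augmentation, if_pos hi]
  trivial

lemma eq_zero_of_aug {i : ℤ} (hi : ¬ 0 < i) (x : (augComplex 𝒜).X₁.carrier i) : x = 0 := by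
  have h := (QuotientAddGroup.eq_zero_iff (N := augmentation 𝒜 i) _).1 x.2
  rw [augmentation, if_neg hi] at h
  exact Subtype.ext h

/-- An element of positive degree, as an element of the augmentation ideal. -/
def augMk {i : ℤ} (hi : 0 < i) : 𝒜 i →ₗ[k] (augComplex 𝒜).X₁.carrier i where
  toFun x := ⟨x, mem_aug_of_pos hi x⟩
  map_add' _ _ := rfl
  map_smul' c x := Subtype.ext (Subtype.ext (by
    refine (Algebra.smul_def c (x : A)).trans (Algebra.commutes c (x : A))))

lemma augMk_surjective {i : ℤ} (hi : 0 < i) :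
    Function.Surjective (augMk (𝒜 := 𝒜) hi) := fun x => ⟨x.1, rfl⟩

lemma augMk_act {i n j : ℤ} (hi : 0 < i) (hj : 0 < j) (h : i + n = j) (x : 𝒜 i) (b : 𝒜 n) :
    (augComplex 𝒜).X₁.act h (augMk hi x) b =
      augMk hj ⟨(x : A) * b, h ▸ SetLike.mul_mem_graded x.2 b.2⟩ := rfl

/-- Left multiplication by an element of degree zero on the sequence `A₊ ⟶ A ⟶ S`. -/
def augLeftMul (s : 𝒜 0) : augComplex 𝒜 ⟶ augComplex 𝒜 where
  τ₁ := (⟨fun i => AddMonoidHom.mk' (fun x => ⟨(leftMul s).app i x.1, by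
      by_cases hi : 0 < i
      · exact mem_aug_of_pos hi ((leftMul s).app i x.1)
      · have h0 : x.1 = 0 := congrArg Subtype.val (eq_zero_of_aug hi x)
        rw [h0, map_zero]
        exact zero_mem _⟩) fun x y => Subtype.ext (map_add _ _ _),
    fun h x b => Subtype.ext ((leftMul s).app_act h _ b)⟩ :
      GrMod.Hom (augComplex 𝒜).X₁ (augComplex 𝒜).X₁)
  τ₂ := leftMul s
  τ₃ := simplesLeftMul s
  comm₁₂ := rfl
  comm₂₃ := rfl

lemma augLeftMul_augMk {i : ℤ} (hi : 0 < i) (s : 𝒜 0) (x : 𝒜 i) :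
    (augLeftMul s).τ₁.app i (augMk hi x) =
      augMk hi ⟨(s : A) * x, by simpa using SetLike.GradedMul.mul_mem (A := 𝒜) s.2 x.2⟩ := rfl

open GrMod in
lemma leftMul_add (s t : 𝒜 0) : leftMul (s + t) = leftMul s + leftMul t := by
  ext i (x : 𝒜 i)
  exact Subtype.ext (add_mul (s : A) t x)

open GrMod in
lemma leftMul_mul (s t : 𝒜 0) : leftMul (s * t) = leftMul t ≫ leftMul s := by
  ext i (x : 𝒜 i)
  exact Subtype.ext (mul_assoc (s : A) t x)

namespace GrMod

lemma shiftMap_add {M N : GrMod 𝒜} (f g : M ⟶ N) (j : ℤ) :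
    shiftMap (f + g) j = shiftMap f j + shiftMap g j := rfl

lemma shiftMap_comp {M N P : GrMod 𝒜} (f : M ⟶ N) (g : N ⟶ P) (j : ℤ) :
    shiftMap (f ≫ g) j = shiftMap f j ≫ shiftMap g j := rfl

end GrMod

open GrMod

/-- A criterion for the Artin-Schelter Gorenstein property in dimension one, in terms of
homomorphisms from the augmentation ideal to shifts of the regular module. -/
lemma isASGorenstein_of_augmentation
    (hr : injectiveDimension (regular 𝒜) = (1 : ℕ))
    (hl : injectiveDimension (regular (opGrading 𝒜)) = (1 : ℕ))
    (hdim : ∀ j : ℤ, HasInjectiveDimensionLT ((regular 𝒜).shift j) 2)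
    (hsocle : ∀ (j : ℤ) (f : simples 𝒜 ⟶ (regular 𝒜).shift j), f = 0)
    (ℓ : ℤ) (ν : 𝒜 0 ≃ₐ[k] 𝒜 0) (f₀ : (augComplex 𝒜).X₁ ⟶ (regular 𝒜).shift (-ℓ))
    (hext : ∀ j : ℤ, j ≠ -ℓ → ∀ f : (augComplex 𝒜).X₁ ⟶ (regular 𝒜).shift j,
      ∃ g : regular 𝒜 ⟶ (regular 𝒜).shift j, (augComplex 𝒜).f ≫ g = f)
    (hsurj : ∀ f : (augComplex 𝒜).X₁ ⟶ (regular 𝒜).shift (-ℓ),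
      ∃ (s : 𝒜 0) (g : regular 𝒜 ⟶ (regular 𝒜).shift (-ℓ)),
        f = f₀ ≫ shiftMap (leftMul s) (-ℓ) + (augComplex 𝒜).f ≫ g)
    (hinj : ∀ (s : 𝒜 0) (g : regular 𝒜 ⟶ (regular 𝒜).shift (-ℓ)),
      (augComplex 𝒜).f ≫ g = f₀ ≫ shiftMap (leftMul s) (-ℓ) → s = 0)
    (hcomm : ∀ s : 𝒜 0, (augLeftMul s).τ₁ ≫ f₀ = f₀ ≫ shiftMap (leftMul (ν s)) (-ℓ)) :
    IsASGorenstein 𝒜 := by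
  have hS := augComplex_shortExact 𝒜
  let φ : 𝒜 0 →+ ExtSA 𝒜 1 (-ℓ) :=
    AddMonoidHom.mk' (fun s => hS.extClass.comp
      (Abelian.Ext.mk₀ (f₀ ≫ shiftMap (leftMul s) (-ℓ))) (add_zero 1)) fun s t => by
        rw [leftMul_add, shiftMap_add, Preadditive.comp_add, Abelian.Ext.mk₀_add,
          Abelian.Ext.comp_add]
        rfl
  have hφ : Function.Bijective φ := by
    constructor
    · rw [injective_iff_map_eq_zero]
      intro s hs
      obtain ⟨g, hg⟩ := (extClass_comp_mk₀_eq_zero_iff hS _).1 hs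
      exact hinj s g hg
    · intro x
      obtain ⟨f, rfl⟩ := exists_extClass_comp_mk₀_eq hS x
      obtain ⟨s, g, rfl⟩ := hsurj f
      refine ⟨s, ?_⟩
      rw [Abelian.Ext.mk₀_add, Abelian.Ext.comp_add,
        (extClass_comp_mk₀_eq_zero_iff hS ((augComplex 𝒜).f ≫ g)).2 ⟨g, rfl⟩, add_zero]
      rfl
  refine ⟨1, hr, hl, fun i hi j => ?_, ℓ, fun j hj => ?_, Twisted (ν : 𝒜 0 ≃+* 𝒜 0),
    inferInstance, inferInstance, inferInstance, inferInstance, fun c v => ?_,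
    Twisted.isInvertibleBimodule _, AddEquiv.ofBijective (show Twisted (ν : 𝒜 0 ≃+* 𝒜 0) →+ ExtSA 𝒜 1 (-ℓ) from φ) hφ,
    fun s v => ?_, fun s v => ?_⟩
  -- `Ext⁰` vanishes because there are no morphisms from `S`, and the groups from `Ext²` on vanish
  -- by the bound on the injective dimension.
  · rcases Nat.lt_or_ge i 2 with h | h
    · obtain rfl : i = 0 := by lia
      refine subsingleton_of_forall_eq 0 fun x => ?_
      obtain ⟨f, rfl⟩ := (Abelian.Ext.mk₀_bijective _ _).2 x
      rw [hsocle j f, Abelian.Ext.mk₀_zero]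
    · have := hdim j
      exact HasInjectiveDimensionLT.subsingleton _ 2 i h _
  · exact subsingleton_ext_one_of_forall_exists_extend hS (hext j hj)
  · change algebraMap k (𝒜 0) c * (show 𝒜 0 from v) = (show 𝒜 0 from v) * ν (algebraMap k (𝒜 0) c)
    rw [AlgEquiv.commutes, Algebra.commutes]
  · change hS.extClass.comp (Abelian.Ext.mk₀ (f₀ ≫ shiftMap (leftMul (s * (show 𝒜 0 from v))) (-ℓ)))
      (add_zero 1) = (hS.extClass.comp (Abelian.Ext.mk₀ (f₀ ≫ shiftMap (leftMul (show 𝒜 0 from v)) (-ℓ)))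
      (add_zero 1)).comp _ (add_zero 1)
    rw [leftMul_mul, shiftMap_comp, ← Category.assoc, ← Abelian.Ext.mk₀_comp_mk₀,
      Abelian.Ext.comp_assoc_of_third_deg_zero]
  · change hS.extClass.comp
      (Abelian.Ext.mk₀ (f₀ ≫ shiftMap (leftMul ((show 𝒜 0 from v) * ν s)) (-ℓ))) (add_zero 1) =
      (Abelian.Ext.mk₀ (augLeftMul s).τ₃).comp
      (hS.extClass.comp (Abelian.Ext.mk₀ (f₀ ≫ shiftMap (leftMul (show 𝒜 0 from v)) (-ℓ))) (add_zero 1))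
      (zero_add 1)
    -- By naturality of the extension class, left multiplication by `s` on `S` may be replaced by
    -- left multiplication on `A₊`, which `f₀` turns into left multiplication by `ν s` on `A`.
    rw [leftMul_mul, shiftMap_comp, ← Category.assoc, ← hcomm, Category.assoc,
      ← Abelian.Ext.mk₀_comp_mk₀, ← Abelian.Ext.comp_assoc_of_third_deg_zero,
      hS.extClass_naturality hS, Abelian.Ext.comp_assoc_of_third_deg_zero]

end Augmentation

end

section

open GrMod

namespace StringBasis

/-! ### Homomorphisms from the augmentation ideal to shifts of the algebra -/

section AugmentationHoms

variable {k : Type u} {A : Type a} [Field k] [Ring A] [Algebra k A]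
  {𝒜 : ℤ → Submodule k A} [NonnegGraded 𝒜] {V : Type v} {E : Type w} [Fintype V] [DecidableEq V]
  [Fintype E] [DecidableEq E] (B : StringBasis 𝒜 V E)

lemma toFun_mul_arrow (x : A) (γ : E) :
    B.toFun (x * B.p γ 0) = Pi.single (B.σ γ) (B.toFun x γ) := by
  rw [toFun_mul, rep_p]
  rfl

lemma toFun_mul_of_mem_zero {x y : A} (hy : y ∈ 𝒜 0) :
    B.toFun (x * y) = B.toFun x * B.toFun y := by
  obtain ⟨c, rfl⟩ := B.exists_coeff_zero hy
  ext β
  rw [toFun_mul, Pi.mul_apply, toFun_sum_e]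
  simp [rep_e, mul_comm]

/-- Multiplication by the arrow `γ` reads off the value at `γ` of the function of `x`. So `A` has no
right socle. -/
lemma eq_zero_of_mul_arrow {x : A} {n : ℤ} (hx : x ∈ 𝒜 n) (h : ∀ γ, x * B.p γ 0 = 0) : x = 0 := by
  refine B.eq_zero_of_toFun_eq_zero hx (funext fun γ => ?_)
  have h' := congrFun (B.toFun_mul_arrow x γ) (B.σ γ)
  rw [h, map_zero, Pi.single_eq_same] at h'
  exact h'.symm

lemma toFun_eq_of_source_eq {x : A} (hx : x ∈ 𝒜 0) {β γ : E} (h : B.s β = B.s γ) :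
    B.toFun x β = B.toFun x γ := by
  obtain ⟨c, rfl⟩ := B.exists_coeff_zero hx
  rw [toFun_sum_e, toFun_sum_e, h]

/-- An arrow, as an element of the augmentation ideal. -/
def arrow (γ : E) : (augComplex 𝒜).X₁.carrier 1 := augMk one_pos ⟨B.p γ 0, B.p_mem γ 0 rfl⟩

include B in
-- The image of the unit is annihilated by the arrows, as these vanish in `S`.
lemma simples_hom_eq_zero {j : ℤ} (f : simples 𝒜 ⟶ (regular 𝒜).shift j) : f = 0 := by
  have hπ : Epi (simplesπ 𝒜) := epi_of_surjective _ fun i => simples_proj_surjective i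
  rw [← cancel_epi (simplesπ 𝒜), comp_zero]
  set g := simplesπ 𝒜 ≫ f
  let x : 𝒜 (0 + j) := g.app 0 (unit 𝒜 0 rfl)
  have hact : ∀ i (b : 𝒜 i), g.app i b = ((regular 𝒜).shift j).act (zero_add i) x b := fun i b =>
    (congrArg (g.app i) (Subtype.ext (one_mul (b : A)).symm)).trans
      (g.app_act (zero_add i) (unit 𝒜 0 rfl) b)
  have hx : x = 0 := by
    refine Subtype.ext (B.eq_zero_of_mul_arrow x.2 fun γ => ?_)
    have h1 := hact 1 ⟨B.p γ 0, B.p_mem γ 0 rfl⟩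
    have h2 : g.app 1 (⟨B.p γ 0, B.p_mem γ 0 rfl⟩ : 𝒜 1) = 0 :=
      (congrArg (f.app 1) (mem_aug_of_pos one_pos _)).trans (map_zero _)
    exact congrArg (Subtype.val (p := (· ∈ 𝒜 (1 + j)))) (h1.symm.trans h2)
  ext i b
  rw [hact i b, hx]
  exact congrArg (fun t => t b) (map_zero (((regular 𝒜).shift j).act (zero_add i)))

/-- Morphisms from the augmentation ideal are determined by the images of the arrows. -/
lemma aug_hom_ext {M : GrMod 𝒜} {f g : (augComplex 𝒜).X₁ ⟶ M}
    (h : ∀ γ, f.app 1 (B.arrow γ) = g.app 1 (B.arrow γ)) : f = g := by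
  ext i x
  by_cases hi : 0 < i
  · obtain ⟨x, rfl⟩ := augMk_surjective hi x
    obtain ⟨n, hn⟩ : ∃ m : ℕ, i = m + 1 := ⟨(i - 1).toNat, by lia⟩
    suffices h' : appₗ f i ∘ₗ augMk hi = appₗ g i ∘ₗ augMk hi from LinearMap.congr_fun h' x
    refine B.linearMap_ext_succ hn fun γ => ?_
    change f.app i (augMk hi _) = g.app i (augMk hi _)
    rcases n with _ | n
    · obtain rfl : i = 1 := by simpa using hn
      exact h γ
    · have hmul : B.p γ (n + 1) = B.p γ 0 * B.p (B.σ γ) n := by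
        rw [p_mul_p, if_pos (by simp)]
        congr 1
        lia
      have hγ : augMk hi ⟨B.p γ (n + 1), B.p_mem γ (n + 1) hn⟩ =
          (augComplex 𝒜).X₁.act (show 1 + ((n : ℤ) + 1) = i by rw [hn]; push_cast; ring)
            (B.arrow γ) ⟨B.p (B.σ γ) n, B.p_mem (B.σ γ) n rfl⟩ := by
        rw [arrow, augMk_act one_pos hi]
        exact congrArg _ (Subtype.ext hmul)
      rw [hγ, f.app_act, g.app_act, h]
  · rw [eq_zero_of_aug hi x, map_zero, map_zero]

/-- The image of an arrow under a homomorphism from the augmentation ideal to a shift of the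
regular module. -/
def arrowImage {j : ℤ} (f : (augComplex 𝒜).X₁ ⟶ (regular 𝒜).shift j) (γ : E) : A :=
  ((show 𝒜 (1 + j) from f.app 1 (B.arrow γ)) : A)

lemma arrowImage_mem {j : ℤ} (f : (augComplex 𝒜).X₁ ⟶ (regular 𝒜).shift j) (γ : E) :
    B.arrowImage f γ ∈ 𝒜 (1 + j) := Subtype.mem _

/-- The coefficients of a homomorphism from the augmentation ideal to a shift of the regular
module. -/
noncomputable def augCoeff {j : ℤ} (f : (augComplex 𝒜).X₁ ⟶ (regular 𝒜).shift j) (γ : E) : k :=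
  B.toFun (B.arrowImage f γ) (B.σ γ)

/-- For an arrow `δ ≠ σ γ` one has `f(γ) δ = f(γ δ) = 0`, and multiplication by `δ` reads off the
value at `δ`. So `f(γ)` is governed by the single scalar `augCoeff f γ`. -/
lemma toFun_arrowImage {j : ℤ} (f : (augComplex 𝒜).X₁ ⟶ (regular 𝒜).shift j) (γ : E) :
    B.toFun (B.arrowImage f γ) = Pi.single (B.σ γ) (B.augCoeff f γ) := by
  ext δ
  by_cases hδ : δ = B.σ γ
  · subst hδ
    rw [Pi.single_eq_same, augCoeff]
  · rw [Pi.single_eq_of_ne hδ]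
    have h0 : B.arrowImage f γ * B.p δ 0 = 0 := by
      have h1 := f.app_act (show (1 : ℤ) + 1 = 2 by rfl) (B.arrow γ)
        ⟨B.p δ 0, B.p_mem δ 0 rfl⟩
      rw [arrow, augMk_act one_pos two_pos] at h1
      have h2 : (⟨B.p γ 0 * B.p δ 0, SetLike.mul_mem_graded (B.p_mem γ 0 rfl) (B.p_mem δ 0 rfl)⟩ :
          𝒜 (1 + 1)) = 0 := by
        exact Subtype.ext ((B.p_mul_p γ 0 δ 0).trans (if_neg (by simpa using hδ)))
      refine (congrArg (Subtype.val (p := (· ∈ 𝒜 (2 + j)))) h1).symm.trans ?_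
      have h3 : f.app 2 (augMk two_pos (0 : 𝒜 2)) = 0 := by rw [map_zero, map_zero]
      refine (congrArg (fun z : 𝒜 2 => ((show 𝒜 (2 + j) from f.app 2 (augMk two_pos z)) : A))
        (?_ : _ = (0 : 𝒜 2))).trans (congrArg (Subtype.val (p := (· ∈ 𝒜 (2 + j)))) h3)
      exact h2
    have h' := congrFun (B.toFun_mul_arrow (B.arrowImage f γ) δ) (B.σ δ)
    rw [h0, map_zero, Pi.single_eq_same] at h'
    exact h'.symm

lemma aug_hom_ext_coeff {j : ℤ} {f g : (augComplex 𝒜).X₁ ⟶ (regular 𝒜).shift j}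
    (h : B.augCoeff f = B.augCoeff g) : f = g := by
  refine B.aug_hom_ext fun γ => Subtype.ext ?_
  have h1 : B.toFun (B.arrowImage f γ - B.arrowImage g γ) = 0 := by
    rw [map_sub, toFun_arrowImage, toFun_arrowImage, h, sub_self]
  exact sub_eq_zero.1 (B.eq_zero_of_toFun_eq_zero
    (sub_mem (B.arrowImage_mem f γ) (B.arrowImage_mem g γ)) h1)

lemma augCoeff_add {j : ℤ} (f g : (augComplex 𝒜).X₁ ⟶ (regular 𝒜).shift j) :
    B.augCoeff (f + g) = B.augCoeff f + B.augCoeff g := by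
  ext γ
  exact congrFun (map_add B.toFun (B.arrowImage f γ) (B.arrowImage g γ)) _

/-- The coefficients of the restriction of a left multiplication. -/
lemma augCoeff_comp {j : ℤ} (g : regular 𝒜 ⟶ (regular 𝒜).shift j) :
    B.augCoeff ((augComplex 𝒜).f ≫ g) =
      B.toFun ((show 𝒜 (0 + j) from g.app 0 (unit 𝒜 0 rfl)) : A) := by
  ext γ
  have h : B.arrowImage ((augComplex 𝒜).f ≫ g) γ =
      ((show 𝒜 (0 + j) from g.app 0 (unit 𝒜 0 rfl)) : A) * B.p γ 0 :=
    congrArg (Subtype.val (p := (· ∈ 𝒜 (1 + j))))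
      ((congrArg (g.app 1) (Subtype.ext (one_mul (B.p γ 0)).symm)).trans
        (g.app_act (zero_add 1) (unit 𝒜 0 rfl) (⟨B.p γ 0, B.p_mem γ 0 rfl⟩ : 𝒜 1)))
  rw [augCoeff, h, toFun_mul_arrow, Pi.single_eq_same]

/-- Left multiplication by an element of degree `j`. -/
def leftMulHom {j : ℤ} {x : A} (hx : x ∈ 𝒜 j) : regular 𝒜 ⟶ (regular 𝒜).shift j :=
  regularIsoShiftZero.hom ≫ ofElement (M := (regular 𝒜).shift j) (add_zero 0)
    (⟨x, by rwa [zero_add]⟩ : 𝒜 (0 + j))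

lemma augCoeff_comp_leftMulHom {j : ℤ} {x : A} (hx : x ∈ 𝒜 j) :
    B.augCoeff ((augComplex 𝒜).f ≫ leftMulHom hx) = B.toFun x := by
  rw [augCoeff_comp]
  congr 1
  exact mul_one x

/-- The extension is left multiplication by `x`. So the question which homomorphisms on `A₊` extend
to `A` becomes a comparison of functions on the arrows. -/
lemma exists_extend_of_augCoeff_eq {j : ℤ} {f : (augComplex 𝒜).X₁ ⟶ (regular 𝒜).shift j} {x : A}
    (hx : x ∈ 𝒜 j) (h : B.augCoeff f = B.toFun x) :
    ∃ g : regular 𝒜 ⟶ (regular 𝒜).shift j, (augComplex 𝒜).f ≫ g = f :=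
  ⟨leftMulHom hx, B.aug_hom_ext_coeff ((B.augCoeff_comp_leftMulHom hx).trans h.symm)⟩

lemma augCoeff_leftMul_comp {j : ℤ} (s : 𝒜 0) (f : (augComplex 𝒜).X₁ ⟶ (regular 𝒜).shift j) :
    B.augCoeff ((augLeftMul s).τ₁ ≫ f) = B.toFun s * B.augCoeff f := by
  ext γ
  obtain ⟨s, hs⟩ := s
  obtain ⟨c, rfl⟩ := B.exists_coeff_zero hs
  have h1 : (augLeftMul ⟨∑ v, c v • B.e v, hs⟩).τ₁.app 1 (B.arrow γ) = c (B.s γ) • B.arrow γ := by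
    rw [arrow, augLeftMul_augMk, ← map_smul]
    refine congrArg _ (Subtype.ext ?_)
    simp [Finset.sum_mul, e_mul_p]
  have h2 : B.arrowImage ((augLeftMul ⟨∑ v, c v • B.e v, hs⟩).τ₁ ≫ f) γ =
      c (B.s γ) • B.arrowImage f γ := by
    rw [arrowImage, comp_app, h1, app_smul]
    exact (Algebra.commutes _ _).symm.trans (Algebra.smul_def _ _).symm
  rw [augCoeff, h2, map_smul, Pi.smul_apply, Pi.mul_apply, toFun_sum_e]
  rfl

lemma augCoeff_comp_leftMul {j : ℤ} (s : 𝒜 0) (f : (augComplex 𝒜).X₁ ⟶ (regular 𝒜).shift j)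
    (γ : E) : B.augCoeff (f ≫ shiftMap (leftMul s) j) γ =
      B.toFun ((s : A) * B.arrowImage f γ) (B.σ γ) := rfl

section Construction

variable (F : A →ₗ[k] A) (j : ℤ) (ε : E → k) (hFe : ∀ v, F (B.e v) = 0)
  (hF : ∀ γ (n : ℕ), F (B.p γ n) ∈ 𝒜 (n + 1 + j))
  (hε : ∀ γ n, B.toFun (F (B.p γ n)) = ε γ • B.toFun (B.p γ n))

include hFe hF in
lemma map_mem_of_arrows {x : A} {i : ℤ} (hx : x ∈ 𝒜 i) : F x ∈ 𝒜 (i + j) := by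
  rcases lt_or_ge i 0 with hn | hn
  · rw [NonnegGraded.eq_bot_of_neg (𝒜 := 𝒜) i hn, Submodule.mem_bot] at hx
    rw [hx, map_zero]
    exact zero_mem _
  obtain rfl | hn := hn.eq_or_lt
  · obtain ⟨c, rfl⟩ := B.exists_coeff_zero hx
    simp only [map_sum, map_smul, hFe, smul_zero, Finset.sum_const_zero]
    exact zero_mem _
  · obtain ⟨n, rfl⟩ : ∃ m : ℕ, i = m + 1 := ⟨(i - 1).toNat, by lia⟩
    obtain ⟨c, rfl⟩ := B.exists_coeff_succ hx
    simp only [map_sum, map_smul]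
    exact Submodule.sum_mem _ fun γ _ => Submodule.smul_mem _ _ (hF γ n)

include hε in
-- A right multiple of a path is a combination of paths with the same first arrow, and the factor
-- depends on this arrow only.
lemma toFun_map_p_mul (γ : E) (n : ℕ) (b : A) :
    B.toFun (F (B.p γ n * b)) = ε γ • B.toFun (B.p γ n * b) := by
  induction b using B.induction with
  | h0 => simp
  | hadd x y hx hy => simp only [mul_add, map_add, hx, hy, smul_add]
  | hsmul c x hx => simp only [mul_smul_comm, map_smul, hx, smul_comm c]
  | he v => rw [p_mul_e]; split_ifs <;> simp [hε]
  | hp δ m => rw [p_mul_p]; split_ifs <;> simp [hε]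

include hFe hF hε in
-- Both sides have degree `i + n + j`, and homogeneous elements are determined by their functions,
-- on which `F` acts by scalars. The degree of `x` has to be positive because `F` kills the
-- vertices.
lemma map_mul_of_arrows {x b : A} {i n : ℤ} (hi : 0 < i) (hx : x ∈ 𝒜 i) (hb : b ∈ 𝒜 n) :
    F (x * b) = F x * b := by
  rw [← sub_eq_zero]
  have hmem : F (x * b) - F x * b ∈ 𝒜 (i + n + j) := by
    refine sub_mem (B.map_mem_of_arrows F j hFe hF (SetLike.mul_mem_graded hx hb)) ?_
    rw [add_right_comm]
    exact SetLike.mul_mem_graded (B.map_mem_of_arrows F j hFe hF hx) hb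
  refine B.eq_zero_of_toFun_eq_zero hmem ?_
  obtain ⟨n, rfl⟩ : ∃ m : ℕ, i = m + 1 := ⟨(i - 1).toNat, by lia⟩
  obtain ⟨c, rfl⟩ := B.exists_coeff_succ hx
  rw [map_sub, sub_eq_zero]
  simp only [Finset.sum_mul, map_sum, smul_mul_assoc, map_smul, toFun_map_p_mul B F ε hε]
  refine Finset.sum_congr rfl fun γ _ => ?_
  rw [toFun_mul, toFun_mul, hε, map_smul]

/-- The homomorphism from the augmentation ideal given by a linear map. -/
def augHom : (augComplex 𝒜).X₁ ⟶ (regular 𝒜).shift j :=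
  (⟨fun i => AddMonoidHom.mk' (fun x => (⟨F (show 𝒜 i from x.1).1,
      B.map_mem_of_arrows F j hFe hF (Subtype.mem _)⟩ : 𝒜 (i + j)))
      fun _ _ => Subtype.ext (map_add F _ _),
    fun {i n l} h x b => by
      by_cases hi : 0 < i
      · obtain ⟨x, rfl⟩ := augMk_surjective hi x
        exact Subtype.ext (B.map_mul_of_arrows F j ε hFe hF hε hi x.2 b.2)
      · rw [eq_zero_of_aug hi x]
        simp only [map_zero, AddMonoidHom.zero_apply]⟩ :
    GrMod.Hom (augComplex 𝒜).X₁ ((regular 𝒜).shift j))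

lemma arrowImage_augHom (γ : E) :
    B.arrowImage (B.augHom F j ε hFe hF hε) γ = F (B.p γ 0) := rfl

lemma augCoeff_augHom : B.augCoeff (B.augHom F j ε hFe hF hε) = ε := by
  ext γ
  rw [augCoeff, arrowImage_augHom, hε, Pi.smul_apply, toFun_p, zero_add, pow_one,
    Pi.single_eq_same, smul_eq_mul, mul_one]

end Construction

/-- The endomorphism of the augmentation ideal that multiplies each path by a scalar that depends
on its first arrow. -/
noncomputable def scaleMap (ε : E → k) : A →ₗ[k] A :=
  B.basis.constr k (Sum.elim 0 fun x => ε x.1 • B.p x.1 x.2)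

lemma scaleMap_e (ε : E → k) (v : V) : B.scaleMap ε (B.e v) = 0 := by
  rw [scaleMap, ← basis_inl, Module.Basis.constr_basis]
  rfl

lemma scaleMap_p (ε : E → k) (γ : E) (n : ℕ) : B.scaleMap ε (B.p γ n) = ε γ • B.p γ n := by
  rw [scaleMap, ← basis_inr, Module.Basis.constr_basis]
  simp

/-- The endomorphism of the augmentation ideal that multiplies each path by a scalar that depends
on its first arrow, as a morphism to the regular module. -/
noncomputable def scaleHom (ε : E → k) : (augComplex 𝒜).X₁ ⟶ (regular 𝒜).shift 0 :=
  B.augHom (B.scaleMap ε) 0 ε (B.scaleMap_e ε)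
    (fun γ n => by
      rw [scaleMap_p]
      exact Submodule.smul_mem _ _ (B.p_mem γ n (add_zero _)))
    (fun γ n => by rw [scaleMap_p, map_smul])

/-- The map that removes the first arrow of a path. -/
noncomputable def dropMap : A →ₗ[k] A :=
  B.basis.constr k (Sum.elim 0 fun x =>
    Nat.casesOn x.2 (B.e (B.s (B.σ x.1))) fun n => B.p (B.σ x.1) n)

lemma dropMap_e (v : V) : B.dropMap (B.e v) = 0 := by
  rw [dropMap, ← basis_inl, Module.Basis.constr_basis]
  rfl

lemma dropMap_arrow (γ : E) : B.dropMap (B.p γ 0) = B.e (B.s (B.σ γ)) := by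
  rw [dropMap, ← basis_inr, Module.Basis.constr_basis]
  rfl

lemma dropMap_p_succ (γ : E) (n : ℕ) : B.dropMap (B.p γ (n + 1)) = B.p (B.σ γ) n := by
  rw [dropMap, ← basis_inr, Module.Basis.constr_basis]
  rfl

lemma toFun_e_of_injective (hs : Function.Injective B.s) (γ : E) :
    B.toFun (B.e (B.s γ)) = Pi.single γ 1 := by
  ext δ
  rw [toFun_e, Pi.single_apply]
  simp only [hs.eq_iff]

/-- The homomorphism that removes the first arrow of a path. -/
noncomputable def dropHom (hs : Function.Injective B.s) :
    (augComplex 𝒜).X₁ ⟶ (regular 𝒜).shift (-1) :=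
  B.augHom B.dropMap (-1) 1 B.dropMap_e
    (fun γ n => by
      rcases n with _ | n
      · rw [dropMap_arrow]
        exact B.e_mem _
      · rw [dropMap_p_succ]
        exact B.p_mem _ _ (by push_cast; ring))
    (fun γ n => by
      rcases n with _ | n
      · rw [dropMap_arrow, toFun_p, B.toFun_e_of_injective hs]
        simp
      · rw [dropMap_p_succ, toFun_p, toFun_p, pow_succ B.σ (n + 1), Equiv.Perm.mul_apply]
        simp)

lemma augCoeff_eq_zero_of_lt {j : ℤ} (hj : j < -1)
    (f : (augComplex 𝒜).X₁ ⟶ (regular 𝒜).shift j) : B.augCoeff f = 0 := by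
  ext γ
  have h : B.arrowImage f γ ∈ (⊥ : Submodule k A) :=
    (NonnegGraded.eq_bot_of_neg (𝒜 := 𝒜) _ (by lia)).le (B.arrowImage_mem f γ)
  rw [augCoeff, (Submodule.mem_bot k).1 h, map_zero]
  rfl

/-- The degree zero part, for a quiver with one arrow from each vertex. -/
noncomputable def zeroEquiv (hs : Function.Injective B.s) : 𝒜 0 ≃ₐ[k] (E → k) :=
  AlgEquiv.ofBijective
    { toFun := fun x => B.toFun x
      map_one' := by
        ext γ
        exact congrFun (B.rep_one 1) γ
      map_mul' := fun x y => B.toFun_mul_of_mem_zero y.2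
      map_zero' := map_zero B.toFun
      map_add' := fun x y => map_add B.toFun _ _
      commutes' := fun c => by
        ext γ
        change B.toFun (algebraMap k A c) γ = c
        rw [Algebra.algebraMap_eq_smul_one, map_smul]
        exact (congrArg (c * ·) (congrFun (B.rep_one 1) γ)).trans (mul_one c) }
    ⟨(injective_iff_map_eq_zero _).2 fun x hx =>
      Subtype.ext (B.eq_zero_of_toFun_eq_zero x.2 hx), fun y => by
      obtain ⟨x, hx, hxy⟩ :=
        B.exists_toFun_eq_comp (𝒜 := 𝒜) (fun v => y (Function.surjInv B.s_surjective v))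
      exact ⟨⟨x, hx⟩, hxy.trans (funext fun γ =>
        congrArg y (hs (Function.surjInv_eq B.s_surjective _)))⟩⟩

lemma zeroEquiv_apply (hs : Function.Injective B.s) (x : 𝒜 0) :
    B.zeroEquiv hs x = B.toFun x := rfl

/-- The Nakayama automorphism, for a quiver with one arrow from each vertex. -/
noncomputable def nakayama (hs : Function.Injective B.s) : 𝒜 0 ≃ₐ[k] 𝒜 0 :=
  ((B.zeroEquiv hs).trans (AlgEquiv.piCongrLeft' k (fun _ => k) B.σ)).trans (B.zeroEquiv hs).symm

lemma toFun_nakayama (hs : Function.Injective B.s) (x : 𝒜 0) (γ : E) :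
    B.toFun (B.nakayama hs x) (B.σ γ) = B.toFun x γ := by
  rw [← zeroEquiv_apply B hs, nakayama, AlgEquiv.trans_apply, AlgEquiv.apply_symm_apply]
  change B.toFun x (B.σ.symm (B.σ γ)) = _
  rw [Equiv.symm_apply_apply]

end AugmentationHoms

/-! ### The extension group in the two Gorenstein cases -/

section Gorenstein

variable {k : Type u} {A : Type (max u a)} [Field k] [Ring A] [Algebra k A]
  {𝒜 : ℤ → Submodule k A} [NonnegGraded 𝒜] {V : Type v} {E : Type a} [Fintype V] [DecidableEq V]
  [Fintype E] [DecidableEq E] [Nonempty E] (B : StringBasis 𝒜 V E)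

include B in
-- In degrees `j ≥ 0` every family of coefficients comes from `Aⱼ`, and below `-1` there are no
-- nonzero homomorphisms from `A₊`. In degree `-1` those from `A` vanish, whereas those from `A₊`
-- are the left multiples of `dropHom`. Removing an arrow replaces its source by its target, and
-- this is the twist by `σ`.
lemma isASGorenstein_of_injective (hs : Function.Injective B.s)
    (hl : injectiveDimension (regular (opGrading 𝒜)) = (1 : ℕ)) : IsASGorenstein 𝒜 := by
  have hdim := B.hasInjectiveDimensionLT_two_of_injective hs
  have hcoeff : ∀ s : 𝒜 0, B.augCoeff (B.dropHom hs ≫ shiftMap (leftMul s) (-1)) =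
      B.toFun s ∘ B.σ := fun s => by
    ext γ
    rw [augCoeff_comp_leftMul, dropHom, arrowImage_augHom, dropMap_arrow,
      B.toFun_mul_of_mem_zero (B.e_mem _), Pi.mul_apply, toFun_e, if_pos rfl, mul_one]
    rfl
  have hneg : ∀ g : regular 𝒜 ⟶ (regular 𝒜).shift (-1), B.augCoeff ((augComplex 𝒜).f ≫ g) = 0 :=
    fun g => by
    have h : ((show 𝒜 (0 + -1) from g.app 0 (unit 𝒜 0 rfl)) : A) ∈ (⊥ : Submodule k A) :=
      (NonnegGraded.eq_bot_of_neg (𝒜 := 𝒜) _ (by lia)).le (Subtype.mem _)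
    rw [augCoeff_comp, (Submodule.mem_bot k).1 h, map_zero]
  refine isASGorenstein_of_augmentation (B.injectiveDimension_regular_eq_one hdim) hl hdim
    (fun j f => B.simples_hom_eq_zero f) 1 (B.nakayama hs) (B.dropHom hs) (fun j hj f => ?_)
    (fun f => ?_) (fun s g h => ?_) fun s => ?_
  · rcases lt_trichotomy j 0 with h | h | h
    · exact B.exists_extend_of_augCoeff_eq (zero_mem _)
        ((B.augCoeff_eq_zero_of_lt (by lia) f).trans (map_zero _).symm)
    · subst h
      exact B.exists_extend_of_augCoeff_eq ((B.zeroEquiv hs).symm (B.augCoeff f)).2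
        ((B.zeroEquiv hs).apply_symm_apply (B.augCoeff f)).symm
    · obtain ⟨x, hx, hxy⟩ := B.exists_toFun_eq h (B.augCoeff f)
      exact B.exists_extend_of_augCoeff_eq hx hxy.symm
  · refine ⟨(B.zeroEquiv hs).symm (B.augCoeff f ∘ B.σ.symm), 0, B.aug_hom_ext_coeff ?_⟩
    refine Eq.trans ?_ (B.augCoeff_add _ _).symm
    refine Eq.trans ?_ (congrArg₂ (· + ·) (hcoeff _) (hneg _)).symm
    rw [← zeroEquiv_apply B hs, AlgEquiv.apply_symm_apply]
    ext γ
    simp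
  · have h' := (hcoeff s).symm.trans ((congrArg B.augCoeff h).symm.trans (hneg g))
    refine Subtype.ext (B.eq_zero_of_toFun_eq_zero s.2 (funext fun γ => ?_))
    obtain ⟨γ, rfl⟩ := B.σ.surjective γ
    exact congrFun h' γ
  · refine B.aug_hom_ext_coeff ?_
    rw [augCoeff_leftMul_comp, hcoeff, dropHom, augCoeff_augHom, mul_one]
    ext γ
    exact (B.toFun_nakayama hs s γ).symm

include B in
-- In degree zero, homomorphisms from `A₊` give arbitrary functions on the arrows, and those from
-- `A` give functions of the source. The quotient has one dimension for each vertex, represented by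
-- the first arrow from it, so that `ℓ = 0` and there is no twist.
lemma isASGorenstein_of_two_arrows (hs : ∀ v, ∃ β β', β ≠ β' ∧
    ∀ γ, B.s γ = v ↔ γ = β ∨ γ = β')
    (hl : injectiveDimension (regular (opGrading 𝒜)) = (1 : ℕ)) : IsASGorenstein 𝒜 := by
  have hdim := B.hasInjectiveDimensionLT_two_of_two_arrows hs
  choose β₁ β₂ hne hs using hs
  let ε : E → k := fun γ => if γ = β₁ (B.s γ) then 1 else 0
  have hs₁ : ∀ v, B.s (β₁ v) = v := fun v => (hs v _).2 (Or.inl rfl)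
  have hs₂ : ∀ v, B.s (β₂ v) = v := fun v => (hs v _).2 (Or.inr rfl)
  have hε₁ : ∀ v, ε (β₁ v) = 1 := fun v => by simp [ε, hs₁]
  have hε₂ : ∀ v, ε (β₂ v) = 0 := fun v => by simp [ε, hs₂, (hne v).symm]
  have hcases : ∀ {y z : E → k}, (∀ v, y (β₁ v) = z (β₁ v)) → (∀ v, y (β₂ v) = z (β₂ v)) →
      y = z := fun {y z} h₁ h₂ => funext fun γ => by
    obtain h | h := (hs (B.s γ) γ).1 rfl
    · rw [h]; exact h₁ _
    · rw [h]; exact h₂ _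
  have hcoeff : ∀ s : 𝒜 0, B.augCoeff (B.scaleHom ε ≫ shiftMap (leftMul s) 0) =
      ε * B.toFun s := fun s => by
    ext γ
    rw [augCoeff_comp_leftMul, scaleHom, arrowImage_augHom, scaleMap_p, mul_smul_comm, map_smul,
      toFun_mul_arrow, Pi.smul_apply, Pi.single_eq_same]
    rfl
  refine isASGorenstein_of_augmentation (B.injectiveDimension_regular_eq_one hdim) hl hdim
    (fun j f => B.simples_hom_eq_zero f) 0 AlgEquiv.refl (B.scaleHom ε) (fun j hj f => ?_)
    (fun f => ?_) (fun s g h => ?_) fun s => ?_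
  · rw [neg_zero] at hj
    rcases lt_or_gt_of_ne hj with h | h
    · refine B.exists_extend_of_augCoeff_eq (zero_mem _) (Eq.trans ?_ (map_zero _).symm)
      obtain rfl | h := (show j ≤ -1 by lia).eq_or_lt
      · ext γ
        -- In degree `-1` the image of `γ` lies in `A₀`, so its function agrees at `σ γ` and at the
        -- other arrow `δ` with the same source; but at `δ` it vanishes.
        have hγ : ∃ δ, B.s δ = B.s (B.σ γ) ∧ δ ≠ B.σ γ := by
          obtain h | h := (hs (B.s (B.σ γ)) (B.σ γ)).1 rfl
          · exact ⟨β₂ (B.s (B.σ γ)), hs₂ _, fun h' => hne _ (h.symm.trans h'.symm)⟩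
          · exact ⟨β₁ (B.s (B.σ γ)), hs₁ _, fun h' => hne _ (h'.trans h)⟩
        obtain ⟨δ, hδ, hδγ⟩ := hγ
        rw [augCoeff, ← B.toFun_eq_of_source_eq (B.arrowImage_mem f γ) hδ, toFun_arrowImage,
          Pi.single_eq_of_ne hδγ]
        rfl
      · exact B.augCoeff_eq_zero_of_lt h f
    · obtain ⟨x, hx, hxy⟩ := B.exists_toFun_eq h (B.augCoeff f)
      exact B.exists_extend_of_augCoeff_eq hx hxy.symm
  -- The part of `c` that depends on the source only is fixed by the values at the second arrows.
  -- The rest is supported on the first arrows.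
  · let c := B.augCoeff f
    obtain ⟨x, hx, hxc⟩ := B.exists_toFun_eq_comp (𝒜 := 𝒜) fun v => c (β₂ v)
    obtain ⟨s, hs', hsc⟩ := B.exists_toFun_eq_comp (𝒜 := 𝒜) fun v => c (β₁ v) - c (β₂ v)
    refine ⟨⟨s, hs'⟩, leftMulHom hx, B.aug_hom_ext_coeff (Eq.trans ?_ (B.augCoeff_add _ _).symm)⟩
    refine Eq.trans ?_
      (congrArg₂ (· + ·) (hcoeff ⟨s, hs'⟩) (B.augCoeff_comp_leftMulHom hx)).symm
    change c = ε * B.toFun s + B.toFun x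
    rw [hsc, hxc]
    exact hcases (fun v => by simp [hε₁, hs₁]) (fun v => by simp [hε₂, hs₂])
  · have h' := (hcoeff s).symm.trans (congrArg B.augCoeff h).symm
    replace h' := h'.trans (B.augCoeff_comp (j := 0) g)
    have hg : ((show 𝒜 (0 + 0) from g.app 0 (unit 𝒜 0 rfl)) : A) ∈ 𝒜 0 := Subtype.mem _
    refine Subtype.ext (B.eq_zero_of_toFun_eq_zero s.2 (hcases (fun v => ?_) fun v => ?_))
    · have h₁ := congrFun h' (β₁ v)
      have h₂ := congrFun h' (β₂ v)
      rw [Pi.mul_apply, hε₁, one_mul] at h₁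
      rw [Pi.mul_apply, hε₂, zero_mul] at h₂
      rw [h₁, B.toFun_eq_of_source_eq hg ((hs₁ v).trans (hs₂ v).symm), ← h₂]
      rfl
    · have h₁ := congrFun h' (β₁ v)
      have h₂ := congrFun h' (β₂ v)
      rw [Pi.mul_apply, hε₁, one_mul] at h₁
      rw [Pi.mul_apply, hε₂, zero_mul] at h₂
      rw [← B.toFun_eq_of_source_eq s.2 ((hs₁ v).trans (hs₂ v).symm), h₁,
        B.toFun_eq_of_source_eq hg ((hs₁ v).trans (hs₂ v).symm), ← h₂]
      rfl
  · refine B.aug_hom_ext_coeff ((B.augCoeff_leftMul_comp (j := 0) s (B.scaleHom ε)).trans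
      (Eq.trans ?_ (hcoeff s).symm))
    rw [scaleHom, augCoeff_augHom, mul_comm]

end Gorenstein

end StringBasis

end

section

open GrMod

namespace StringBasis

/-! ### The opposite algebra -/

section Opposite

variable {k : Type u} {A : Type a} [Field k] [Ring A] [Algebra k A]
  {𝒜 : ℤ → Submodule k A} {V : Type v} {E : Type w} [Fintype V] [DecidableEq V]
  [Fintype E] [DecidableEq E] (B : StringBasis 𝒜 V E)

/-- The equivalence of the index sets of the bases of `A` and of its opposite, which sends the last
arrow of a path to the first. -/
def firstArrow : V ⊕ E × ℕ ≃ V ⊕ E × ℕ :=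
  Equiv.sumCongr (Equiv.refl V)
    { toFun := fun x => ((B.σ⁻¹ ^ x.2) x.1, x.2)
      invFun := fun x => ((B.σ ^ x.2) x.1, x.2)
      left_inv := fun x => by simp
      right_inv := fun x => by simp }

lemma op_family : (Sum.elim (fun v => MulOpposite.op (B.e v))
      fun x : E × ℕ => MulOpposite.op (B.p ((B.σ⁻¹ ^ x.2) x.1) x.2)) =
    (MulOpposite.opLinearEquiv k).toLinearMap ∘
      (Sum.elim B.e fun x : E × ℕ => B.p x.1 x.2) ∘ B.firstArrow :=
  funext fun x => by rcases x with v | ⟨γ, n⟩ <;> rfl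

/-- The basis of paths of the opposite algebra. -/
def op : StringBasis (opGrading 𝒜) V E where
  s γ := B.s (B.σ γ)
  σ := B.σ⁻¹
  s_surjective := B.s_surjective.comp B.σ.surjective
  e v := MulOpposite.op (B.e v)
  -- Reversed, a path begins with its last arrow `γ`; its first arrow in `A` is then `σ⁻ⁿ γ`.
  p γ n := MulOpposite.op (B.p ((B.σ⁻¹ ^ n) γ) n)
  linearIndependent := by
    rw [op_family]
    exact (B.linearIndependent.comp B.firstArrow B.firstArrow.injective).map'
      (MulOpposite.opLinearEquiv k).toLinearMap (LinearEquiv.ker _)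
  span_eq_top := by
    rw [op_family, Set.range_comp, B.firstArrow.surjective.range_comp, ← Submodule.map_span,
      B.span_eq_top, Submodule.map_top, LinearEquiv.range]
  span_zero := by
    rw [opGrading, B.span_zero, Submodule.map_span, ← Set.range_comp]
    rfl
  span_succ n := by
    rw [opGrading, B.span_succ, Submodule.map_span, ← Set.range_comp,
      ← (B.σ⁻¹ ^ n).surjective.range_comp]
    rfl
  one_eq := by
    rw [← MulOpposite.op_one, B.one_eq, Finset.op_sum]
  e_mul_e v w := by
    rw [← MulOpposite.op_mul, B.e_mul_e]
    by_cases h : v = w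
    · simp [h]
    · simp [h, Ne.symm h]
  e_mul_p v γ n := by
    rw [← MulOpposite.op_mul, B.p_mul_e, pow_succ', Equiv.Perm.mul_apply, ← Equiv.Perm.mul_apply,
      ← Equiv.Perm.mul_apply, mul_assoc, inv_pow, mul_inv_cancel, mul_one]
    split_ifs <;> rfl
  p_mul_e γ n v := by
    rw [← MulOpposite.op_mul, B.e_mul_p, pow_succ', Equiv.Perm.mul_apply,
      show B.σ (B.σ⁻¹ _) = _ from B.σ.apply_symm_apply _]
    split_ifs <;> rfl
  p_mul_p γ n δ m := by
    rw [← MulOpposite.op_mul, B.p_mul_p]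
    have h : (B.σ⁻¹ ^ n) γ = (B.σ ^ (m + 1)) ((B.σ⁻¹ ^ m) δ) ↔ δ = (B.σ⁻¹ ^ (n + 1)) γ := by
      rw [pow_succ' B.σ, pow_succ' B.σ⁻¹, Equiv.Perm.mul_apply, Equiv.Perm.mul_apply, inv_pow, inv_pow,
        show (B.σ ^ m) ((B.σ ^ m)⁻¹ δ) = δ from (B.σ ^ m).apply_symm_apply δ, Equiv.Perm.eq_inv_iff_eq, eq_comm]
    rw [if_congr h rfl rfl]
    split_ifs with h'
    · subst h'
      rw [← Equiv.Perm.mul_apply, ← pow_add]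
      congr 2
      · congr 2; ring
      · ring
    · rfl

end Opposite

/-! ### Sufficiency of the condition on the quiver -/

section Gorenstein

variable {k : Type u} {A : Type (max u a)} [Field k] [Ring A] [Algebra k A]
  {𝒜 : ℤ → Submodule k A} [NonnegGraded 𝒜] {V : Type v} {E : Type a} [Fintype V] [DecidableEq V]
  [Fintype E] [DecidableEq E] [Nonempty E] (B : StringBasis 𝒜 V E)

include B in
/-- If there is exactly one arrow from each vertex, or exactly two arrows from each vertex, then the
algebra is Artin-Schelter Gorenstein. -/
lemma isASGorenstein (hs : Function.Injective B.s ∨ ∀ v, ∃ β β', β ≠ β' ∧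
    ∀ γ, B.s γ = v ↔ γ = β ∨ γ = β') : IsASGorenstein 𝒜 := by
  rcases hs with hs | hs
  · exact B.isASGorenstein_of_injective hs (B.op.injectiveDimension_regular_eq_one
      (B.op.hasInjectiveDimensionLT_two_of_injective (hs.comp B.σ.injective)))
  · refine B.isASGorenstein_of_two_arrows hs (B.op.injectiveDimension_regular_eq_one
      (B.op.hasInjectiveDimensionLT_two_of_two_arrows fun v => ?_))
    obtain ⟨β, β', hne, h⟩ := hs v
    -- The arrows that end at `v` are the predecessors of the two arrows that start there.
    refine ⟨B.σ⁻¹ β, B.σ⁻¹ β', by simpa using hne, fun γ => ?_⟩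
    change B.s (B.σ γ) = v ↔ _
    rw [h, Equiv.Perm.eq_inv_iff_eq, Equiv.Perm.eq_inv_iff_eq]

end Gorenstein

/-! ### Failure of the Gorenstein property for mixed numbers of outgoing arrows -/

section NotGorenstein

variable {k : Type u} {A : Type a} [Field k] [Ring A] [Algebra k A]
  {𝒜 : ℤ → Submodule k A} [NonnegGraded 𝒜] {V : Type v} {E : Type w} [Fintype V] [DecidableEq V]
  [Fintype E] [DecidableEq E] (B : StringBasis 𝒜 V E)

include B in
-- The homomorphism that keeps the paths beginning with `b` and kills all others does not extend to
-- `A`: an extension would be left multiplication by an element of `A₀`, which scales `b` and `b'`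
-- by the same factor.
lemma nontrivial_ext_one {b b' : E} (hne : b ≠ b') (hs : B.s b = B.s b') :
    ¬ Subsingleton (ExtSA 𝒜 1 0) := by
  intro h
  have : Subsingleton (Abelian.Ext (augComplex 𝒜).X₃ ((regular 𝒜).shift 0) 1) := h
  obtain ⟨g, hg⟩ : ∃ g : (augComplex 𝒜).X₂ ⟶ _, (augComplex 𝒜).f ≫ g =
      B.scaleHom (Pi.single b 1) :=
    exists_extend_of_subsingleton_ext_one (augComplex_shortExact 𝒜) _
  have h1 := (B.augCoeff_comp (j := 0) g).symm.trans
    ((congrArg B.augCoeff hg).trans (B.augCoeff_augHom _ _ _ _ _ _))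
  have h2 := B.toFun_eq_of_source_eq (x := ((show 𝒜 (0 + 0) from g.app 0 (unit 𝒜 0 rfl)) : A))
    (Subtype.mem _) hs
  replace h2 := (congrFun h1 b).symm.trans (h2.trans (congrFun h1 b'))
  rw [Pi.single_eq_same, Pi.single_eq_of_ne hne.symm] at h2
  exact one_ne_zero h2

/-- Left multiplication by an arrow, as a morphism `A[1] ⟶ A[2]`. -/
def arrowMul (β : E) : (regular 𝒜).shift 1 ⟶ (regular 𝒜).shift 2 :=
  ofElement (M := (regular 𝒜).shift 2) (n := -1) rfl (⟨B.p β 0, B.p_mem β 0 rfl⟩ : 𝒜 (-1 + 2))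

lemma mul_eq_zero_of_ker {β : E} {i : ℤ} (x : (ker (B.arrowMul β)).carrier i) :
    B.p β 0 * (show 𝒜 (i + 1) from ((B.arrowMul β).app i).ker.subtype x).1 = 0 :=
  congrArg (Subtype.val (p := (· ∈ 𝒜 (i + 2)))) x.2

/-- The map that removes the first arrow from the paths that start with `b`, and that is zero on
the other paths. -/
noncomputable def dropArrow (b : E) : A →ₗ[k] A := B.dropMap ∘ₗ B.scaleMap (Pi.single b 1)

lemma dropArrow_e (b : E) (v : V) : B.dropArrow b (B.e v) = 0 := by
  rw [dropArrow, LinearMap.comp_apply, scaleMap_e, map_zero]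

lemma dropArrow_p (b γ : E) (n : ℕ) :
    B.dropArrow b (B.p γ n) = (Pi.single b 1 : E → k) γ • B.dropMap (B.p γ n) := by
  rw [dropArrow, LinearMap.comp_apply, scaleMap_p, map_smul]

lemma dropArrow_p_mem (b γ : E) (n : ℕ) : B.dropArrow b (B.p γ n) ∈ 𝒜 (n + 1 + -1) := by
  rw [dropArrow_p]
  refine Submodule.smul_mem _ _ ?_
  rcases n with _ | n
  · rw [dropMap_arrow]
    exact B.e_mem _
  · rw [dropMap_p_succ]
    exact B.p_mem _ _ (by push_cast; ring)

/-- Since `σ b` is the only arrow from the target of `b`, the path `b` and its target vertex have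
the same continuations. So removing `b` does not change the function, even for the path of length
one. -/
lemma toFun_dropArrow_p {b : E} (hb : ∀ γ, B.s γ = B.s (B.σ b) → γ = B.σ b) (γ : E) (n : ℕ) :
    B.toFun (B.dropArrow b (B.p γ n)) = (Pi.single b 1 : E → k) γ • B.toFun (B.p γ n) := by
  rw [dropArrow_p, map_smul]
  by_cases hγ : γ = b
  · subst hγ
    congr 1
    rcases n with _ | n
    · ext δ
      rw [dropMap_arrow, toFun_e, toFun_p, Pi.single_apply]
      exact if_congr ⟨hb δ, fun h => by rw [h]; rfl⟩ rfl rfl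
    · rw [dropMap_p_succ, toFun_p, toFun_p, pow_succ B.σ (n + 1), Equiv.Perm.mul_apply]
  · rw [Pi.single_eq_of_ne hγ, zero_smul, zero_smul]

lemma dropArrow_sum_mul (b : E) (c : V → k) (y : A) :
    B.dropArrow b ((∑ v, c v • B.e v) * y) = c (B.s b) • B.dropArrow b y := by
  induction y using B.induction with
  | h0 => simp
  | hadd x y hx hy => simp only [mul_add, map_add, hx, hy, smul_add]
  | hsmul c x hx => simp only [mul_smul_comm, map_smul, hx, smul_comm c]
  | he v => simp [Finset.sum_mul, e_mul_e, dropArrow_e]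
  | hp γ n =>
    simp only [Finset.sum_mul, smul_mul_assoc, e_mul_p, smul_ite, smul_zero, Finset.sum_ite_eq,
      Finset.mem_univ, if_true, map_smul, dropArrow_p]
    by_cases hγ : γ = b
    · rw [hγ]
    · rw [Pi.single_eq_of_ne hγ, zero_smul, smul_zero, smul_zero]

/-- For `x` of degree zero, linearity depends on `x` being in the kernel: `a x = 0`, with `a` the
predecessor of `b'`, makes the coefficient of `x` vanish at the common source of `b` and `b'`, so
both sides are zero. -/
lemma dropArrow_mul {b b' : E} (hs : B.s b = B.s b')
    (hb : ∀ γ, B.s γ = B.s (B.σ b) → γ = B.σ b) {x y : A} {i n : ℤ} (hx : x ∈ 𝒜 i) (hy : y ∈ 𝒜 n)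
    (h0 : B.p (B.σ⁻¹ b') 0 * x = 0) : B.dropArrow b (x * y) = B.dropArrow b x * y := by
  rcases lt_trichotomy i 0 with hi | hi | hi
  · rw [NonnegGraded.eq_bot_of_neg (𝒜 := 𝒜) _ hi, Submodule.mem_bot] at hx
    rw [hx, zero_mul, map_zero, zero_mul]
  · rw [hi] at hx
    have h1 := congrFun (B.toFun_mul_of_mem_zero (x := B.p (B.σ⁻¹ b') 0) hx) b'
    obtain ⟨c, rfl⟩ := B.exists_coeff_zero hx
    have hσ : B.σ (B.σ⁻¹ b') = b' := B.σ.apply_symm_apply b'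
    rw [h0, map_zero, Pi.mul_apply, toFun_p, zero_add, pow_one, hσ,
      Pi.single_eq_same, one_mul, toFun_sum_e, ← hs] at h1
    rw [dropArrow_sum_mul, ← h1]
    simp only [Pi.zero_apply, map_sum, map_smul, dropArrow_e, smul_zero, Finset.sum_const_zero,
      zero_smul, zero_mul]
  · exact B.map_mul_of_arrows _ (-1) (Pi.single b 1) (B.dropArrow_e b) (B.dropArrow_p_mem b)
      (B.toFun_dropArrow_p hb) hi hx hy

/-- The component of the morphism `kerHom` in a given degree. -/
noncomputable def kerHomApp (b : E) (i : ℤ) : 𝒜 (i + 1) →+ 𝒜 i :=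
  AddMonoidHom.mk' (fun x => ⟨B.dropArrow b x, by
    simpa using B.map_mem_of_arrows _ (-1) (B.dropArrow_e b) (B.dropArrow_p_mem b) x.2⟩)
    fun _ _ => Subtype.ext (map_add (B.dropArrow b) _ _)

/-- The morphism from the kernel of left multiplication by an arrow `a` to the regular module that
removes the first arrow from the paths that start with `b`, where `a b` is zero, and where `σ b` is
the only arrow from the target of `b`. -/
noncomputable def kerHom {b b' : E} (hs : B.s b = B.s b')
    (hb : ∀ γ, B.s γ = B.s (B.σ b) → γ = B.σ b) :
    ker (B.arrowMul (B.σ⁻¹ b')) ⟶ regular 𝒜 :=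
  (⟨fun i => (B.kerHomApp b i).comp ((B.arrowMul (B.σ⁻¹ b')).app i).ker.subtype,
    fun {i _ _} _ x y => Subtype.ext (B.dropArrow_mul hs hb
      (show 𝒜 (i + 1) from ((B.arrowMul (B.σ⁻¹ b')).app i).ker.subtype x).2 y.2
      (B.mul_eq_zero_of_ker x))⟩ : GrMod.Hom (ker (B.arrowMul (B.σ⁻¹ b'))) (regular 𝒜))

include B in
/-- The regular module has injective dimension at least two if there are two arrows that start at
the source of some arrow `b` and only one that starts at its target. -/
lemma not_hasInjectiveDimensionLT_two {b b' : E} (hne : b ≠ b') (hs : B.s b = B.s b')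
    (hb : ∀ γ, B.s γ = B.s (B.σ b) → γ = B.σ b) :
    ¬ HasInjectiveDimensionLT (regular 𝒜) 2 := by
  intro hdim
  let l := B.arrowMul (B.σ⁻¹ b')
  -- The cokernel of the inclusion of the kernel is, up to a shift, the right ideal generated by the
  -- arrow `σ⁻¹ b'`. By `m` it is a subobject of the projective module `A[2]`, so injective
  -- dimension at most one makes its `Ext¹` vanish.
  have hS₁ := cokerComplex_shortExact (kerι l) fun i x hx => Subtype.ext hx
  let m : coker (kerι l) ⟶ (regular 𝒜).shift 2 :=
    quotDesc _ (range_stable _) l (by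
      rintro i _ ⟨x, rfl⟩
      exact x.2)
  have hS₂ := cokerComplex_shortExact m fun i x hx => by
    obtain ⟨x, rfl⟩ := QuotientAddGroup.mk_surjective x
    exact (QuotientAddGroup.eq_zero_iff x).2 ⟨⟨x, hx⟩, rfl⟩
  have : Projective (cokerComplex m).X₂ := projective_regular_shift 2
  have : Subsingleton (Abelian.Ext (cokerComplex (kerι l)).X₃ (regular 𝒜) 1) :=
    subsingleton_ext_one_of_hasInjectiveDimensionLT_two hS₂
  -- Every morphism `A[1] ⟶ A` is zero because `A₋₁ = 0`, but `kerHom` sends `b` to the vertex at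
  -- its target.
  obtain ⟨g, hg⟩ := exists_extend_of_subsingleton_ext_one hS₁ (B.kerHom hs hb)
  let x : ((regular 𝒜).shift 1).carrier 0 := (⟨B.p b 0, B.p_mem b 0 rfl⟩ : 𝒜 (0 + 1))
  have hx : l.app 0 x = 0 := Subtype.ext ((B.p_mul_p _ 0 b 0).trans (if_neg (by simpa using hne)))
  have h1 := congrArg (fun t : ker l ⟶ regular 𝒜 => t.app 0 ⟨x, hx⟩) hg
  have h2 : g.app 0 x = 0 := by
    refine (app_eq_act_unit (M := regular 𝒜) (l := 1) (n := -1) g rfl 0 x).trans ?_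
    have : Hom.app g (-1) (unit 𝒜 (-1 + 1) rfl) = 0 := by
      have h3 : ((show 𝒜 (-1) from Hom.app g (-1) (unit 𝒜 (-1 + 1) rfl)) : A) ∈
          (⊥ : Submodule k A) :=
        (NonnegGraded.eq_bot_of_neg (𝒜 := 𝒜) (-1) (by lia)).le (Subtype.mem _)
      exact Subtype.ext h3
    refine (congrArg (fun z => (regular 𝒜).act _ z _) this).trans ?_
    exact Subtype.ext (zero_mul _)
  have h3 : B.dropArrow b (B.p b 0) = 0 := congrArg (Subtype.val (p := (· ∈ 𝒜 0))) (h1.symm.trans h2)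
  rw [dropArrow_p, Pi.single_eq_same, one_smul, dropMap_arrow] at h3
  exact B.linearIndependent.ne_zero (Sum.inl (B.s (B.σ b))) h3

include B in
/-- If the algebra is Artin-Schelter Gorenstein, then there is no arrow whose source is the source of
another arrow, and whose target is not. -/
lemma not_isASGorenstein {b b' : E} (hne : b ≠ b') (hs : B.s b = B.s b')
    (hb : ∀ γ, B.s γ = B.s (B.σ b) → γ = B.σ b) : ¬ IsASGorenstein 𝒜 := by
  rintro ⟨d, hd, -, hext, -⟩
  obtain rfl : d = 1 := by
    by_contra h
    exact B.nontrivial_ext_one hne hs (hext 1 (Ne.symm h) 0)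
  exact B.not_hasInjectiveDimensionLT_two hne hs hb ((injectiveDimension_le_iff _ 1).1 hd.le)

end NotGorenstein

end StringBasis

end

/-! ### Linear maps on the path algebra and on ideals generated by sets -/

namespace PathAlgebra

section Span

variable {k : Type u} {V : Type v} [Field k] [DecidableEq V] [Quiver.{w} V] [Fintype V]

/-- The paths span the path algebra. -/
lemma mem_span_ofPath (f : PathAlgebra k V) :
    f ∈ Submodule.span k {x : PathAlgebra k V | ∃ (a b : V) (p : Quiver.Path a b),
      x = ofPath k p} := by
  have h : f = ∑ a, ∑ b, (f.coeff a b).sum fun p c => c • ofPath k p := by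
    ext1 x y
    rw [sum_coeff, Finset.sum_eq_single x, sum_coeff, Finset.sum_eq_single y, Finsupp.sum, sum_coeff]
    · simp only [smul_coeff, ofPath_coeff_self, Finsupp.smul_single, smul_eq_mul, mul_one]
      exact (Finsupp.sum_single _).symm
    · intro b _ hb
      rw [Finsupp.sum, sum_coeff]
      exact Finset.sum_eq_zero fun p _ => by
        rw [smul_coeff, ofPath_coeff_of_ne_right _ hb.symm, smul_zero]
    · simp
    · intro a _ ha
      rw [sum_coeff]
      refine Finset.sum_eq_zero fun b _ => ?_
      rw [Finsupp.sum, sum_coeff]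
      exact Finset.sum_eq_zero fun p _ => by
        rw [smul_coeff, ofPath_coeff_of_ne_left _ ha.symm, smul_zero]
    · simp
  rw [h]
  exact Submodule.sum_mem _ fun a _ => Submodule.sum_mem _ fun b _ => Submodule.sum_mem _
    fun p _ => Submodule.smul_mem _ _ (Submodule.subset_span ⟨a, b, p, rfl⟩)

/-- The linear map on the path algebra with given values on the paths. -/
noncomputable def lift {M : Type*} [AddCommGroup M] [Module k M]
    (φ : ∀ a b : V, Quiver.Path a b → M) : PathAlgebra k V →ₗ[k] M where
  toFun f := ∑ a, ∑ b, Finsupp.linearCombination k (φ a b) (f.coeff a b)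
  map_add' f g := by simp [Finset.sum_add_distrib]
  map_smul' c f := by simp [Finset.smul_sum]

lemma lift_ofPath {M : Type*} [AddCommGroup M] [Module k M]
    (φ : ∀ a b : V, Quiver.Path a b → M) {a b : V} (p : Quiver.Path a b) :
    lift φ (ofPath k p) = φ a b p := by
  change ∑ x, ∑ y, Finsupp.linearCombination k (φ x y) ((ofPath k p).coeff x y) = _
  rw [Finset.sum_eq_single a, Finset.sum_eq_single b, ofPath_coeff_self]
  · simp
  · intro y _ hy
    rw [ofPath_coeff_of_ne_right _ hy, map_zero]
  · simp
  · intro x _ hx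
    refine Finset.sum_eq_zero fun y _ => ?_
    rw [ofPath_coeff_of_ne_left _ hx, map_zero]
  · simp

/-- A linear map vanishes on the two-sided ideal generated by a set if it vanishes on the products
of the elements of this set with paths on both sides. -/
lemma map_eq_zero_of_mem_span {M : Type*} [AddCommGroup M] [Module k M]
    {R : Set (PathAlgebra k V)} (Φ : PathAlgebra k V →ₗ[k] M)
    (h : ∀ r ∈ R, ∀ {a b c d : V} (p : Quiver.Path a b) (q : Quiver.Path c d),
      Φ (ofPath k p * r * ofPath k q) = 0) {f : PathAlgebra k V} (hf : f ∈ TwoSidedIdeal.span R) :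
    Φ f = 0 := by
  rw [TwoSidedIdeal.mem_span_iff_mem_addSubgroup_closure] at hf
  induction hf using AddSubgroup.closure_induction with
  | zero => exact map_zero Φ
  | add x y _ _ hx hy => rw [map_add, hx, hy, add_zero]
  | neg x _ hx => rw [map_neg, hx, neg_zero]
  | mem x hx =>
    obtain ⟨_, ⟨x, -, r, hr, rfl⟩, y, -, rfl⟩ := hx
    induction mem_span_ofPath x using Submodule.span_induction with
    | zero => simp
    | add x₁ x₂ _ _ h₁ h₂ => simpa [add_mul, h₁] using h₂
    | smul c x _ h => simpa using Or.inr h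
    | mem x hx =>
      obtain ⟨a, b, p, rfl⟩ := hx
      induction mem_span_ofPath y using Submodule.span_induction with
      | zero => simp
      | add x₁ x₂ _ _ h₁ h₂ => simpa [mul_add, h₁] using h₂
      | smul c x _ h => simpa using Or.inr h
      | mem y hy =>
        obtain ⟨c, d, q, rfl⟩ := hy
        exact h r hr p q

end Span

end PathAlgebra

/-! ### Paths that follow a permutation of the arrows -/

section Code

variable {V : Type v} [Quiver.{w} V]

variable (V) in
/-- The arrows of a quiver. -/
abbrev Arrow : Type (max v w) := Σ a b : V, (a ⟶ b)

variable [DecidableEq (Arrow V)] (σ : Equiv.Perm (Arrow V))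

/-- Extend a path that follows the permutation `σ` of the arrows by an arrow. -/
def extendCode (δ : Arrow V) : V ⊕ Arrow V × ℕ → Option (V ⊕ Arrow V × ℕ)
  | Sum.inl _ => some (Sum.inr (δ, 0))
  | Sum.inr (γ, n) => if δ = (σ ^ (n + 1)) γ then some (Sum.inr (γ, n + 1)) else none

/-- The vertex of a path of length zero, and the first arrow `γ` and the length `n + 1` of a longer
path if this is the path with arrows `γ, σ γ, …, σⁿ γ`. -/
def pathCode {a : V} : ∀ {b : V}, Quiver.Path a b → Option (V ⊕ Arrow V × ℕ)
  | _, Quiver.Path.nil => some (Sum.inl a)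
  | _, Quiver.Path.cons p α => (pathCode p).bind (extendCode σ ⟨_, _, α⟩)

variable {σ}

lemma pathCode_eq_inl {a b v : V} {p : Quiver.Path a b} (h : pathCode σ p = some (Sum.inl v)) :
    v = b ∧ p.length = 0 := by
  rcases p with _ | ⟨p, α⟩
  · exact ⟨(Sum.inl_injective (Option.some_injective _ h)).symm, rfl⟩
  · obtain ⟨_ | ⟨γ, n⟩, -, hx⟩ := Option.bind_eq_some_iff.1 h
    · simp [extendCode] at hx
    · simp only [extendCode] at hx
      split_ifs at hx
      simp at hx

lemma pathCode_cons_eq_inr {a b c : V} {p : Quiver.Path a b} {α : b ⟶ c} {γ : Arrow V} {n : ℕ}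
    (h : pathCode σ (p.cons α) = some (Sum.inr (γ, n))) : (σ ^ n) γ = ⟨_, _, α⟩ := by
  obtain ⟨_ | ⟨γ, n⟩, -, hx⟩ := Option.bind_eq_some_iff.1 h
  · simp only [extendCode, Option.some.injEq, Sum.inr.injEq, Prod.mk.injEq] at hx
    rw [← hx.1, ← hx.2]
    rfl
  · simp only [extendCode] at hx
    split_ifs at hx with hc
    simp only [Option.some.injEq, Sum.inr.injEq, Prod.mk.injEq] at hx
    rw [hc, ← hx.1, ← hx.2]

lemma length_of_pathCode {a b : V} {p : Quiver.Path a b} {γ : Arrow V} {n : ℕ}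
    (h : pathCode σ p = some (Sum.inr (γ, n))) : p.length = n + 1 := by
  induction p generalizing γ n with
  | nil => simp [pathCode] at h
  | cons p α ih =>
    obtain ⟨v | ⟨δ, m⟩, hp, hx⟩ := Option.bind_eq_some_iff.1 h
    · simp only [extendCode, Option.some.injEq, Sum.inr.injEq, Prod.mk.injEq] at hx
      rw [Quiver.Path.length_cons, (pathCode_eq_inl hp).2, ← hx.2]
    · simp only [extendCode] at hx
      split_ifs at hx with hc
      simp only [Option.some.injEq, Sum.inr.injEq, Prod.mk.injEq] at hx
      rw [Quiver.Path.length_cons, ih hp, ← hx.2]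

lemma pathCode_comp_eq_none {a b c : V} {p : Quiver.Path a b} (q : Quiver.Path b c)
    (h : pathCode σ p = none) : pathCode σ (p.comp q) = none := by
  induction q with
  | nil => exact h
  | cons q α ih => rw [Quiver.Path.comp_cons, pathCode, ih, Option.bind_none]

/-- The code of a path that follows `σ` determines its last arrow, so that two consecutive arrows
which violate `σ` spoil every path that ends with them. -/
lemma pathCode_cons_cons_eq_none {a b c d : V} (p : Quiver.Path a b) {α : b ⟶ c} {β : c ⟶ d}
    (h : (⟨_, _, β⟩ : Arrow V) ≠ σ ⟨_, _, α⟩) : pathCode σ ((p.cons α).cons β) = none := by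
  rcases hp : pathCode σ (p.cons α) with _ | v | ⟨γ, n⟩
  · rw [pathCode, hp, Option.bind_none]
  · exact absurd (pathCode_eq_inl hp).2 (by simp)
  · rw [pathCode, hp, Option.bind_some, extendCode, if_neg]
    rwa [pow_succ', Equiv.Perm.mul_apply, pathCode_cons_eq_inr hp]

end Code

/-! ### The basis of paths of the quotient algebra -/

section Basis

variable {k : Type u} {V : Type v} [Field k] [Fintype V] [DecidableEq V] [Quiver.{w} V]

open PathAlgebra

lemma quotMk_mul (I : TwoSidedIdeal (PathAlgebra k V)) (f g : PathAlgebra k V) :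
    quotMk I (f * g) = quotMk I f * quotMk I g := rfl

lemma quotMk_eq_zero {I : TwoSidedIdeal (PathAlgebra k V)} {f : PathAlgebra k V} :
    quotMk I f = 0 ↔ f ∈ I :=
  (RingCon.eq I.ringCon).trans (I.mem_iff f).symm

lemma quotMk_surjective (I : TwoSidedIdeal (PathAlgebra k V)) : Function.Surjective (quotMk I) :=
  Quotient.mk_surjective

/-- The class of an arrow in `kQ / I`. -/
noncomputable def arrowClass (I : TwoSidedIdeal (PathAlgebra k V)) (α : Arrow V) : QuotAlgebra I :=
  quotMk I (ofPath k α.2.2.toPath)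

/-- The class of a vertex in `kQ / I`. -/
noncomputable def vertexClass (I : TwoSidedIdeal (PathAlgebra k V)) (v : V) : QuotAlgebra I :=
  quotMk I (ofPath k (Quiver.Path.nil : Quiver.Path v v))

lemma quotMk_cons (I : TwoSidedIdeal (PathAlgebra k V)) {a b c : V} (p : Quiver.Path a b)
    (α : b ⟶ c) : quotMk I (ofPath k (p.cons α)) =
      quotMk I (ofPath k p) * arrowClass I ⟨_, _, α⟩ := by
  rw [arrowClass, ← quotMk_mul, ofPath_mul_ofPath]
  rfl

lemma one_eq_sum_vertexClass (I : TwoSidedIdeal (PathAlgebra k V)) :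
    1 = ∑ v, vertexClass I v :=
  map_sum (quotMk I) (fun v => ofPath k (Quiver.Path.nil : Quiver.Path v v)) Finset.univ

lemma vertexClass_mul_vertexClass (I : TwoSidedIdeal (PathAlgebra k V)) (v w : V) :
    vertexClass I v * vertexClass I w = if w = v then vertexClass I v else 0 := by
  rw [vertexClass, vertexClass, ← quotMk_mul]
  split_ifs with h
  · subst h
    rw [ofPath_mul_ofPath]
    rfl
  · rw [ofPath_mul_ofPath_of_ne _ _ (Ne.symm h), map_zero]

lemma vertexClass_mul_arrowClass (I : TwoSidedIdeal (PathAlgebra k V)) (v : V) (α : Arrow V) :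
    vertexClass I v * arrowClass I α = if α.1 = v then arrowClass I α else 0 := by
  rw [vertexClass, arrowClass, ← quotMk_mul]
  split_ifs with h
  · subst h
    rw [ofPath_mul_ofPath, Quiver.Path.nil_comp]
  · rw [ofPath_mul_ofPath_of_ne _ _ (Ne.symm h), map_zero]

lemma arrowClass_mul_vertexClass (I : TwoSidedIdeal (PathAlgebra k V)) (v : V) (α : Arrow V) :
    arrowClass I α * vertexClass I v = if α.2.1 = v then arrowClass I α else 0 := by
  rw [vertexClass, arrowClass, ← quotMk_mul]
  split_ifs with h
  · subst h
    rw [ofPath_mul_ofPath, Quiver.Path.comp_nil]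
  · rw [ofPath_mul_ofPath_of_ne _ _ h, map_zero]

lemma target_eq_source {I : TwoSidedIdeal (PathAlgebra k V)} {α β : Arrow V}
    (h : arrowClass I α * arrowClass I β ≠ 0) : α.2.1 = β.1 := by
  by_contra hne
  refine h ?_
  rw [arrowClass, arrowClass, ← quotMk_mul, ofPath_mul_ofPath_of_ne _ _ hne, map_zero]

/-- The class in `kQ / I` of the path with arrows `γ, σ γ, …, σⁿ γ`. -/
noncomputable def orbitPath (I : TwoSidedIdeal (PathAlgebra k V)) (σ : Equiv.Perm (Arrow V)) (γ : Arrow V) :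
    ℕ → QuotAlgebra I
  | 0 => arrowClass I γ
  | n + 1 => orbitPath I σ γ n * arrowClass I ((σ ^ (n + 1)) γ)

/-- The family of elements of `kQ / I` that is indexed by the codes of paths. -/
noncomputable def codeClass (I : TwoSidedIdeal (PathAlgebra k V)) (σ : Equiv.Perm (Arrow V)) :
    V ⊕ Arrow V × ℕ → QuotAlgebra I :=
  Sum.elim (vertexClass I) fun x => orbitPath I σ x.1 x.2

variable {I : TwoSidedIdeal (PathAlgebra k V)} {σ : Equiv.Perm (Arrow V)}
  (hσ : ∀ α β, arrowClass I α * arrowClass I β ≠ 0 ↔ β = σ α) [DecidableEq (Arrow V)]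

include hσ

/-- Whether a path can be continued is decided by its last arrow `σⁿ γ`. -/
lemma orbitPath_mul_arrowClass (γ : Arrow V) (n : ℕ) (δ : Arrow V) :
    orbitPath I σ γ n * arrowClass I δ =
      if δ = (σ ^ (n + 1)) γ then orbitPath I σ γ (n + 1) else 0 := by
  split_ifs with h
  · rw [h]; rfl
  · have h0 : arrowClass I ((σ ^ n) γ) * arrowClass I δ = 0 := by
      by_contra h0
      rw [← ne_eq, hσ, ← Equiv.Perm.mul_apply, ← pow_succ'] at h0
      exact h h0
    rcases n with _ | n
    · exact h0
    · rw [orbitPath, mul_assoc, h0, mul_zero]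

lemma target_eq (α : Arrow V) : α.2.1 = (σ α).1 := target_eq_source ((hσ _ _).2 rfl)

lemma vertexClass_mul_orbitPath (v : V) (γ : Arrow V) (n : ℕ) :
    vertexClass I v * orbitPath I σ γ n = if γ.1 = v then orbitPath I σ γ n else 0 := by
  induction n with
  | zero => exact vertexClass_mul_arrowClass I v γ
  | succ n ih =>
    rw [orbitPath, ← mul_assoc, ih]
    split_ifs <;> simp

lemma orbitPath_mul_vertexClass (γ : Arrow V) (n : ℕ) (v : V) :
    orbitPath I σ γ n * vertexClass I v =
      if ((σ ^ (n + 1)) γ).1 = v then orbitPath I σ γ n else 0 := by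
  rw [pow_succ', Equiv.Perm.mul_apply, ← target_eq hσ]
  rcases n with _ | n
  · exact arrowClass_mul_vertexClass I v γ
  · rw [orbitPath, mul_assoc, arrowClass_mul_vertexClass]
    split_ifs <;> simp

lemma orbitPath_mul_orbitPath (γ : Arrow V) (n : ℕ) (δ : Arrow V) (m : ℕ) :
    orbitPath I σ γ n * orbitPath I σ δ m =
      if δ = (σ ^ (n + 1)) γ then orbitPath I σ γ (n + m + 1) else 0 := by
  induction m with
  | zero => exact orbitPath_mul_arrowClass hσ γ n δ
  | succ m ih =>
    rw [orbitPath, ← mul_assoc, ih]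
    split_ifs with h
    · rw [orbitPath_mul_arrowClass hσ, if_pos]
      · rfl
      · rw [h, ← Equiv.Perm.mul_apply, ← pow_add]
        congr 2
        ring
    · rw [zero_mul]

/-- The class of a path in `kQ / I` is determined by its code. -/
lemma quotMk_ofPath {a b : V} (p : Quiver.Path a b) :
    quotMk I (ofPath k p) = (pathCode σ p).elim 0 (codeClass I σ) := by
  induction p with
  | nil => rfl
  | cons p α ih =>
    rw [quotMk_cons, ih, pathCode]
    rcases hp : pathCode σ p with _ | v | ⟨γ, n⟩
    · simp
    · obtain ⟨rfl, -⟩ := pathCode_eq_inl hp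
      simp [codeClass, extendCode, vertexClass_mul_arrowClass, orbitPath]
    · simp only [Option.elim_some, codeClass, Sum.elim_inr, Option.bind_some, extendCode]
      rw [orbitPath_mul_arrowClass hσ]
      split_ifs <;> rfl

lemma exists_path_of_code (x : V ⊕ Arrow V × ℕ) :
    ∃ (a b : V) (p : Quiver.Path a b), pathCode σ p = some x := by
  rcases x with v | ⟨γ, n⟩
  · exact ⟨v, v, Quiver.Path.nil, rfl⟩
  · suffices ∃ (b : V) (p : Quiver.Path γ.1 b), b = ((σ ^ (n + 1)) γ).1 ∧
        pathCode σ p = some (Sum.inr (γ, n)) by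
      obtain ⟨b, p, -, hp⟩ := this
      exact ⟨_, b, p, hp⟩
    induction n with
    | zero => exact ⟨_, γ.2.2.toPath, target_eq hσ γ, rfl⟩
    | succ n ih =>
      obtain ⟨b, p, rfl, hp⟩ := ih
      refine ⟨_, p.cons ((σ ^ (n + 1)) γ).2.2, ?_, ?_⟩
      · rw [pow_succ' σ (n + 1), Equiv.Perm.mul_apply, ← target_eq hσ]
      · rw [pathCode, hp]
        exact if_pos rfl

/-- The classes of the paths that follow the permutation `σ` are linearly independent in `kQ / I` if
`I` is generated by paths of length two. -/
lemma linearIndependent_codeClass {R : Set (PathAlgebra k V)}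
    (hR : ∀ r ∈ R, ∃ (a b : V) (p : Quiver.Path a b), p.length = 2 ∧ r = ofPath k p)
    (hI : I = TwoSidedIdeal.span R) : LinearIndependent k (codeClass I σ) := by
  -- Paths that follow `σ` are sent to their codes, all others to zero. This kills `I`, since no
  -- path that contains a relation follows `σ`, and it separates the codes.
  let Φ : PathAlgebra k V →ₗ[k] (V ⊕ Arrow V × ℕ →₀ k) :=
    lift fun _ _ p => (pathCode σ p).elim 0 fun x => Finsupp.single x 1
  have hΦ : ∀ f ∈ I, Φ f = 0 := fun f hf => by
    rw [hI] at hf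
    refine map_eq_zero_of_mem_span Φ ?_ hf
    intro r hr a b c d p q
    obtain ⟨x, y, z, hz, rfl⟩ := hR r hr
    by_cases hbx : b = x
    swap
    · rw [ofPath_mul_ofPath_of_ne _ _ hbx, zero_mul, map_zero]
    subst hbx
    by_cases hyc : y = c
    swap
    · rw [mul_assoc, ofPath_mul_ofPath_of_ne _ _ hyc, mul_zero, map_zero]
    subst hyc
    rw [ofPath_mul_ofPath, ofPath_mul_ofPath, lift_ofPath, pathCode_comp_eq_none _ ?_,
      Option.elim_none]
    obtain _ | ⟨z, β⟩ := z
    · simp at hz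
    obtain _ | ⟨z, α⟩ := z
    · simp at hz
    obtain _ | ⟨z, δ⟩ := z
    · refine pathCode_cons_cons_eq_none _ ?_
      rw [ne_eq, ← hσ, not_not, arrowClass, arrowClass, ← quotMk_mul, ofPath_mul_ofPath,
        quotMk_eq_zero, hI]
      exact TwoSidedIdeal.subset_span hr
    · simp at hz
  -- A linear section of the quotient map; as `Φ` kills `I`, the composition `Φ ∘ g` is the map that
  -- `Φ` induces on the quotient.
  obtain ⟨g, hg⟩ := (quotMk I).exists_rightInverse_of_surjective
    (LinearMap.range_eq_top.2 (quotMk_surjective I))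
  have hΦg : ∀ f, Φ (g (quotMk I f)) = Φ f := fun f => by
    rw [← sub_eq_zero, ← map_sub]
    refine hΦ _ (quotMk_eq_zero.1 ?_)
    rw [map_sub, sub_eq_zero]
    exact LinearMap.congr_fun hg _
  refine LinearIndependent.of_comp (Φ ∘ₗ g) ?_
  convert (Finsupp.basisSingleOne (R := k) (ι := V ⊕ Arrow V × ℕ)).linearIndependent using 1
  funext x
  obtain ⟨a, b, p, hp⟩ := exists_path_of_code hσ x
  have h : codeClass I σ x = quotMk I (ofPath k p) := by
    rw [quotMk_ofPath hσ, hp, Option.elim_some]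
  rw [Function.comp_apply, h, LinearMap.comp_apply, hΦg, lift_ofPath, hp]
  simp

/-- The basis of paths of `kQ / I`, where `I` is generated by paths of length two, and each arrow
can be continued in exactly one way on either side. -/
noncomputable def stringBasis {R : Set (PathAlgebra k V)}
    (hR : ∀ r ∈ R, ∃ (a b : V) (p : Quiver.Path a b), p.length = 2 ∧ r = ofPath k p)
    (hI : I = TwoSidedIdeal.span R) (hs : ∀ v : V, ∃ α : Arrow V, α.1 = v) :
    StringBasis (pathGrading I) V (Arrow V) where
  s := Sigma.fst
  σ := σ
  s_surjective := hs
  e := vertexClass I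
  p := orbitPath I σ
  linearIndependent := linearIndependent_codeClass hσ hR hI
  span_eq_top := by
    rw [eq_top_iff]
    rintro x -
    obtain ⟨f, rfl⟩ := quotMk_surjective I x
    induction mem_span_ofPath f using Submodule.span_induction with
    | zero => simp
    | add x y _ _ hx hy => rw [map_add]; exact add_mem hx hy
    | smul c x _ hx => rw [map_smul]; exact Submodule.smul_mem _ _ hx
    | mem x hx =>
      obtain ⟨a, b, p, rfl⟩ := hx
      rw [quotMk_ofPath hσ]
      rcases pathCode σ p with _ | x
      · exact zero_mem _
      · exact Submodule.subset_span ⟨x, rfl⟩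
  span_zero := by
    refine le_antisymm (Submodule.span_le.2 ?_) (Submodule.span_le.2 ?_)
    · rintro _ ⟨a, b, p, hp, rfl⟩
      obtain _ | ⟨p, α⟩ := p
      · exact Submodule.subset_span ⟨a, rfl⟩
      · rw [Quiver.Path.length_cons] at hp
        lia
    · rintro _ ⟨v, rfl⟩
      exact Submodule.subset_span ⟨v, v, Quiver.Path.nil, rfl, rfl⟩
  span_succ n := by
    refine le_antisymm (Submodule.span_le.2 ?_) (Submodule.span_le.2 ?_)
    · rintro _ ⟨a, b, p, hp, rfl⟩
      rw [quotMk_ofPath hσ]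
      rcases h : pathCode σ p with _ | v | ⟨γ, m⟩
      · exact zero_mem _
      · rw [(pathCode_eq_inl h).2] at hp
        lia
      · rw [length_of_pathCode h] at hp
        obtain rfl : m = n := by lia
        exact Submodule.subset_span ⟨γ, rfl⟩
    · rintro _ ⟨γ, rfl⟩
      obtain ⟨a, b, p, hp⟩ := exists_path_of_code hσ (Sum.inr (γ, n))
      refine Submodule.subset_span ⟨a, b, p, by rw [length_of_pathCode hp]; simp, ?_⟩
      rw [quotMk_ofPath hσ, hp]
      rfl
  one_eq := one_eq_sum_vertexClass I
  e_mul_e := vertexClass_mul_vertexClass I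
  e_mul_p := vertexClass_mul_orbitPath hσ
  p_mul_e := orbitPath_mul_vertexClass hσ
  p_mul_p := orbitPath_mul_orbitPath hσ

end Basis

/-! ### Combinatorics of connected quivers -/

section Quivers

variable {V : Type v} [Quiver.{w} V]

/-- In a connected quiver, a property of vertices that each arrow preserves in both directions holds
for all vertices if it holds for one of them. -/
lemma forall_of_connected (hV : Subsingleton (Quiver.WeaklyConnectedComponent V)) {P : V → Prop}
    (hP : ∀ α : Arrow V, P α.1 ↔ P α.2.1) {x : V} (hx : P x) (y : V) : P y := by
  obtain ⟨p⟩ := (Quiver.WeaklyConnectedComponent.eq x y).1 (Subsingleton.elim _ _)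
  induction p with
  | nil => exact hx
  | cons p α ih =>
    rcases α with α | α
    · exact (hP ⟨_, _, α⟩).1 ih
    · exact (hP ⟨_, _, α⟩).2 ih

variable {σ : Equiv.Perm (Arrow V)} (hσ : ∀ α : Arrow V, α.2.1 = (σ α).1)

include hσ in
/-- In a connected quiver whose arrows can be continued by a permutation `σ`, each vertex is the
source of an arrow. -/
lemma exists_arrow_of_connected (hV : Subsingleton (Quiver.WeaklyConnectedComponent V))
    (hE : Nonempty (Arrow V)) (x : V) : ∃ α : Arrow V, α.1 = x := by
  obtain ⟨γ⟩ := hE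
  refine forall_of_connected hV (P := fun x => ∃ α : Arrow V, α.1 = x) (fun α => ?_) ⟨γ, rfl⟩ x
  exact iff_of_true ⟨α, rfl⟩ ⟨σ α, (hσ α).symm⟩

variable (V) in
/-- The number of arrows is the sum of the numbers of arrows that start at the vertices. -/
lemma numArrows_eq_sum [Fintype V] [∀ a b : V, Fintype (a ⟶ b)] :
    numArrows V = ∑ x : V, Fintype.card (Σ y : V, (x ⟶ y)) := Fintype.card_sigma

include hσ in
/-- Either each vertex is the source of several arrows, or each vertex is the source of at most one
arrow, or some arrow leads from a vertex of the first kind to one of the second. -/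
lemma sources_trichotomy [Fintype V] [∀ a b : V, Fintype (a ⟶ b)]
    (hV : Subsingleton (Quiver.WeaklyConnectedComponent V)) :
    (∀ x : V, ∃ β β' : Arrow V, β ≠ β' ∧ β.1 = x ∧ β'.1 = x) ∨
    Function.Injective (Sigma.fst : Arrow V → V) ∨
    ∃ β β' : Arrow V, β ≠ β' ∧ β.1 = β'.1 ∧ ∀ γ : Arrow V, γ.1 = (σ β).1 → γ = σ β := by
  by_contra! h
  obtain ⟨⟨x, hx⟩, hinj, h⟩ := h
  let P : V → Prop := fun x => ∃ β β' : Arrow V, β ≠ β' ∧ β.1 = x ∧ β'.1 = x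
  -- If the third alternative fails, no arrow leaves the set of vertices with several outgoing
  -- arrows.
  have hP : ∀ β : Arrow V, P β.1 → P (σ β).1 := by
    rintro β ⟨γ, γ', hne, hγ, hγ'⟩
    have : ∃ β' : Arrow V, β ≠ β' ∧ β.1 = β'.1 := by
      by_cases hβ : β = γ
      · exact ⟨γ', hβ ▸ hne, hγ'.symm⟩
      · exact ⟨γ, hβ, hγ.symm⟩
    obtain ⟨β', hβ, hβ'⟩ := this
    obtain ⟨δ, hδ, hδ'⟩ := h β β' hβ hβ'
    exact ⟨δ, σ β, hδ', hδ, rfl⟩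
  have hpow : ∀ (n : ℕ) (β : Arrow V), P β.1 → P ((σ ^ n) β).1 := by
    intro n
    induction n with
    | zero => exact fun β hβ => hβ
    | succ n ih =>
      intro β hβ
      rw [pow_succ, Equiv.Perm.mul_apply]
      exact ih _ (hP β hβ)
  -- As `σ` has finite order, `σ⁻¹` is a power of `σ`; so no arrow enters this set from outside
  -- either, and connectedness makes it empty or everything.
  have hP' : ∀ β : Arrow V, P (σ β).1 → P β.1 := fun β hβ => by
    classical
    have := hpow (orderOf σ - 1) _ hβ
    rwa [← Equiv.Perm.mul_apply, ← pow_succ, Nat.sub_add_cancel (orderOf_pos σ), pow_orderOf_eq_one,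
      Equiv.Perm.one_apply] at this
  rw [Function.Injective] at hinj
  push Not at hinj
  obtain ⟨β, β', hs, hne⟩ := hinj
  obtain ⟨γ, γ', hne, hγ, hγ'⟩ := forall_of_connected hV (P := P)
    (fun α => by rw [hσ]; exact ⟨hP α, hP' α⟩) (x := β.1) ⟨β, β', hne, rfl, hs.symm⟩ x
  exact hx γ γ' hne hγ hγ'

lemma numArrows_eq_card_iff [Fintype V] [∀ a b : V, Fintype (a ⟶ b)]
    (hs : ∀ x : V, ∃ α : Arrow V, α.1 = x) :
    numArrows V = Fintype.card V ↔ Function.Injective (Sigma.fst : Arrow V → V) := by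
  constructor
  · exact fun h => ((Fintype.bijective_iff_surjective_and_card _).2 ⟨hs, h⟩).1
  · exact fun h => Fintype.card_of_bijective ⟨h, hs⟩

lemma numArrows_eq_two_mul_card_iff [Fintype V] [∀ a b : V, Fintype (a ⟶ b)]
    (h2 : ∀ x : V, Fintype.card (Σ y : V, (x ⟶ y)) ≤ 2) :
    numArrows V = 2 * Fintype.card V ↔
      ∀ x : V, ∃ β β' : Arrow V, β ≠ β' ∧ ∀ γ : Arrow V, γ.1 = x ↔ γ = β ∨ γ = β' := by
  classical
  have h : numArrows V = 2 * Fintype.card V ↔ ∀ x : V, Fintype.card (Σ y : V, (x ⟶ y)) = 2 := by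
    -- The number of arrows is a sum of terms at most two, so it is maximal only if every term is
    -- two.
    have := Finset.sum_eq_sum_iff_of_le (s := Finset.univ) fun x _ => h2 x
    rw [Finset.sum_const, Finset.card_univ, smul_eq_mul, ← numArrows_eq_sum, mul_comm] at this
    simpa using this
  rw [h]
  refine forall_congr' fun x => ⟨fun hx => ?_, ?_⟩
  · obtain ⟨β, β', hne, hu⟩ := Finset.card_eq_two.1 hx
    refine ⟨⟨x, β⟩, ⟨x, β'⟩, by simpa using hne, ?_⟩
    rintro ⟨y, γ⟩
    refine ⟨?_, ?_⟩
    · rintro rfl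
      have := Finset.mem_univ γ
      rw [hu, Finset.mem_insert, Finset.mem_singleton] at this
      simpa using this
    · rintro (h | h) <;> rw [h]
  · rintro ⟨⟨y, β⟩, ⟨y', β'⟩, hne, h⟩
    obtain rfl : y = x := (h _).2 (Or.inl rfl)
    obtain rfl : y' = y := (h _).2 (Or.inr rfl)
    refine le_antisymm (h2 y') (Finset.one_lt_card.2 ⟨β, Finset.mem_univ _, β', Finset.mem_univ _, ?_⟩)
    rintro rfl
    exact hne rfl

lemma numArrows_of_isTildeA [Fintype V] [∀ a b : V, Fintype (a ⟶ b)] (h : IsTildeA V) :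
    numArrows V = Fintype.card V := by
  classical
  obtain ⟨n, e, h⟩ := h
  rw [numArrows_eq_sum, Fintype.card_eq_sum_ones]
  refine Finset.sum_congr rfl fun x _ => ?_
  rw [Fintype.card_sigma, Finset.sum_congr rfl fun y _ => h x y,
    Finset.sum_eq_single (e.symm (e x + 1))]
  · simp
  · intro y _ hy
    rw [if_neg]
    rintro h
    exact hy (by rw [← h, Equiv.symm_apply_apply])
  · simp

include hσ in
/-- A connected quiver with exactly one arrow from each vertex, where the arrows can be continued by
a permutation, is an oriented cycle. -/
lemma isTildeA_of_injective [Fintype V] [∀ a b : V, Fintype (a ⟶ b)]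
    (hV : Subsingleton (Quiver.WeaklyConnectedComponent V)) [Nonempty V]
    (hs : ∀ x : V, ∃ α : Arrow V, α.1 = x)
    (hinj : Function.Injective (Sigma.fst : Arrow V → V)) : IsTildeA V := by
  classical
  let s : Arrow V ≃ V := Equiv.ofBijective Sigma.fst ⟨hinj, hs⟩
  let T : Equiv.Perm V := (s.symm.trans σ).trans s
  have hT : ∀ α : Arrow V, T α.1 = α.2.1 := fun α => by
    rw [hσ]
    exact congrArg (fun x => (σ x).1) (s.symm_apply_apply α)
  -- The permutation `T` moves each vertex along its only outgoing arrow, so by connectedness it is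
  -- a single cycle.
  have hcyc : T.IsCycleOn (Finset.univ : Finset V) := by
    refine ⟨by simp, fun x _ y _ => ?_⟩
    refine forall_of_connected hV (P := fun y => T.SameCycle x y) (fun α => ?_)
      (Equiv.Perm.SameCycle.refl _ _) y
    rw [← hT, Equiv.Perm.sameCycle_apply_right]
  obtain ⟨n, hn⟩ := Nat.exists_eq_add_one_of_ne_zero (Fintype.card_ne_zero (α := V))
  obtain ⟨x⟩ := ‹Nonempty V›
  have hf : Function.Bijective fun j : ZMod (n + 1) => (T ^ j.val) x := by
    rw [Fintype.bijective_iff_surjective_and_card]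
    refine ⟨fun y => ?_, by rw [ZMod.card, hn]⟩
    obtain ⟨m, hm, rfl⟩ := hcyc.exists_pow_eq (Finset.mem_univ x) (Finset.mem_univ y)
    rw [Finset.card_univ, hn] at hm
    exact ⟨m, by simp only [ZMod.val_natCast, Nat.mod_eq_of_lt hm]⟩
  let f := Equiv.ofBijective _ hf
  have hfT : ∀ j, f (j + 1) = T (f j) := fun j => by
    change (T ^ (j + 1).val) x = T ((T ^ j.val) x)
    rw [← Equiv.Perm.mul_apply, ← pow_succ', hcyc.pow_apply_eq_pow_apply (Finset.mem_univ x),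
      Finset.card_univ, hn, ZMod.val_add]
    refine (Nat.mod_modEq _ _).trans (Nat.ModEq.add_left _ ?_)
    rw [ZMod.val_one_eq_one_mod]
    exact Nat.mod_modEq _ _
  refine ⟨n, f.symm, fun y z => ?_⟩
  have hz : f.symm z = f.symm y + 1 ↔ z = T y := by
    rw [Equiv.symm_apply_eq, hfT, Equiv.apply_symm_apply]
  rw [if_congr hz rfl rfl]
  split_ifs with h
  · obtain ⟨⟨y, z', α⟩, rfl⟩ := hs y
    obtain rfl : z' = z := by rw [h, hT]
    refine Fintype.card_eq_one_iff.2 ⟨α, fun β => ?_⟩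
    have := @hinj ⟨y, z', β⟩ ⟨y, z', α⟩ rfl
    simpa using this
  · rw [Fintype.card_eq_zero_iff]
    exact ⟨fun α => h (hT ⟨y, z, α⟩).symm⟩

end Quivers

/-! ### From the gentle conditions to a permutation of the arrows -/

section Gentle

variable {k : Type u} {V : Type v} [Field k] [Fintype V] [DecidableEq V] [Quiver.{w} V]
  [∀ a b : V, Fintype (a ⟶ b)] {I : TwoSidedIdeal (PathAlgebra k V)}

open PathAlgebra

lemma arrowClass_mul_arrowClass_eq_zero {x y z : V} (α : x ⟶ y) (β : y ⟶ z) :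
    arrowClass I ⟨_, _, α⟩ * arrowClass I ⟨_, _, β⟩ = 0 ↔
      ofPath k (α.toPath.comp β.toPath) ∈ I := by
  rw [arrowClass, arrowClass, ← quotMk_mul, ofPath_mul_ofPath, quotMk_eq_zero]

/-- Of two distinct continuations of `α`, the gentle conditions put one into `I`. The other half of
the condition, that only one of them is in `I`, plays no role here. -/
lemma GentleConditions.right_cancel (h : GentleConditions I) {α β β' : Arrow V}
    (hβ : arrowClass I α * arrowClass I β ≠ 0) (hβ' : arrowClass I α * arrowClass I β' ≠ 0) :
    β = β' := by
  obtain ⟨x, y, α⟩ := α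
  obtain ⟨y, z, β⟩ := β
  obtain ⟨y', z', β'⟩ := β'
  obtain rfl := target_eq_source hβ
  obtain rfl := target_eq_source hβ'
  by_contra hne
  dsimp only at hβ hβ'
  rw [ne_eq, arrowClass_mul_arrowClass_eq_zero] at hβ hβ'
  rcases h.right_unique α ⟨z, β⟩ ⟨z', β'⟩ (fun h => hne (congrArg (Sigma.mk _) h)) with h | h
  · exact hβ h.1
  · exact hβ' h.1

lemma GentleConditions.left_cancel (h : GentleConditions I) {α β β' : Arrow V}
    (hβ : arrowClass I β * arrowClass I α ≠ 0) (hβ' : arrowClass I β' * arrowClass I α ≠ 0) :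
    β = β' := by
  obtain ⟨x, y, α⟩ := α
  obtain ⟨z, y, β⟩ := β
  obtain ⟨z', y', β'⟩ := β'
  obtain rfl := target_eq_source hβ
  obtain rfl := target_eq_source hβ'
  by_contra hne
  dsimp only at hβ hβ'
  rw [ne_eq, arrowClass_mul_arrowClass_eq_zero] at hβ hβ'
  rcases h.left_unique α ⟨z, β⟩ ⟨z', β'⟩ (fun h => hne (by
    obtain ⟨rfl, h⟩ := Sigma.mk.inj h
    rw [eq_of_heq h])) with h | h
  · exact hβ h.1
  · exact hβ' h.1

/-- If each arrow of a gentle quiver can be continued by another arrow, then this continuation is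
given by a permutation of the arrows. -/
lemma GentleConditions.exists_perm (h : GentleConditions I)
    (hc : ∀ α : Arrow V, ∃ β, arrowClass I α * arrowClass I β ≠ 0) :
    ∃ σ : Equiv.Perm (Arrow V), ∀ α β, arrowClass I α * arrowClass I β ≠ 0 ↔ β = σ α := by
  choose f hf using hc
  have hinj : Function.Injective f := fun α α' hα => h.left_cancel (hf α) (hα ▸ hf α')
  refine ⟨Equiv.ofBijective f (Finite.injective_iff_bijective.1 hinj), fun α β => ⟨fun hβ =>
    h.right_cancel hβ (hf α), ?_⟩⟩
  rintro rfl
  exact hf α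

/-- The conditions of Artin-Schelter Gorensteinness in terms of the quiver. -/
lemma GentleConditions.isASGorenstein_iff (h : GentleConditions I)
    (hc : ∀ α : Arrow V, ∃ β, arrowClass I α * arrowClass I β ≠ 0) :
    IsASGorenstein (pathGrading I) ↔
      numArrows V = Fintype.card V ∨ numArrows V = 2 * Fintype.card V := by
  classical
  obtain ⟨σ, hσ⟩ := h.exists_perm hc
  obtain ⟨R, hR, hI⟩ := h.generated
  have hE : Nonempty (Arrow V) := Fintype.card_pos_iff.1 h.one_le_numArrows
  have hs := exists_arrow_of_connected (target_eq hσ) h.connected hE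
  let B := stringBasis hσ hR hI hs
  rw [numArrows_eq_card_iff hs, numArrows_eq_two_mul_card_iff h.outdeg_le]
  refine ⟨fun hA => ?_, B.isASGorenstein⟩
  rcases sources_trichotomy (target_eq hσ) h.connected with h2 | hinj | ⟨β, β', hne, hs, hb⟩
  · refine Or.inr fun x => ?_
    obtain ⟨⟨x, β⟩, ⟨x', β'⟩, hne, rfl, rfl⟩ := h2 x
    refine ⟨_, _, hne, ?_⟩
    rintro ⟨y, γ⟩
    refine ⟨?_, ?_⟩
    · rintro rfl
      -- A third arrow from this vertex would contradict the bound on the number of outgoing arrows.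
      by_contra! hγ
      refine absurd (h.outdeg_le y) (not_le.2 (Finset.two_lt_card.2 ⟨β, Finset.mem_univ _, β',
        Finset.mem_univ _, γ, Finset.mem_univ _, ?_⟩))
      refine ⟨?_, ?_, ?_⟩
      · exact fun h => hne (congrArg (Sigma.mk _) h)
      · exact fun h => hγ.1 (congrArg (Sigma.mk _) h.symm)
      · exact fun h => hγ.2 (congrArg (Sigma.mk _) h.symm)
    · rintro (h | h) <;> rw [h]
  · exact Or.inl hinj
  · exact absurd hA (B.not_isASGorenstein hne hs hb)

/-- The quivers with as many arrows as vertices. -/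
lemma GentleConditions.isTildeA_iff (h : GentleConditions I)
    (hc : ∀ α : Arrow V, ∃ β, arrowClass I α * arrowClass I β ≠ 0) :
    IsTildeA V ↔ numArrows V = Fintype.card V := by
  classical
  refine ⟨numArrows_of_isTildeA, fun hn => ?_⟩
  obtain ⟨σ, hσ⟩ := h.exists_perm hc
  have hE : Nonempty (Arrow V) := Fintype.card_pos_iff.1 h.one_le_numArrows
  have hs := exists_arrow_of_connected (target_eq hσ) h.connected hE
  have := h.nonempty
  exact isTildeA_of_injective (target_eq hσ) h.connected hs ((numArrows_eq_card_iff hs).1 hn)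

end Gentle

section

open GrMod

/-! ### The right socle and the depth -/

section Socle

variable {k : Type u} {A : Type a} [Field k] [Ring A] [Algebra k A]
  {𝒜 : ℤ → Submodule k A} [NonnegGraded 𝒜]

/-- The morphism `S ⟶ A[j]` given by an element of degree `j` of the right socle of `A`. -/
noncomputable def socleHom {j : ℤ} {x : A} (hx : x ∈ 𝒜 j)
    (h : ∀ n > 0, ∀ b ∈ 𝒜 n, x * b = 0) : simples 𝒜 ⟶ (regular 𝒜).shift j :=
  quotDesc _ (augmentation_stable 𝒜)
    (⟨fun i => AddMonoidHom.mk' (fun b : 𝒜 i =>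
          (⟨x * b, add_comm j i ▸ SetLike.mul_mem_graded hx b.2⟩ : 𝒜 (i + j)))
        fun _ _ => Subtype.ext (mul_add x _ _),
      fun _ _ _ => Subtype.ext (mul_assoc x _ _).symm⟩ :
      GrMod.Hom (regular 𝒜) ((regular 𝒜).shift j)) (by
    intro i b hb
    by_cases hi : 0 < i
    · exact Subtype.ext (h i hi _ (show 𝒜 i from b).2)
    · rw [augmentation, if_neg hi] at hb
      rw [AddSubgroup.mem_bot.1 hb, map_zero])

/-- An element of degree `j` of the right socle of `A` gives a nonzero morphism `S ⟶ A[j]`. -/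
lemma nontrivial_extSA_zero {j : ℤ} {x : A} (hx : x ∈ 𝒜 j) (hx0 : x ≠ 0)
    (h : ∀ n > 0, ∀ b ∈ 𝒜 n, x * b = 0) : Nontrivial (ExtSA 𝒜 0 j) := by
  refine ⟨⟨Abelian.Ext.mk₀ (socleHom hx h), 0, fun h0 => hx0 ?_⟩⟩
  rw [← Abelian.Ext.mk₀_zero] at h0
  have h1 := (Abelian.Ext.mk₀_bijective _ _).1 h0
  have h2 := congrArg (fun t : simples 𝒜 ⟶ (regular 𝒜).shift j =>
    t.app 0 ((quotπ _ _ (augmentation_stable 𝒜)).app 0 (unit 𝒜 0 rfl))) h1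
  have h3 : x * 1 = 0 := congrArg (Subtype.val (p := (· ∈ 𝒜 (0 + j)))) h2
  rwa [mul_one] at h3

/-- If there is an element of the right socle of `A`, then the depth of `A` is zero. -/
lemma HasDepth.eq_zero {d : ℕ} (hd : HasDepth 𝒜 d) {j : ℤ} {x : A} (hx : x ∈ 𝒜 j) (hx0 : x ≠ 0)
    (h : ∀ n > 0, ∀ b ∈ 𝒜 n, x * b = 0) : d = 0 :=
  Nat.le_zero.1 (hd.2 ⟨j, nontrivial_extSA_zero hx hx0 h⟩)

end Socle

/-! ### Gelfand–Kirillov dimension and freeness over a polynomial ring -/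

section Growth

variable {k : Type u} {A : Type a} [Field k] [Ring A] [Algebra k A]

lemma pow_one_sup_le (W : Submodule k A) {n m : ℕ} (h : n ≤ m) : (1 ⊔ W) ^ n ≤ (1 ⊔ W) ^ m :=
  pow_le_pow_right₀ le_sup_left h

/-- The Gelfand-Kirillov dimension of an infinite dimensional algebra that is generated by a finite
dimensional subspace is at least one. -/
lemma one_le_gkDim (hA : ¬ FiniteDimensional k A) {W : Submodule k A} (hW : FiniteDimensional k W)
    (hgen : ∀ x : A, ∃ n, x ∈ (1 ⊔ W) ^ n) : 1 ≤ gkDim k A := by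
  set U : Submodule k A := 1 ⊔ W with hU
  have hfg : ∀ n, FiniteDimensional k (U ^ n : Submodule k A) := fun n => by
    have h1 : (1 : Submodule k A).FG := by
      rw [Submodule.one_eq_span]
      exact Submodule.fg_span_singleton _
    exact Module.Finite.iff_fg.2 ((h1.sup (Module.Finite.iff_fg.1 hW)).pow n)
  have hle : ∀ n, U ^ n ≤ U ^ (n + 1) := fun n => pow_one_sup_le W n.le_succ
  -- If the powers of `U` stopped growing once, they would be constant from there on and equal to
  -- `A`, which would be finite dimensional.
  have hlt : ∀ n, U ^ n < U ^ (n + 1) := fun n => (hle n).lt_of_ne fun h => hA (by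
    have hs : ∀ m, U ^ (n + m) = U ^ n := fun m => by
      induction m with
      | zero => rfl
      | succ m ih => rw [← add_assoc, pow_succ, ih, ← pow_succ, ← h]
    have ht : U ^ n = ⊤ := by
      rw [eq_top_iff]
      rintro x -
      obtain ⟨m, hm⟩ := hgen x
      rw [← hs m]
      exact pow_one_sup_le W (Nat.le_add_left m n) hm
    have := hfg n
    rw [ht] at this
    exact Module.Finite.equiv (Submodule.topEquiv (R := k) (M := A)))
  have hmono : StrictMono fun n => Module.finrank k (U ^ n : Submodule k A) :=
    strictMono_nat_of_lt_succ fun n => Submodule.finrank_lt_finrank_of_lt (hlt n)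
  refine le_trans ?_ (le_iSup₂ (f := fun (W : Submodule k A) (_ : FiniteDimensional k W) =>
    Filter.limsup (fun n : ℕ => ((Real.log (Module.finrank k ((1 ⊔ W) ^ n : Submodule k A)) /
      Real.log n : ℝ) : EReal)) Filter.atTop) W hW)
  -- Strict growth gives `dim Uⁿ ≥ n`. From `n = 2` on the denominator `log n` is positive, and the
  -- quotient is at least one.
  refine Filter.le_limsup_of_frequently_le' (Filter.Eventually.frequently ?_)
  filter_upwards [Filter.eventually_ge_atTop 2] with n hn
  rw [← EReal.coe_one, EReal.coe_le_coe_iff, one_le_div (Real.log_pos (by exact_mod_cast hn))]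
  exact Real.log_le_log (by exact_mod_cast (by lia : 0 < n)) (by exact_mod_cast hmono.le_apply)

/-- An algebra that satisfies the second Cohen-Macaulay condition, whose Gelfand-Kirillov dimension
is at least one and whose part of degree zero is finite dimensional, has no right socle. -/
lemma CM2.eq_zero_of_mul_eq_zero {𝒜 : ℤ → Submodule k A} [NonnegGraded 𝒜] (h : CM2 𝒜)
    (hA : 1 ≤ gkDim k A) (h0 : FiniteDimensional k (𝒜 0)) {x : A}
    (hx : ∀ n > 0, ∀ b ∈ 𝒜 n, x * b = 0) : x = 0 := by
  obtain ⟨d, hd, ψ, hψ, hhom, m, y, hy⟩ := h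
  have hd1 : 1 ≤ d := by
    rw [hd] at hA
    exact_mod_cast hA
  let i : Fin d := ⟨0, hd1⟩
  have hX : ψ (MvPolynomial.X i) ≠ 0 := by
    rw [ne_eq, map_eq_zero_iff ψ hψ]
    exact MvPolynomial.X_ne_zero i
  obtain ⟨j, hj⟩ := hhom i
  rcases lt_trichotomy j 0 with hj0 | rfl | hj0
  · rw [NonnegGraded.eq_bot_of_neg (𝒜 := 𝒜) j hj0, Submodule.mem_bot] at hj
    exact absurd hj hX
  -- A variable of degree zero would be algebraic over `k`, since it lies in the finite dimensional
  -- algebra `A₀`.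
  · obtain ⟨p, hp, hp0⟩ := (IsIntegral.of_finite k (⟨_, hj⟩ : 𝒜 0)).isAlgebraic
    refine absurd (MvPolynomial.transcendental_X k i) (not_not.2 ⟨p, hp, hψ ?_⟩)
    rw [map_zero, ← Polynomial.aeval_algHom_apply]
    exact (Polynomial.aeval_algHom_apply (SetLike.GradeZero.subalgebra 𝒜).val ⟨_, hj⟩ p).trans
      (congrArg Subtype.val hp0)
  · obtain ⟨c, hc, -⟩ := hy x
    obtain ⟨c', -, hc'⟩ := hy 0
    -- As the variable kills `x`, multiplying the coordinates of `x` by it gives coordinates of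
    -- zero. By uniqueness they vanish, and polynomials over `k` have no zero divisors.
    have h1 : (fun l => c l * MvPolynomial.X i) = c' := hc' _ (by
      simp only [map_mul, ← mul_assoc, ← Finset.sum_mul]
      rw [← hc, hx j hj0 _ hj])
    have h2 : (fun _ => 0) = c' := hc' _ (by simp)
    rw [hc]
    refine Finset.sum_eq_zero fun l _ => ?_
    have h3 := congrFun (h1.trans h2.symm) l
    rw [(mul_eq_zero.1 h3).resolve_right (MvPolynomial.X_ne_zero i), map_zero, mul_zero]

end Growth

/-! ### Continuation of arrows in Cohen–Macaulay locally gentle algebras -/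

section Gentle

variable {k : Type u} {V : Type v} [Field k] [Fintype V] [DecidableEq V] [Quiver.{w} V]
  {I : TwoSidedIdeal (PathAlgebra k V)}

open PathAlgebra

lemma vertexClass_mem (v : V) : vertexClass I v ∈ pathGrading I 0 :=
  Submodule.subset_span ⟨v, v, Quiver.Path.nil, rfl, rfl⟩

lemma arrowClass_mem (α : Arrow V) : arrowClass I α ∈ pathGrading I 1 :=
  Submodule.subset_span ⟨_, _, α.2.2.toPath, rfl, rfl⟩

lemma pathGrading_zero : pathGrading I 0 = Submodule.span k (Set.range (vertexClass I)) := by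
  refine le_antisymm (Submodule.span_le.2 ?_) (Submodule.span_le.2 ?_)
  · rintro _ ⟨a, b, p, hp, rfl⟩
    obtain _ | ⟨p, α⟩ := p
    · exact Submodule.subset_span ⟨a, rfl⟩
    · rw [Quiver.Path.length_cons] at hp
      lia
  · rintro _ ⟨v, rfl⟩
    exact vertexClass_mem v

lemma finiteDimensional_pathGrading_zero : FiniteDimensional k (pathGrading I 0) := by
  rw [pathGrading_zero]
  exact FiniteDimensional.span_of_finite k (Set.finite_range _)

/-- The classes of the vertices and arrows generate `kQ / I`. -/
lemma exists_mem_pow (x : QuotAlgebra I) : ∃ n, x ∈ (1 ⊔ Submodule.span k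
    (Set.range (Sum.elim (vertexClass I) (arrowClass I)))) ^ n := by
  set W := Submodule.span k (Set.range (Sum.elim (vertexClass I) (arrowClass I)))
  obtain ⟨f, rfl⟩ := quotMk_surjective I x
  induction mem_span_ofPath f using Submodule.span_induction with
  | zero => exact ⟨0, by rw [map_zero]; exact zero_mem _⟩
  | add x y _ _ hx hy =>
    obtain ⟨n, hn⟩ := hx
    obtain ⟨m, hm⟩ := hy
    refine ⟨n + m, ?_⟩
    rw [map_add]
    exact add_mem (pow_one_sup_le W (Nat.le_add_right n m) hn)
      (pow_one_sup_le W (Nat.le_add_left m n) hm)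
  | smul c x _ hx =>
    obtain ⟨n, hn⟩ := hx
    exact ⟨n, by rw [map_smul]; exact Submodule.smul_mem _ _ hn⟩
  | mem x hx =>
    obtain ⟨a, b, p, rfl⟩ := hx
    refine ⟨p.length + 1, ?_⟩
    induction p with
    | nil =>
      rw [Quiver.Path.length_nil, zero_add, pow_one]
      exact Submodule.mem_sup_right (Submodule.subset_span ⟨Sum.inl a, rfl⟩)
    | cons p α ih =>
      rw [quotMk_cons, pow_succ, Quiver.Path.length_cons]
      exact Submodule.mul_mem_mul ih
        (Submodule.mem_sup_right (Submodule.subset_span ⟨Sum.inr ⟨_, _, α⟩, rfl⟩))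

lemma one_le_gkDim_quotAlgebra [∀ a b : V, Fintype (a ⟶ b)]
    (hI : ¬ FiniteDimensional k (QuotAlgebra I)) : 1 ≤ gkDim k (QuotAlgebra I) :=
  one_le_gkDim hI (FiniteDimensional.span_of_finite k (Set.finite_range _)) exists_mem_pow

/-- The arrows are nonzero in `kQ / I` if `I` is generated by paths of length two. -/
lemma arrowClass_ne_zero {R : Set (PathAlgebra k V)}
    (hR : ∀ r ∈ R, ∃ (a b : V) (p : Quiver.Path a b), p.length = 2 ∧ r = ofPath k p)
    (hI : I = TwoSidedIdeal.span R) (α : Arrow V) : arrowClass I α ≠ 0 := by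
  rw [arrowClass, ne_eq, quotMk_eq_zero, hI]
  intro h
  -- All paths that occur in elements of the ideal have length at least two, so this functional
  -- kills the ideal but not the arrow.
  let Φ : PathAlgebra k V →ₗ[k] k := lift fun _ _ p => if p.length = 1 then 1 else 0
  have h1 : Φ (ofPath k α.2.2.toPath) = 0 := map_eq_zero_of_mem_span Φ (fun r hr a b c d p q => by
    obtain ⟨x, y, z, hz, rfl⟩ := hR r hr
    by_cases hbx : b = x
    swap
    · rw [ofPath_mul_ofPath_of_ne _ _ hbx, zero_mul, map_zero]
    subst hbx
    by_cases hyc : y = c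
    swap
    · rw [mul_assoc, ofPath_mul_ofPath_of_ne _ _ hyc, mul_zero, map_zero]
    subst hyc
    rw [ofPath_mul_ofPath, ofPath_mul_ofPath, lift_ofPath, if_neg]
    rw [Quiver.Path.length_comp, Quiver.Path.length_comp]
    lia) h
  rw [lift_ofPath, Quiver.Path.length_toPath, if_pos rfl] at h1
  exact one_ne_zero h1

/-- An element that is annihilated by all arrows is annihilated by the elements of positive degree. -/
lemma mul_eq_zero_of_mul_arrowClass {x : QuotAlgebra I} (hx : ∀ β, x * arrowClass I β = 0) (n : ℤ)
    (hn : n > 0) (b : QuotAlgebra I) (hb : b ∈ pathGrading I n) : x * b = 0 := by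
  induction hb using Submodule.span_induction with
  | zero => exact mul_zero x
  | add y z _ _ hy hz => rw [mul_add, hy, hz, add_zero]
  | smul c y _ hy => rw [mul_smul_comm, hy, smul_zero]
  | mem y hy =>
    obtain ⟨a, b, p, hp, rfl⟩ := hy
    have hp0 : 0 < p.length := by lia
    clear hp
    induction p with
    | nil => exact absurd hp0 (lt_irrefl 0)
    | cons p α ih =>
      rw [quotMk_cons]
      obtain _ | ⟨p, β⟩ := p
      · change x * (vertexClass I _ * _) = 0
        rw [vertexClass_mul_arrowClass, if_pos rfl, hx]
      · rw [← mul_assoc, ih (Nat.succ_pos _), zero_mul]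

/-- In a locally gentle algebra that is Cohen-Macaulay, each arrow can be continued. -/
lemma IsLocallyGentle.exists_mul_ne_zero [∀ a b : V, Fintype (a ⟶ b)] (h : IsLocallyGentle I)
    (hCM : CM1 (pathGrading I) ∨ CM2 (pathGrading I)) (α : Arrow V) :
    ∃ β, arrowClass I α * arrowClass I β ≠ 0 := by
  by_contra! hα
  obtain ⟨R, hR, hI⟩ := h.1.generated
  have h0 := arrowClass_ne_zero hR hI α
  have h1 := mul_eq_zero_of_mul_arrowClass hα
  have hgk := one_le_gkDim_quotAlgebra h.2
  rcases hCM with ⟨d, hd, hgd⟩ | hCM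
  · rw [hgd, hd.eq_zero (arrowClass_mem α) h0 h1] at hgk
    exact absurd hgk (by simp)
  · exact h0 (hCM.eq_zero_of_mul_eq_zero hgk finiteDimensional_pathGrading_zero h1)

end Gentle

end

/-! ### Substitution of `t⁻¹` in rational functions -/

section RationalFunctions

open scoped LaurentSeries

variable {K : Type*} [Field K]

/-- The value at `t⁻¹` of a quotient of polynomials. -/
lemma eval_inv_X_div (p q : Polynomial K) (hq : q ≠ 0) :
    (algebraMap _ (RatFunc K) p / algebraMap _ _ q).eval RatFunc.C (RatFunc.X)⁻¹ =
      Polynomial.aeval (RatFunc.X : RatFunc K)⁻¹ p / Polynomial.aeval (RatFunc.X : RatFunc K)⁻¹ q := by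
  -- The evaluation is defined by the reduced numerator and denominator. As `t⁻¹` is transcendental,
  -- no denominator vanishes there, so any other representation as a quotient gives the same value.
  have htr : Transcendental K (RatFunc.X : RatFunc K)⁻¹ := fun h =>
    RatFunc.transcendental_X (inv_inv (RatFunc.X : RatFunc K) ▸ h.inv)
  have h0 : ∀ r : Polynomial K, r ≠ 0 → Polynomial.aeval (RatFunc.X : RatFunc K)⁻¹ r ≠ 0 :=
    fun r hr h => hr ((transcendental_iff.1 htr) r h)
  set x : RatFunc K := algebraMap _ (RatFunc K) p / algebraMap _ _ q
  have h1 : x.num * q = p * x.denom := (RatFunc.num_mul_eq_mul_denom_iff hq).2 rfl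
  have h2 := congrArg (Polynomial.aeval (RatFunc.X : RatFunc K)⁻¹) h1
  rw [map_mul, map_mul] at h2
  exact (div_eq_div_iff (h0 _ x.denom_ne_zero) (h0 q hq)).2 h2

/-- A power series whose coefficients are constant from the first one on is rational. -/
lemma coe_div_one_sub_X (v e : K) (f : PowerSeries K) (hf0 : PowerSeries.coeff 0 f = v)
    (hf : ∀ n, PowerSeries.coeff (n + 1) f = e) :
    ((algebraMap (Polynomial K) (RatFunc K) (Polynomial.C v + Polynomial.C (e - v) * Polynomial.X) /
      algebraMap (Polynomial K) (RatFunc K) (1 - Polynomial.X) : RatFunc K) : LaurentSeries K) = f := by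
  have h1 : (1 - Polynomial.X : Polynomial K) ≠ 0 := fun h => by
    simpa using congrArg (Polynomial.eval 0) h
  have h2 : f * ((1 - Polynomial.X : Polynomial K) : PowerSeries K) =
      ((Polynomial.C v + Polynomial.C (e - v) * Polynomial.X : Polynomial K) : PowerSeries K) := by
    ext n
    rw [Polynomial.coeff_coe, Polynomial.coe_sub, Polynomial.coe_one, Polynomial.coe_X, mul_sub,
      mul_one, map_sub]
    rcases n with _ | _ | n
    · simp [hf0]
    · rw [PowerSeries.coeff_succ_mul_X, hf, zero_add, hf0]
      simp
    · rw [PowerSeries.coeff_succ_mul_X, hf, hf]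
      simp
  have h3 := congrArg (HahnSeries.ofPowerSeries ℤ K) h2
  rw [map_mul, RatFunc.coe_coe, RatFunc.coe_coe] at h3
  let φ : RatFunc K →+* K⸨X⸩ :=
    letI := RatFunc.liftAlgebra K K⸨X⸩
    algebraMap _ _
  have h4 : φ (algebraMap (Polynomial K) (RatFunc K) (1 - Polynomial.X)) ≠ 0 := by
    rwa [ne_eq, map_eq_zero, map_eq_zero_iff _ (RatFunc.algebraMap_injective K)]
  change φ _ = _
  rw [map_div₀, div_eq_iff h4]
  exact h3.symm

/-- The symmetry of a rational function `v + e t / (1 - t)`. -/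
lemma eval_inv_symm_iff (v e : K) (hv : v ≠ 0) (he : e ≠ 0) (h : RatFunc K)
    (hh : h = algebraMap (Polynomial K) (RatFunc K) (Polynomial.C v + Polynomial.C (e - v) * Polynomial.X) /
      algebraMap (Polynomial K) (RatFunc K) (1 - Polynomial.X)) :
    (∃ m : ℤ, h.eval RatFunc.C (RatFunc.X)⁻¹ = RatFunc.X ^ m * h ∨
      h.eval RatFunc.C (RatFunc.X)⁻¹ = -(RatFunc.X ^ m * h)) ↔
      e = v ∨ e = 2 * v := by
  have h1 : (1 - Polynomial.X : Polynomial K) ≠ 0 := fun h => by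
    simpa using congrArg (Polynomial.eval 0) h
  let ι : Polynomial K →+* RatFunc K := algebraMap _ _
  have hι : Function.Injective ι := RatFunc.algebraMap_injective K
  have hX : ι Polynomial.X = RatFunc.X := RatFunc.algebraMap_X
  have hX0 : (RatFunc.X : RatFunc K) ≠ 0 := RatFunc.X_ne_zero
  have h1' : 1 - (RatFunc.X : RatFunc K) ≠ 0 := by
    rw [← hX, ← map_one ι, ← map_sub]
    exact (map_ne_zero_iff ι hι).2 h1
  -- Here `h = Q / (1 - t)` with `Q = v + (e - v) t`. Substituting `t⁻¹` reverses `Q` to `P` and the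
  -- denominator to its negative, so the symmetry means `P = ± tᵐ Q`.
  let P : Polynomial K := Polynomial.C (e - v) + Polynomial.C v * Polynomial.X
  let Q : Polynomial K := Polynomial.C v + Polynomial.C (e - v) * Polynomial.X
  have key : h.eval RatFunc.C (RatFunc.X)⁻¹ = - ι P / (1 - RatFunc.X) := by
    have h2 : (RatFunc.X : RatFunc K) - 1 ≠ 0 := by
      rw [← neg_sub]; exact neg_ne_zero.2 h1'
    have h3 : Polynomial.aeval (RatFunc.X : RatFunc K)⁻¹ (1 - Polynomial.X : Polynomial K) =
        1 - (RatFunc.X)⁻¹ := by simp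
    rw [hh, eval_inv_X_div _ _ h1, h3]
    have hC : ∀ c : K, ι (Polynomial.C c) = algebraMap K (RatFunc K) c := fun c => rfl
    simp only [P, map_add, map_mul, hX, Polynomial.aeval_C, Polynomial.aeval_X, hC]
    generalize algebraMap K (RatFunc K) (e - v) = r
    generalize algebraMap K (RatFunc K) v = s
    field_simp
    ring
  have hhQ : h = ι Q / (1 - RatFunc.X) := by rw [hh, map_sub _ 1, map_one, RatFunc.algebraMap_X]
  have hiff : ∀ m : ℤ, (h.eval RatFunc.C (RatFunc.X)⁻¹ = RatFunc.X ^ m * h ∨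
      h.eval RatFunc.C (RatFunc.X)⁻¹ = -(RatFunc.X ^ m * h)) ↔
      ι P = -(RatFunc.X ^ m * ι Q) ∨ ι P = RatFunc.X ^ m * ι Q := fun m => by
    rw [key, hhQ, ← mul_div_assoc, ← neg_div, div_left_inj' h1', div_left_inj' h1', neg_inj,
      neg_eq_iff_eq_neg]
  simp only [hiff]
  have hP0 : P.coeff 0 = e - v := by simp [P]
  have hQ0 : Q.coeff 0 = v := by simp [Q]
  constructor
  · rintro ⟨m, hm⟩
    have hm' : ∃ ε : K, (ε = 1 ∨ ε = -1) ∧ ι P = RatFunc.X ^ m * ι (Polynomial.C ε * Q) := by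
      rcases hm with hm | hm
      · exact ⟨-1, Or.inr rfl, by rw [hm]; simp⟩
      · exact ⟨1, Or.inl rfl, by rw [hm]; simp⟩
    obtain ⟨ε, hε, hm'⟩ := hm'
    -- Comparison of constant terms: `m < 0` forces `v = 0`, `m = 0` forces `e - v = ± v`, and `m >
    -- 0` forces `e - v = 0`.
    rcases lt_trichotomy m 0 with hm0 | rfl | hm0
    · obtain ⟨n, rfl⟩ : ∃ n : ℕ, m = -(n + 1 : ℕ) := ⟨(-m - 1).toNat, by lia⟩
      rw [zpow_neg, eq_inv_mul_iff_mul_eq₀ (zpow_ne_zero _ hX0), zpow_natCast, ← hX, ← map_pow,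
        ← map_mul] at hm'
      have h2 := congrArg (Polynomial.coeff · 0) (hι hm')
      simp only [pow_succ, Polynomial.mul_coeff_zero, Polynomial.coeff_X_zero, mul_zero, zero_mul,
        Polynomial.coeff_C_zero, hQ0] at h2
      have h3 : ε * v = 0 := h2.symm
      rcases hε with rfl | rfl
      · exact absurd (by simpa using h3) hv
      · exact absurd (by simpa using h3) hv
    · rw [zpow_zero, one_mul] at hm'
      have h2 := congrArg (Polynomial.coeff · 0) (hι hm')
      simp only [Polynomial.mul_coeff_zero, Polynomial.coeff_C_zero, hQ0, hP0] at h2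
      rcases hε with rfl | rfl
      · right; linear_combination h2
      · exact absurd (by linear_combination h2) he
    · obtain ⟨n, rfl⟩ : ∃ n : ℕ, m = (n + 1 : ℕ) := ⟨(m - 1).toNat, by lia⟩
      rw [zpow_natCast, ← hX, ← map_pow, ← map_mul] at hm'
      have h2 := congrArg (Polynomial.coeff · 0) (hι hm')
      simp only [pow_succ, Polynomial.mul_coeff_zero, Polynomial.coeff_X_zero, mul_zero, zero_mul,
        hP0] at h2
      left; linear_combination h2
  · rintro (rfl | rfl)
    · exact ⟨1, Or.inr (by
        rw [zpow_one, ← hX, ← map_mul, show P = Polynomial.X * Q by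
          simp only [P, Q, sub_self, map_zero, zero_mul, add_zero, zero_add, mul_comm]])⟩
    · have h2 : 2 * v - v = v := by ring
      refine ⟨0, Or.inr ?_⟩
      rw [zpow_zero, one_mul]
      change ι (Polynomial.C (2 * v - v) + _) = ι (_ + Polynomial.C (2 * v - v) * _)
      rw [h2]

end RationalFunctions

/-! ### The Hilbert series of an algebra with a string basis -/

section Hilbert

variable {k : Type u} {A : Type a} [Field k] [Ring A] [Algebra k A]
  {𝒜 : ℤ → Submodule k A} {V : Type v} {E : Type w} [Fintype V] [DecidableEq V]
  [Fintype E] [DecidableEq E] (B : StringBasis 𝒜 V E)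

lemma hilbertSymmetric_iff_of_coe_eq (h₀ : RatFunc ℚ)
    (h : (h₀ : LaurentSeries ℚ) = (hilbertSeries 𝒜 : LaurentSeries ℚ)) :
    HilbertSymmetric 𝒜 ↔ ∃ m : ℤ,
      h₀.eval RatFunc.C (RatFunc.X)⁻¹ = RatFunc.X ^ m * h₀ ∨
      h₀.eval RatFunc.C (RatFunc.X)⁻¹ = -(RatFunc.X ^ m * h₀) := by
  rw [HilbertSymmetric, Subsingleton.elim (algebraMap ℚ (RatFunc ℚ)) RatFunc.C]
  refine ⟨?_, fun h' => ⟨h₀, h, h'⟩⟩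
  rintro ⟨h₁, hh₁, h'⟩
  -- The expansion into Laurent series is a ring homomorphism from a field, so the rational function
  -- is unique.
  obtain rfl : h₁ = h₀ := RingHom.injective _ (hh₁.trans h.symm)
  exact h'

namespace StringBasis

include B in
lemma finrank_zero : Module.finrank k (𝒜 0) = Fintype.card V := by
  rw [B.span_zero]
  exact finrank_span_eq_card (B.linearIndependent.comp Sum.inl Sum.inl_injective)

include B in
lemma finrank_succ (n : ℕ) : Module.finrank k (𝒜 (n + 1)) = Fintype.card E := by
  rw [B.span_succ]
  exact finrank_span_eq_card (B.linearIndependent.comp (fun γ => Sum.inr (γ, n))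
    (Sum.inr_injective.comp fun _ _ h => congrArg Prod.fst h))

include B in
/-- The symmetry of the Hilbert series `|V| + |E| t / (1 - t)`. -/
lemma hilbertSymmetric_iff [Nonempty V] [Nonempty E] : HilbertSymmetric 𝒜 ↔
    Fintype.card E = Fintype.card V ∨ Fintype.card E = 2 * Fintype.card V := by
  have h0 : PowerSeries.coeff 0 (hilbertSeries 𝒜) = (Fintype.card V : ℚ) := by
    rw [hilbertSeries, PowerSeries.coeff_mk, Nat.cast_zero, B.finrank_zero]
  have h1 : ∀ n, PowerSeries.coeff (n + 1) (hilbertSeries 𝒜) = (Fintype.card E : ℚ) := fun n => by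
    rw [hilbertSeries, PowerSeries.coeff_mk, Nat.cast_succ, B.finrank_succ]
  refine (hilbertSymmetric_iff_of_coe_eq _ (coe_div_one_sub_X _ _ _ h0 h1)).trans
    ((eval_inv_symm_iff _ _ (Nat.cast_ne_zero.2 Fintype.card_ne_zero)
      (Nat.cast_ne_zero.2 Fintype.card_ne_zero) _ rfl).trans ?_)
  norm_cast

end StringBasis

end Hilbert

/-! ### The equivalence for locally gentle Cohen–Macaulay algebras -/

section Gentle

variable {k : Type u} {V : Type v} [Field k] [Fintype V] [DecidableEq V] [Quiver.{w} V]
  [∀ a b : V, Fintype (a ⟶ b)] {I : TwoSidedIdeal (PathAlgebra k V)}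

lemma GentleConditions.hilbertSymmetric_iff (h : GentleConditions I)
    (hc : ∀ α : Arrow V, ∃ β, arrowClass I α * arrowClass I β ≠ 0) :
    HilbertSymmetric (pathGrading I) ↔
      numArrows V = Fintype.card V ∨ numArrows V = 2 * Fintype.card V := by
  classical
  obtain ⟨σ, hσ⟩ := h.exists_perm hc
  obtain ⟨R, hR, hI⟩ := h.generated
  have hE : Nonempty (Arrow V) := Fintype.card_pos_iff.1 h.one_le_numArrows
  have := h.nonempty
  exact (stringBasis hσ hR hI
    (exists_arrow_of_connected (target_eq hσ) h.connected hE)).hilbertSymmetric_iff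

/-- For locally gentle Cohen-Macaulay algebras the Artin-Schelter Gorenstein property, the symmetry
of the Hilbert series, and the combinatorial condition on the quiver are equivalent. -/
lemma IsLocallyGentle.tfae (h : IsLocallyGentle I)
    (hCM : CM1 (pathGrading I) ∨ CM2 (pathGrading I)) :
    List.TFAE
      [IsASGorenstein (pathGrading I),
       HilbertSymmetric (pathGrading I),
       IsTildeA V ∨ numArrows V = 2 * Fintype.card V] := by
  have hc := h.exists_mul_ne_zero hCM
  rw [h.1.isASGorenstein_iff hc, h.1.hilbertSymmetric_iff hc, h.1.isTildeA_iff hc]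
  tfae_finish

end Gentle

/-! ### Finite dimensional algebras are Cohen–Macaulay of dimension zero -/

section FiniteDimensional

variable {k : Type u} {A : Type a} [Field k] [Ring A] [Algebra k A]

/-- Finite dimensional algebras have Gelfand-Kirillov dimension zero. -/
lemma gkDim_eq_zero [FiniteDimensional k A] : gkDim k A = 0 := by
  have h : ∀ W : Submodule k A, Filter.limsup (fun n : ℕ => ((Real.log
      (Module.finrank k ((1 ⊔ W) ^ n : Submodule k A)) / Real.log n : ℝ) : EReal)) Filter.atTop =
      0 := fun W => by
    refine Filter.Tendsto.limsup_eq ?_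
    rw [← EReal.coe_zero, EReal.tendsto_coe]
    have hlog : Filter.Tendsto (fun n : ℕ => Real.log n) Filter.atTop Filter.atTop :=
      Real.tendsto_log_atTop.comp tendsto_natCast_atTop_atTop
    -- The numerators are bounded by `log (dim A)`, while `log n` tends to infinity.
    refine squeeze_zero (fun n => div_nonneg (Real.log_natCast_nonneg _) (Real.log_natCast_nonneg _))
      (fun n => div_le_div_of_nonneg_right ?_ (Real.log_natCast_nonneg _))
      (hlog.const_div_atTop (Real.log (Module.finrank k A)))
    rcases Nat.eq_zero_or_pos (Module.finrank k ((1 ⊔ W) ^ n : Submodule k A)) with h0 | h0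
    · rw [h0, Nat.cast_zero, Real.log_zero]
      exact Real.log_natCast_nonneg _
    · exact Real.log_le_log (by exact_mod_cast h0) (by exact_mod_cast Submodule.finrank_le _)
  rw [gkDim]
  refine le_antisymm (iSup₂_le fun W _ => (h W).le) ?_
  exact (h ⊥).symm.le.trans (le_iSup₂_of_le (⊥ : Submodule k A) inferInstance le_rfl)

/-- Finite dimensional algebras satisfy the second Cohen-Macaulay condition. -/
lemma CM2_of_finiteDimensional [FiniteDimensional k A] [Nontrivial A] (𝒜 : ℤ → Submodule k A) :
    CM2 𝒜 := by
  -- The polynomial ring in no variables is `k`, so a basis of the vector space `A` will do.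
  let e := MvPolynomial.isEmptyAlgEquiv k (Fin 0)
  let y := Module.finBasis k A
  refine ⟨0, gkDim_eq_zero.trans Nat.cast_zero.symm, (Algebra.ofId k A).comp e.toAlgHom,
    (algebraMap k A).injective.comp e.injective, fun i => i.elim0, Module.finrank k A, y,
    fun x => ?_⟩
  have hC : ∀ c : Fin (Module.finrank k A) → MvPolynomial (Fin 0) k,
      ∑ i, y i * (Algebra.ofId k A).comp e.toAlgHom (c i) = ∑ i, e (c i) • y i := fun c =>
    Finset.sum_congr rfl fun i _ => by
      rw [Algebra.smul_def, Algebra.commutes]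
      rfl
  refine ⟨fun i => e.symm (y.repr x i), ?_, fun c hc => ?_⟩
  · dsimp only
    rw [hC]
    simp [Module.Basis.sum_repr]
  · dsimp only at hc
    rw [hC] at hc
    funext i
    rw [hc, Module.Basis.repr_sum_self, AlgEquiv.symm_apply_apply]

end FiniteDimensional

/-! ### Linear independence of paths in the absence of relations -/

section Degrees

variable {k : Type u} {V : Type v} [Field k] [Fintype V] [DecidableEq V] [Quiver.{w} V]
  {I : TwoSidedIdeal (PathAlgebra k V)}

open PathAlgebra

lemma pathGrading_one : pathGrading I 1 = Submodule.span k (Set.range (arrowClass I)) := by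
  refine le_antisymm (Submodule.span_le.2 ?_) (Submodule.span_le.2 ?_)
  · rintro _ ⟨a, b, p, hp, rfl⟩
    obtain _ | ⟨p, α⟩ := p
    · simp at hp
    · obtain _ | ⟨p, β⟩ := p
      · exact Submodule.subset_span ⟨⟨_, _, α⟩, rfl⟩
      · simp only [Quiver.Path.length_cons] at hp
        lia
  · rintro _ ⟨α, rfl⟩
    exact arrowClass_mem α

variable (k V) in
/-- The paths are linearly independent in the path algebra. -/
lemma linearIndependent_ofPath : LinearIndependent k
    (fun x : Σ a b : V, Quiver.Path a b => (ofPath k x.2.2 : PathAlgebra k V)) := by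
  let Φ : PathAlgebra k V →ₗ[k] ((Σ a b : V, Quiver.Path a b) →₀ k) :=
    lift fun a b p => Finsupp.single ⟨a, b, p⟩ 1
  refine LinearIndependent.of_comp Φ ?_
  convert (Finsupp.basisSingleOne (R := k) (ι := Σ a b : V, Quiver.Path a b)).linearIndependent
    using 1
  funext x
  rw [Function.comp_apply, lift_ofPath]
  simp

variable (k V) in
lemma linearIndependent_quotMk_bot : LinearIndependent k
    (fun x : Σ a b : V, Quiver.Path a b =>
      quotMk (⊥ : TwoSidedIdeal (PathAlgebra k V)) (ofPath k x.2.2)) :=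
  (linearIndependent_ofPath k V).map' (quotMk ⊥) (LinearMap.ker_eq_bot'.2 fun _ hf =>
    (TwoSidedIdeal.mem_bot _).1 (quotMk_eq_zero.1 hf))

end Degrees

/-! ### The Kronecker quiver as a gentle counterexample -/

section Kronecker

/-- The two vertices of the Kronecker quiver. -/
inductive KroneckerVertex : Type
  | source
  | target
  deriving DecidableEq

namespace KroneckerVertex

instance : Fintype KroneckerVertex := ⟨{source, target}, fun x => by cases x <;> simp⟩

/-- The Kronecker quiver, with two arrows from the first vertex to the second. -/
instance : Quiver.{0} KroneckerVertex := ⟨fun a b => {_x : Bool // a = source ∧ b = target}⟩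

instance (a b : KroneckerVertex) : Fintype (a ⟶ b) :=
  inferInstanceAs (Fintype {_x : Bool // a = source ∧ b = target})

/-- The arrows. -/
def arrow (x : Bool) : source ⟶ target :=
  (⟨x, rfl, rfl⟩ : {_x : Bool // source = source ∧ target = target})

lemma source_ne_target : source ≠ target := nofun

lemma arrow_eq {a b : KroneckerVertex} (α : a ⟶ b) : a = source ∧ b = target :=
  Subtype.prop (p := fun _ : Bool => a = source ∧ b = target) α

lemma isEmpty_comp {a b c : KroneckerVertex} (α : a ⟶ b) (β : b ⟶ c) : False :=
  source_ne_target ((arrow_eq β).1.symm.trans (arrow_eq α).2)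

lemma length_le_one {a b : KroneckerVertex} (p : Quiver.Path a b) : p.length ≤ 1 := by
  obtain _ | ⟨_ | ⟨p, α⟩, β⟩ := p
  · exact Nat.zero_le 1
  · exact le_rfl
  · exact (isEmpty_comp α β).elim

lemma card_arrow : Fintype.card (Arrow KroneckerVertex) = 2 := by decide

variable (k : Type u) [Field k]

/-- The conditions on gentle algebras hold for the Kronecker quiver without relations. -/
lemma gentleConditions : GentleConditions (⊥ : TwoSidedIdeal (PathAlgebra k KroneckerVertex)) where
  nonempty := ⟨source⟩
  one_le_numArrows := by rw [numArrows, card_arrow]; exact one_le_two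
  connected := by
    have h : ∀ x : KroneckerVertex, Quiver.WeaklyConnectedComponent.mk x =
        Quiver.WeaklyConnectedComponent.mk source := fun x => by
      cases x
      · rfl
      · exact ((Quiver.WeaklyConnectedComponent.eq source target).2
          ⟨Quiver.Hom.toPath (V := Quiver.Symmetrify KroneckerVertex) (Sum.inl (arrow true))⟩).symm
    refine ⟨fun x y => ?_⟩
    obtain ⟨x, rfl⟩ := Quotient.mk_surjective x
    obtain ⟨y, rfl⟩ := Quotient.mk_surjective y
    exact (h x).trans (h y).symm
  indeg_le := by decide
  outdeg_le := by decide
  left_unique α β _ _ := (isEmpty_comp β.2 α).elim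
  right_unique α β _ _ := (isEmpty_comp α β.2).elim
  generated := ⟨∅, fun _ h => h.elim,
    le_antisymm bot_le (TwoSidedIdeal.span_le.2 (Set.empty_subset _))⟩

variable {k}

open PathAlgebra

/-- The algebra of the Kronecker quiver. -/
abbrev Alg (k : Type u) [Field k] : Type u :=
  QuotAlgebra (⊥ : TwoSidedIdeal (PathAlgebra k KroneckerVertex))

lemma vertexClass_ne_zero (v : KroneckerVertex) :
    vertexClass (⊥ : TwoSidedIdeal (PathAlgebra k KroneckerVertex)) v ≠ 0 :=
  (linearIndependent_quotMk_bot k KroneckerVertex).ne_zero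
    (⟨v, v, Quiver.Path.nil⟩ : Σ a b : KroneckerVertex, Quiver.Path a b)

lemma arrow_ne_zero (α : Arrow KroneckerVertex) :
    arrowClass (⊥ : TwoSidedIdeal (PathAlgebra k KroneckerVertex)) α ≠ 0 :=
  (linearIndependent_quotMk_bot k KroneckerVertex).ne_zero
    (⟨_, _, α.2.2.toPath⟩ : Σ a b : KroneckerVertex, Quiver.Path a b)

instance : Nontrivial (Alg k) := ⟨⟨_, _, vertexClass_ne_zero source⟩⟩

instance : FiniteDimensional k (Alg k) := by
  refine Module.Finite.of_fg_top ?_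
  have h : (⊤ : Submodule k (Alg k)) =
      Submodule.span k (Set.range (Sum.elim (vertexClass ⊥) (arrowClass ⊥))) := by
    refine (eq_top_iff.2 ?_).symm
    rintro x -
    obtain ⟨f, rfl⟩ := quotMk_surjective _ x
    induction mem_span_ofPath f using Submodule.span_induction with
    | zero => simp
    | add x y _ _ hx hy => rw [map_add]; exact add_mem hx hy
    | smul c x _ hx => rw [map_smul]; exact Submodule.smul_mem _ _ hx
    | mem x hx =>
      obtain ⟨a, b, p, rfl⟩ := hx
      obtain _ | ⟨_ | ⟨p, α⟩, β⟩ := p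
      · exact Submodule.subset_span ⟨Sum.inl a, rfl⟩
      · exact Submodule.subset_span ⟨Sum.inr ⟨_, _, β⟩, rfl⟩
      · exact (isEmpty_comp α β).elim
  rw [h]
  exact Submodule.fg_span (Set.finite_range _)

lemma arrow_mul (α : Arrow KroneckerVertex) (n : ℤ) (hn : n > 0) (b : Alg k)
    (hb : b ∈ pathGrading ⊥ n) : arrowClass ⊥ α * b = 0 := by
  refine mul_eq_zero_of_mul_arrowClass (fun β => ?_) n hn b hb
  by_contra h
  exact source_ne_target ((arrow_eq β.2.2).1.symm.trans
    ((target_eq_source h).symm.trans (arrow_eq α.2.2).2))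

lemma target_mul (n : ℤ) (hn : n > 0) (b : Alg k) (hb : b ∈ pathGrading ⊥ n) :
    vertexClass ⊥ target * b = 0 := by
  refine mul_eq_zero_of_mul_arrowClass (fun β => ?_) n hn b hb
  rw [vertexClass_mul_arrowClass, if_neg]
  exact fun h => source_ne_target ((arrow_eq β.2.2).1.symm.trans h)

variable (k)

lemma nontrivial_extSA_zero_one :
    Nontrivial (ExtSA (pathGrading (⊥ : TwoSidedIdeal (PathAlgebra k KroneckerVertex))) 0 1) :=
  nontrivial_extSA_zero (arrowClass_mem ⟨_, _, arrow true⟩) (arrow_ne_zero _) (arrow_mul _)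

lemma nontrivial_extSA_zero_zero :
    Nontrivial (ExtSA (pathGrading (⊥ : TwoSidedIdeal (PathAlgebra k KroneckerVertex))) 0 0) :=
  nontrivial_extSA_zero (vertexClass_mem target) (vertexClass_ne_zero _) target_mul

lemma cm1 : CM1 (pathGrading (⊥ : TwoSidedIdeal (PathAlgebra k KroneckerVertex))) :=
  ⟨0, ⟨⟨1, nontrivial_extSA_zero_one k⟩, fun _ _ => Nat.zero_le _⟩,
    gkDim_eq_zero.trans Nat.cast_zero.symm⟩

/-- The right socle of the path algebra of the Kronecker quiver is not concentrated in one
degree. -/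
lemma not_isASGorenstein :
    ¬ IsASGorenstein (pathGrading (⊥ : TwoSidedIdeal (PathAlgebra k KroneckerVertex))) := by
  rintro ⟨d, -, -, hd, l, hl, -⟩
  have h0 := not_subsingleton_iff_nontrivial.2 (nontrivial_extSA_zero_zero k)
  have h1 := not_subsingleton_iff_nontrivial.2 (nontrivial_extSA_zero_one k)
  -- `Ext⁰(S, A)` is nonzero in the degrees zero and one, so the dimension could only be zero, and
  -- then one of these two degrees would have to be trivial.
  obtain rfl : d = 0 := by
    by_contra h
    exact h0 (hd 0 (Ne.symm h) 0)
  rcases eq_or_ne l 0 with rfl | hne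
  · exact h1 (hl 1 (by simp))
  · exact h0 (hl 0 (by simpa [eq_comm] using hne))

lemma finrank_zero :
    Module.finrank k (pathGrading (⊥ : TwoSidedIdeal (PathAlgebra k KroneckerVertex)) 0) = 2 := by
  rw [pathGrading_zero]
  exact finrank_span_eq_card ((linearIndependent_quotMk_bot k KroneckerVertex).comp
    (fun v => ⟨v, v, Quiver.Path.nil⟩) fun _ _ h => congrArg Sigma.fst h)

lemma finrank_one :
    Module.finrank k (pathGrading (⊥ : TwoSidedIdeal (PathAlgebra k KroneckerVertex)) 1) = 2 := by
  rw [pathGrading_one]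
  refine (finrank_span_eq_card ((linearIndependent_quotMk_bot k KroneckerVertex).comp
    (fun α : Arrow KroneckerVertex => ⟨_, _, α.2.2.toPath⟩) ?_)).trans card_arrow
  rintro ⟨a, b, α⟩ ⟨a', b', β⟩ h
  cases h
  rfl

lemma finrank_add_two (n : ℕ) : Module.finrank k
    (pathGrading (⊥ : TwoSidedIdeal (PathAlgebra k KroneckerVertex)) (n + 2 : ℕ)) = 0 := by
  have h : pathGrading (⊥ : TwoSidedIdeal (PathAlgebra k KroneckerVertex)) (n + 2 : ℕ) = ⊥ := by
    rw [pathGrading, Submodule.span_eq_bot]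
    rintro _ ⟨a, b, p, hp, rfl⟩
    have := length_le_one p
    lia
  rw [h, finrank_bot]

/-- The Hilbert series of the path algebra of the Kronecker quiver is `2 + 2 t`. -/
lemma hilbertSymmetric :
    HilbertSymmetric (pathGrading (⊥ : TwoSidedIdeal (PathAlgebra k KroneckerVertex))) := by
  let P : Polynomial ℚ := Polynomial.C 2 + Polynomial.C 2 * Polynomial.X
  have hP : (P : PowerSeries ℚ) =
      hilbertSeries (pathGrading (⊥ : TwoSidedIdeal (PathAlgebra k KroneckerVertex))) := by
    ext n
    rw [Polynomial.coeff_coe, hilbertSeries, PowerSeries.coeff_mk]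
    rcases n with _ | _ | n
    · rw [Nat.cast_zero, finrank_zero]
      simp [P]
    · rw [zero_add, Nat.cast_one, finrank_one]
      simp [P]
    · rw [finrank_add_two]
      simp [P]
  rw [hilbertSymmetric_iff_of_coe_eq (algebraMap (Polynomial ℚ) (RatFunc ℚ) P)
    (by rw [← hP]; exact (RatFunc.coe_coe P).symm)]
  -- The exponent is minus the degree of the series: `2 + 2t⁻¹ = t⁻¹ (2 + 2t)`.
  refine ⟨-1, Or.inl ?_⟩
  have h := eval_inv_X_div P 1 one_ne_zero
  rw [map_one, map_one, div_one, div_one] at h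
  rw [h]
  have hX : (RatFunc.X : RatFunc ℚ) ≠ 0 := RatFunc.X_ne_zero
  simp only [P, map_add, map_mul, Polynomial.aeval_C, Polynomial.aeval_X, RatFunc.algebraMap_X,
    RatFunc.algebraMap_C, zpow_neg_one, RatFunc.algebraMap_eq_C]
  generalize (RatFunc.C 2 : RatFunc ℚ) = c
  field_simp
  ring

end KroneckerVertex

end Kronecker

end LocGentle

theorem theorem5p8 (k : Type u) [Field k] [CharZero k] :
    (∀ (V : Type v) [Fintype V] [DecidableEq V] [Quiver.{w} V] [∀ a b : V, Fintype (a ⟶ b)]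
      (I : TwoSidedIdeal (PathAlgebra k V)), IsLocallyGentle I →
      (CM1 (pathGrading I) ∨ CM2 (pathGrading I)) →
      List.TFAE
        [IsASGorenstein (pathGrading I),
         HilbertSymmetric (pathGrading I),
         IsTildeA V ∨ numArrows V = 2 * Fintype.card V]) ∧
    (∃ (V : Type) (_ : Fintype V) (_ : DecidableEq V) (_ : Quiver.{0} V)
      (_ : ∀ a b : V, Fintype (a ⟶ b)) (I : TwoSidedIdeal (PathAlgebra k V)),
      IsGentle I ∧ CM1 (pathGrading I) ∧ CM2 (pathGrading I) ∧
      HilbertSymmetric (pathGrading I) ∧ ¬ IsASGorenstein (pathGrading I)) := by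
  refine ⟨fun V _ _ _ _ I hI hCM => hI.tfae hCM, ?_⟩
  exact ⟨KroneckerVertex, inferInstance, inferInstance, inferInstance, inferInstance, ⊥,
    ⟨KroneckerVertex.gentleConditions k, inferInstance⟩, KroneckerVertex.cm1 k,
    CM2_of_finiteDimensional _, KroneckerVertex.hilbertSymmetric k,
    KroneckerVertex.not_isASGorenstein k⟩
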